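/- Let $k$ be a commutative ring (with $1$) and let $H$ be a quasi-Hopf algebra over $k$: a $k$-algebra with algebra homomorphisms $\Delta:H\to H\otimes H$ and $\epsilon:H\to k$, an invertible associator $\phi=\phi^{(1)}\otimes\phi^{(2)}\otimes\phi^{(3)}\in H\otimes H\otimes H$, and a quasi-antipode $(S,\alpha,\beta)$ consisting of an algebra anti-automorphism $S$ of $H$ and $\alpha,\beta\in H$, such that $(\epsilon\otimes \mathrm{id})\Delta(h)=h=(\mathrm{id}\otimes\epsilon)\Delta(h)$, $(\mathrm{id}\otimes\Delta)\Delta(h)\cdot\phi=\phi\cdot(\Delta\otimes\mathrm{id})\Delta(h)$, $(\mathrm{id}\otimes\mathrm{id}\otimes\Delta)(\phi)\cdot(\Delta\otimes\mathrm{id}\otimes\mathrm{id})(\phi)=(1\otimes\phi)\cdot(\mathrm{id}\otimes\Delta\otimes\mathrm{id})(\phi)\cdot(\phi\otimes1)$, $(\mathrm{id}\otimes\epsilon\otimes\mathrm{id})(\phi)=1\otimes 1$, $S(h_{(1)})\alpha h_{(2)}=\epsilon(h)\alpha$, $h_{(1)}\beta S(h_{(2)})=\epsilon(h)\beta$, $\phi^{(1)}\beta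 S(\phi^{(2)})\alpha\phi^{(3)}=1$ and $S(\phi^{(-1)})\alpha\phi^{(-2)}\beta S(\phi^{(-3)})=1$, where $\phi^{-1}=\phi^{(-1)}\otimes\phi^{(-2)}\otimes\phi^{(-3)}$. Let ${}^H\mathscr M$ be the monoidal category of left $H$-modules: $H$ acts on $V\otimes W=V\otimes_k W$ by $h\triangleright(v\otimes w)=(h_{(1)}\triangleright v)\otimes(h_{(2)}\triangleright w)$, the unit object is $k$ with action through $\epsilon$, the associator is the action of $\phi$, and the unitors are those of $k$-modules. It is closed: $\mathrm{hom}(V,W)=\mathrm{Hom}_k(V,W)$ with $h\triangleright L=(h_{(1)}\triangleright\,\cdot\,)\circ L\circ(S(h_{(2)})\triangleright\,\cdot\,)$, with natural bijections $\mathrm{Hom}(V\otimes W,X)\cong\mathrm{Hom}(V,\mathrm{hom}(W,X))$, $f\mapsto\big(v\mapsto f(\phi^{(-1)}\triangleright v\otimes(\phi^{(-2)}\beta S(\phi^{(-3)}))\triangleright\,\cdot\,)\big)$, and evaluation $\mathrm{ev}(L\otimes v)=\phi^{(1)}\triangleright L\big((S(\phi^{(2)})\alpha\phi^{(3)})\triangleright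 v\big)$. Let $A$ be an algebra (monoid) in ${}^H\mathscr M$ and let ${}^H{}_A\mathscr M_A$ be the category of $A$-bimodules in ${}^H\mathscr M$. It is a closed monoidal category: the tensor product $V\otimes_A W$ is the coequalizer of the two maps $(V\otimes A)\otimes W\rightrightarrows V\otimes W$ given by the right $A$-action on $V$ and the left $A$-action on $W$; the unit object is $A$; and the internal hom $\mathrm{hom}_A(V,W)\subseteq\mathrm{hom}(V,W)$ is the $H$-submodule of right $A$-linear internal homomorphisms, i.e. the equalizer of the two maps $\mathrm{hom}(V,W)\rightrightarrows\mathrm{hom}(V\otimes A,W)$ obtained by currying $\mathrm{ev}\circ(\mathrm{id}\otimes r_V)$ and $r_W\circ(\mathrm{ev}\otimes\mathrm{id}_A)\circ\Phi^{-1}$, where $\Phi$ is the associator and $r_V,r_W$ are the right actions. Its left (respectively right) $A$-action is given by internal composition with the left action of $A$ on $W$ (respectively on $V$), viewed as a morphism $A\to\mathrm{hom}(W,W)$ (respectively $A\to\mathrm{hom}(V,V)$). There are natural bijections $\mathrm{Hom}(V\otimes_AW,X)\cong\mathrm{Hom}(V,\mathrm{hom}_A(W,X))$ induced by those in ${}^H\mathscr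 M$. Let $F=F^{(1)}\otimes F^{(2)}\in H\otimes H$ be a cochain twist, i.e. an invertible element with $(\epsilon\otimes\mathrm{id})(F)=1=(\mathrm{id}\otimes\epsilon)(F)$, and write $F^{-1}=F^{(-1)}\otimes F^{(-2)}$. Let $H_F$ be the twisted quasi-Hopf algebra: the algebra $H$ with the same $\epsilon$ and $S$ and with $\Delta_F(h)=F\Delta(h)F^{-1}$, $\phi_F=(1\otimes F)\,(\mathrm{id}\otimes\Delta)(F)\,\phi\,(\Delta\otimes\mathrm{id})(F^{-1})\,(F^{-1}\otimes1)$, $\alpha_F=S(F^{(-1)})\alpha F^{(-2)}$, $\beta_F=F^{(1)}\beta S(F^{(2)})$. Let $A_F$ be the algebra in ${}^{H_F}\mathscr M$ with the same underlying $H$-module and unit as $A$ and with product $a\star a'=(F^{(-1)}\triangleright a)(F^{(-2)}\triangleright a')$. Let $\mathcal F:{}^H{}_A\mathscr M_A\to{}^{H_F}{}_{A_F}\mathscr M_{A_F}$ be the functor that is the identity on underlying $H$-modules and on underlying maps and replaces the $A$-actions on $V$ by the $A_F$-actions $a\star v=(F^{(-1)}\triangleright a)(F^{(-2)}\triangleright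 v)$ and $v\star a=(F^{(-1)}\triangleright v)(F^{(-2)}\triangleright a)$. **Theorem.** The functor $\mathcal F$ is an equivalence of closed monoidal categories between ${}^H{}_A\mathscr M_A$ and ${}^{H_F}{}_{A_F}\mathscr M_{A_F}$, with the following coherence maps. That is: $\mathcal F$ is an equivalence of categories; the maps $$\varphi^A_{V,W}:\mathcal F(V)\otimes_{A_F}\mathcal F(W)\to\mathcal F(V\otimes_AW),\quad v\otimes_{A_F}w\mapsto (F^{(-1)}\triangleright v)\otimes_A(F^{(-2)}\triangleright w),$$ $$\psi^A:A_F\to\mathcal F(A),\quad a\mapsto a,$$ are well-defined isomorphisms that make $\mathcal F$ a (strong) monoidal functor; and the maps $$\gamma^A_{V,W}:\mathrm{hom}_{A_F}(\mathcal F(V),\mathcal F(W))\to\mathcal F(\mathrm{hom}_A(V,W)),\quad L\mapsto (F^{(-1)}\triangleright\,\cdot\,)\circ L\circ(S(F^{(-2)})\triangleright\,\cdot\,),$$ are well-defined isomorphisms of $A_F$-bimodules in ${}^{H_F}\mathscr M$, natural in $V$ and $W$, and compatible with the evaluations: $\mathcal F(\mathrm{ev}^A_{V,W})\circ\varphi^A_{\mathrm{hom}_A(V,W),V}\circ(\gamma^A_{V,W}\otimes_{A_F}\mathrm{id}_{\mathcal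 F(V)})=\mathrm{ev}^{A_F}_{\mathcal F(V),\mathcal F(W)}$. -/

import Mathlib

open CategoryTheory MonoidalCategory Limits
open scoped TensorProduct

universe u v

section TensorTools

variable {k : Type u} [CommRing k]

/-- The linear map `x ⊗ y ↦ S(x) a y`. -/
noncomputable def sandwichLeft {H : Type v} [Ring H] [Algebra k H] (S : H →ₗ[k] H) (a : H) :
    H ⊗[k] H →ₗ[k] H :=
  LinearMap.mul' k H ∘ₗ TensorProduct.map ((LinearMap.mulRight k a) ∘ₗ S) LinearMap.id

/-- The linear map `x ⊗ y ↦ x b S(y)`. -/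
noncomputable def sandwichRight {H : Type v} [Ring H] [Algebra k H] (S : H →ₗ[k] H) (b : H) :
    H ⊗[k] H →ₗ[k] H :=
  LinearMap.mul' k H ∘ₗ TensorProduct.map (LinearMap.mulRight k b) S

@[simp] theorem sandwichLeft_tmul {H : Type v} [Ring H] [Algebra k H] (S : H →ₗ[k] H) (a x y : H) :
    sandwichLeft S a (x ⊗ₜ[k] y) = S x * a * y := by
  simp [sandwichLeft]

@[simp] theorem sandwichRight_tmul {H : Type v} [Ring H] [Algebra k H] (S : H →ₗ[k] H)
    (b x y : H) : sandwichRight S b (x ⊗ₜ[k] y) = x * b * S y := by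
  simp [sandwichRight]

/-- `Δ ⊗ id : H ⊗ B → H ⊗ (H ⊗ B)`, for an algebra homomorphism `Δ : H → H ⊗ H`. -/
noncomputable def comulFst {H : Type v} [Ring H] [Algebra k H] (Δ : H →ₐ[k] H ⊗[k] H)
    (B : Type v) [Ring B] [Algebra k B] : H ⊗[k] B →ₐ[k] H ⊗[k] (H ⊗[k] B) :=
  (Algebra.TensorProduct.assoc k k k H H B).toAlgHom.comp
    (Algebra.TensorProduct.map Δ (AlgHom.id k B))

/-- `id ⊗ f : H ⊗ B → H ⊗ C`, for an algebra homomorphism `f : B → C`. -/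
noncomputable def mapSnd (H : Type v) [Ring H] [Algebra k H] {B C : Type v} [Ring B] [Algebra k B]
    [Ring C] [Algebra k C] (f : B →ₐ[k] C) : H ⊗[k] B →ₐ[k] H ⊗[k] C :=
  Algebra.TensorProduct.map (AlgHom.id k H) f

/-- `ε ⊗ id : H ⊗ B → B`, for an algebra homomorphism `ε : H → k`. -/
noncomputable def counitFst {H : Type v} [Ring H] [Algebra k H] (ε : H →ₐ[k] k)
    (B : Type v) [Ring B] [Algebra k B] : H ⊗[k] B →ₐ[k] B :=
  (Algebra.TensorProduct.lid k B).toAlgHom.comp (Algebra.TensorProduct.map ε (AlgHom.id k B))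

/-- `id ⊗ ε : H ⊗ H → H`, for an algebra homomorphism `ε : H → k`. -/
noncomputable def counitSnd {H : Type v} [Ring H] [Algebra k H] (ε : H →ₐ[k] k) :
    H ⊗[k] H →ₐ[k] H :=
  (Algebra.TensorProduct.rid k k H).toAlgHom.comp (Algebra.TensorProduct.map (AlgHom.id k H) ε)

/-- `X ↦ 1 ⊗ X`. -/
noncomputable def oneTmul (H : Type v) [Ring H] [Algebra k H] (B : Type v) [Ring B] [Algebra k B] :
    B →ₐ[k] H ⊗[k] B :=
  Algebra.TensorProduct.includeRight

/-- `X ↦ X ⊗ 1` as a map `H ⊗ H → H ⊗ (H ⊗ B)`. -/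
noncomputable def tmulOne (H : Type v) [Ring H] [Algebra k H] (B : Type v) [Ring B] [Algebra k B] :
    H ⊗[k] H →ₐ[k] H ⊗[k] (H ⊗[k] B) :=
  mapSnd H Algebra.TensorProduct.includeLeft

/-- An algebra anti-automorphism of `H`, viewed as a `k`-linear endomorphism. -/
def antiLin {H : Type v} [Ring H] [Algebra k H] (S : H ≃ₐ[k] Hᵐᵒᵖ) : H →ₗ[k] H :=
  (MulOpposite.opLinearEquiv k).symm.toLinearMap ∘ₗ S.toLinearMap

variable {H : Type v} [Ring H] [Algebra k H] {B C : Type v} [Ring B] [Algebra k B]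
    [Ring C] [Algebra k C]

theorem antiLin_mul (S : H ≃ₐ[k] Hᵐᵒᵖ) (x y : H) : antiLin S (x * y) = antiLin S y * antiLin S x := by
  simp [antiLin]

theorem antiLin_one (S : H ≃ₐ[k] Hᵐᵒᵖ) : antiLin S 1 = 1 := by
  simp [antiLin]

@[simp] theorem mapSnd_tmul (f : B →ₐ[k] C) (h : H) (b : B) :
    mapSnd H f (h ⊗ₜ[k] b) = h ⊗ₜ f b := rfl

@[simp] theorem counitFst_tmul (ε : H →ₐ[k] k) (h : H) (b : B) :
    counitFst ε B (h ⊗ₜ[k] b) = ε h • b := by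
  simp [counitFst]

@[simp] theorem counitSnd_tmul (ε : H →ₐ[k] k) (h h' : H) :
    counitSnd ε (h ⊗ₜ[k] h') = ε h' • h := by
  simp [counitSnd]

@[simp] theorem oneTmul_apply (b : B) : oneTmul (k := k) H B b = 1 ⊗ₜ b := rfl

@[simp] theorem tmulOne_tmul (x y : H) : tmulOne H B (x ⊗ₜ[k] y) = x ⊗ₜ (y ⊗ₜ 1) := rfl

theorem comulFst_tmul (Δ : H →ₐ[k] H ⊗[k] H) (h : H) (b : B) :
    comulFst Δ B (h ⊗ₜ[k] b) = Algebra.TensorProduct.assoc k k k H H B (Δ h ⊗ₜ b) := rfl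

end TensorTools

/-- A quasi-Hopf algebra structure on the `k`-algebra `H`: coproduct `Δ`, counit `ε`, invertible
associator `φ ∈ H ⊗ H ⊗ H` and quasi-antipode `(S, α, β)`.  The antipode is an algebra
anti-automorphism, that is, an algebra isomorphism from `H` to its opposite algebra. -/
structure QuasiHopfAlgebra (k : Type u) (H : Type v) [CommRing k] [Ring H] [Algebra k H] where
  /-- the coproduct -/
  comul : H →ₐ[k] H ⊗[k] H
  /-- the counit -/
  counit : H →ₐ[k] k
  /-- the associator -/
  assoc : (H ⊗[k] (H ⊗[k] H))ˣ
  counit_comul : ∀ h, counitFst counit H (comul h) = h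
  comul_counit : ∀ h, counitSnd counit (comul h) = h
  coassoc : ∀ h, mapSnd H comul (comul h) * assoc = assoc * comulFst comul H (comul h)
  cocycle : mapSnd H (mapSnd H comul) assoc * comulFst comul (H ⊗[k] H) assoc =
    oneTmul H (H ⊗[k] (H ⊗[k] H)) assoc * mapSnd H (comulFst comul H) assoc *
      mapSnd H (tmulOne H H) assoc
  counit_assoc : mapSnd H (counitFst counit H) assoc = 1
  /-- the antipode -/
  antipode : H ≃ₐ[k] Hᵐᵒᵖ
  /-- the element `α` -/
  α : H
  /-- the element `β` -/
  β : H
  antipode_left : ∀ h,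
    sandwichLeft (antiLin antipode) α
      (comul h) = counit h • α
  antipode_right : ∀ h,
    sandwichRight (antiLin antipode) β
      (comul h) = counit h • β
  antipode_assoc :
    sandwichRight LinearMap.id β (TensorProduct.map LinearMap.id
      (sandwichLeft (antiLin antipode) α)
      (assoc : H ⊗[k] (H ⊗[k] H))) = 1
  antipode_assoc_inv :
    sandwichLeft (antiLin antipode) α
      (TensorProduct.map LinearMap.id
      (sandwichRight (antiLin antipode) β)
      ((assoc⁻¹ : (H ⊗[k] (H ⊗[k] H))ˣ) : H ⊗[k] (H ⊗[k] H))) = 1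

/-- A cochain twist based on `Q`: an invertible element `F ∈ H ⊗ H` with
`(ε ⊗ id) F = 1 = (id ⊗ ε) F`. -/
structure CochainTwist {k : Type u} {H : Type v} [CommRing k] [Ring H] [Algebra k H]
    (Q : QuasiHopfAlgebra k H) where
  /-- the invertible element `F` -/
  F : (H ⊗[k] H)ˣ
  counit_left : counitFst Q.counit H F = 1
  counit_right : counitSnd Q.counit (F : H ⊗[k] H) = 1

section TwistTools

variable {k : Type u} [CommRing k] {H : Type v} [Ring H] [Algebra k H] {B C : Type v} [Ring B]
  [Algebra k B] [Ring C] [Algebra k C]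

/-- The algebra homomorphism `h ↦ u f(h) u⁻¹`. -/
noncomputable def conjHom (f : B →ₐ[k] C) (u : Cˣ) : B →ₐ[k] C :=
  AlgHom.ofLinearMap (LinearMap.mulLeft k (u : C) ∘ₗ LinearMap.mulRight k ((u⁻¹ : Cˣ) : C) ∘ₗ
    f.toLinearMap) (by simp) (by intro x y; simp [mul_assoc])

theorem conjHom_apply (f : B →ₐ[k] C) (u : Cˣ) (b : B) :
    conjHom f u b = u * f b * ((u⁻¹ : Cˣ) : C) := by
  simp [conjHom, mul_assoc]

/-- The image of an invertible element under an algebra homomorphism. -/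
def unitMap (f : B →ₐ[k] C) (u : Bˣ) : Cˣ := Units.map (f : B →* C) u

@[simp] theorem unitMap_val (f : B →ₐ[k] C) (u : Bˣ) : (unitMap f u : C) = f u := rfl

@[simp] theorem unitMap_inv_val (f : B →ₐ[k] C) (u : Bˣ) :
    (((unitMap f u)⁻¹ : Cˣ) : C) = f ((u⁻¹ : Bˣ) : B) := rfl

theorem unitMap_mul (f : B →ₐ[k] C) (u v : Bˣ) : unitMap f (u * v) = unitMap f u * unitMap f v :=
  map_mul _ u v

theorem unitMap_inv (f : B →ₐ[k] C) (u : Bˣ) : unitMap f u⁻¹ = (unitMap f u)⁻¹ :=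
  map_inv _ u

theorem mapSnd_conjHom (f : B →ₐ[k] C) (u : Cˣ) (X : H ⊗[k] B) :
    mapSnd H (conjHom f u) X =
      oneTmul H C u * mapSnd H f X * oneTmul H C ((u⁻¹ : Cˣ) : C) := by
  induction X with
  | zero => simp
  | tmul x y => simp [conjHom_apply]
  | add x y hx hy => simp [hx, hy, mul_add, add_mul]

theorem assoc_tmul_one (X : H ⊗[k] H) :
    Algebra.TensorProduct.assoc k k k H H B (X ⊗ₜ 1) = tmulOne H B X := by
  induction X with
  | zero => simp
  | tmul x y => simp
  | add x y hx hy => simp [hx, hy, TensorProduct.add_tmul]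

theorem comulFst_conjHom (f : H →ₐ[k] H ⊗[k] H) (u : (H ⊗[k] H)ˣ) (X : H ⊗[k] B) :
    comulFst (conjHom f u) B X =
      tmulOne H B u * comulFst f B X * tmulOne H B ((u⁻¹ : (H ⊗[k] H)ˣ) : H ⊗[k] H) := by
  induction X with
  | zero => simp
  | tmul x y =>
    simp only [comulFst_tmul, conjHom_apply, ← assoc_tmul_one, ← map_mul,
      Algebra.TensorProduct.tmul_mul_tmul, one_mul, mul_one]
  | add x y hx hy => simp [hx, hy, mul_add, add_mul]

theorem mapSnd_comp_apply {D : Type v} [Ring D] [Algebra k D] (g : C →ₐ[k] D) (f : B →ₐ[k] C)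
    (X : H ⊗[k] B) : mapSnd H g (mapSnd H f X) = mapSnd H (g.comp f) X := by
  induction X with
  | zero => simp
  | tmul x y => simp
  | add x y hx hy => simp [hx, hy]

theorem mapSnd_oneTmul (g : B →ₐ[k] C) (X : B) :
    mapSnd H g (oneTmul H B X) = oneTmul H C (g X) := by
  simp

theorem mapSnd_assoc_tmul (g : B →ₐ[k] C) (Z : H ⊗[k] H) (y : B) :
    mapSnd H (mapSnd H g) (Algebra.TensorProduct.assoc k k k H H B (Z ⊗ₜ y)) =
      Algebra.TensorProduct.assoc k k k H H C (Z ⊗ₜ g y) := by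
  induction Z with
  | zero => simp
  | tmul x y => simp
  | add x y hx hy => simp [hx, hy, TensorProduct.add_tmul]

theorem mapSnd_comulFst (f : H →ₐ[k] H ⊗[k] H) (g : B →ₐ[k] C) (X : H ⊗[k] B) :
    mapSnd H (mapSnd H g) (comulFst f B X) = comulFst f C (mapSnd H g X) := by
  induction X with
  | zero => simp
  | tmul x y => simp [comulFst_tmul, mapSnd_assoc_tmul]
  | add x y hx hy => simp [hx, hy]

theorem comulFst_oneTmul (f : H →ₐ[k] H ⊗[k] H) (X : B) :
    comulFst f B (oneTmul H B X) = oneTmul H (H ⊗[k] B) (oneTmul H B X) := by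
  simp [comulFst_tmul, Algebra.TensorProduct.one_def]

theorem mapSnd_tmulOne (g : B →ₐ[k] C) (X : H ⊗[k] H) :
    mapSnd H (mapSnd H g) (tmulOne H B X) = tmulOne H C X := by
  induction X with
  | zero => simp
  | tmul x y => simp
  | add x y hx hy => simp [hx, hy]

theorem tmulOne_comm (X : H ⊗[k] H) (Y : B) :
    tmulOne H B X * oneTmul H _ (oneTmul H B Y) =
      oneTmul H _ (oneTmul H B Y) * tmulOne H B X := by
  induction X with
  | zero => simp
  | tmul x y => simp
  | add x y hx hy => simp only [map_add, add_mul, mul_add, hx, hy]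

theorem mapSnd_comulFst_tmulOne (f : H →ₐ[k] H ⊗[k] H) (X : H ⊗[k] H) :
    mapSnd H (comulFst f B) (tmulOne H B X) = mapSnd H (tmulOne H B) (mapSnd H f X) := by
  induction X with
  | zero => simp
  | tmul x y => simp [comulFst_tmul, assoc_tmul_one]
  | add x y hx hy => simp [hx, hy]

theorem comulFst_tmulOne (f : H →ₐ[k] H ⊗[k] H) (X : H ⊗[k] H) :
    comulFst f (H ⊗[k] B) (tmulOne H B X) = mapSnd H (tmulOne H B) (comulFst f H X) := by
  induction X with
  | zero => simp
  | tmul x y =>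
    simp only [tmulOne_tmul, comulFst_tmul]
    generalize f x = Z
    induction Z with
    | zero => simp
    | tmul z w => simp
    | add x y hx hy => simp [hx, hy, TensorProduct.add_tmul]
  | add x y hx hy => simp [hx, hy]

theorem mapSnd_tmulOne_tmulOne (X : H ⊗[k] H) :
    mapSnd H (tmulOne H B) (tmulOne H H X) = tmulOne H (H ⊗[k] B) X := by
  induction X with
  | zero => simp
  | tmul x y => simp [Algebra.TensorProduct.one_def]
  | add x y hx hy => simp [hx, hy]

theorem cocycle_ring_lemma {A : Type v} [Ring A]
    (F12 F23 F34 D2F3 D2F1 D1F3 d3D2 d2D2 d2D1 dd d1D1 φ1 φ4 d1φ d2φ d3φ : A)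
    (F12' F23' F34' D1F3' D1F1' D2F1' d2D1' dd' d1D1' : A)
    (i1 : F12' * F12 = 1) (i2 : F23' * F23 = 1) (i3 : F34' * F34 = 1) (i4 : D1F3' * D1F3 = 1)
    (i5 : D2F1' * D2F1 = 1) (i6 : d2D1' * d2D1 = 1) (i7 : d1D1 * d1D1' = 1) (i8 : dd' * dd = 1)
    (comm : F12 * F34 = F34 * F12) (pent : d3φ * d1φ = φ1 * d2φ * φ4)
    (co1 : d3D2 * φ1 = φ1 * d2D2) (co4 : d2D1 * φ4 = φ4 * d1D1) :
    (F34 * (D2F3 * d3D2 * d3φ * dd' * F12') * F34') *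
      (F12 * (F34 * dd * d1φ * d1D1' * D1F1') * F12') =
    (F34 * D2F3 * φ1 * D1F3' * F23') *
      (F23 * (D1F3 * d2D2 * d2φ * d2D1' * D2F1') * F23') *
      (F23 * D2F1 * φ4 * D1F1' * F12') := by
  have e1 : F12' * F34' * F12 * F34 = 1 := by
    rw [mul_assoc, comm, mul_assoc, ← mul_assoc F34', i3, one_mul, i1]
  have e2 : d2D1' * φ4 = φ4 * d1D1' := by
    calc _ = d2D1' * φ4 * (d1D1 * d1D1') := by rw [i7, mul_one]
      _ = d2D1' * (φ4 * d1D1) * d1D1' := by simp only [mul_assoc]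
      _ = (d2D1' * d2D1) * φ4 * d1D1' := by rw [← co4]; simp only [mul_assoc]
      _ = _ := by rw [i6, one_mul]
  calc _ = F34 * D2F3 * d3D2 * d3φ * dd' * (F12' * F34' * F12 * F34) * dd * d1φ * d1D1' *
        D1F1' * F12' := by simp only [mul_assoc]
    _ = F34 * D2F3 * d3D2 * d3φ * (dd' * dd) * d1φ * d1D1' * D1F1' * F12' := by
        rw [e1]; simp only [mul_assoc, one_mul]
    _ = F34 * D2F3 * (d3D2 * (d3φ * d1φ)) * d1D1' * D1F1' * F12' := by
        rw [i8]; simp only [mul_assoc, one_mul]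
    _ = F34 * D2F3 * (d3D2 * φ1) * d2φ * (φ4 * d1D1') * D1F1' * F12' := by
        rw [pent]; simp only [mul_assoc]
    _ = F34 * D2F3 * φ1 * d2D2 * d2φ * d2D1' * φ4 * D1F1' * F12' := by
        rw [co1, ← e2]; simp only [mul_assoc]
    _ = F34 * D2F3 * φ1 * (D1F3' * ((F23' * F23) * D1F3)) * d2D2 * d2φ * d2D1' *
        (D2F1' * ((F23' * F23) * D2F1)) * φ4 * D1F1' * F12' := by
        rw [i2, one_mul, one_mul, i4, i5, mul_one, mul_one]
    _ = _ := by simp only [mul_assoc]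

end TwistTools

namespace CochainTwist

variable {k : Type u} {H : Type v} [CommRing k] [Ring H] [Algebra k H]
  {Q : QuasiHopfAlgebra k H} (T : CochainTwist Q)

/-- The twisted coproduct `Δ_F(h) = F Δ(h) F⁻¹`. -/
noncomputable def comul : H →ₐ[k] H ⊗[k] H := conjHom Q.comul T.F

/-- The twisted associator `φ_F = (1 ⊗ F) (id ⊗ Δ)(F) φ (Δ ⊗ id)(F⁻¹) (F⁻¹ ⊗ 1)`. -/
noncomputable def assoc : (H ⊗[k] (H ⊗[k] H))ˣ :=
  unitMap (oneTmul H (H ⊗[k] H)) T.F * unitMap (mapSnd H Q.comul) T.F * Q.assoc *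
    (unitMap (comulFst Q.comul H) T.F)⁻¹ * (unitMap (tmulOne H H) T.F)⁻¹

/-- `α_F = S(F⁽⁻¹⁾) α F⁽⁻²⁾`. -/
noncomputable def α : H :=
  sandwichLeft (antiLin Q.antipode) Q.α ((T.F⁻¹ : (H ⊗[k] H)ˣ) : H ⊗[k] H)

/-- `β_F = F⁽¹⁾ β S(F⁽²⁾)`. -/
noncomputable def β : H := sandwichRight (antiLin Q.antipode) Q.β (T.F : H ⊗[k] H)

theorem coassoc (h : H) : mapSnd H T.comul (T.comul h) * T.assoc =
    T.assoc * comulFst T.comul H (T.comul h) := by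
  have hco := Q.coassoc h
  simp only [comul, mapSnd_conjHom, comulFst_conjHom]
  simp only [conjHom_apply, map_mul, assoc, Units.val_mul, unitMap_val, unitMap_inv_val]
  have cc : ∀ (f : H ⊗[k] H →ₐ[k] H ⊗[k] (H ⊗[k] H)) (X : H ⊗[k] (H ⊗[k] H)),
      f ((T.F⁻¹ : (H ⊗[k] H)ˣ) : H ⊗[k] H) * (f T.F * X) = X := by
    intro f X; rw [← mul_assoc, ← map_mul]; simp
  simp only [mul_assoc, cc]
  have hco' : ∀ X, mapSnd H Q.comul (Q.comul h) * ((Q.assoc : H ⊗[k] (H ⊗[k] H)) * X) =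
      Q.assoc * (comulFst Q.comul H (Q.comul h) * X) := by
    intro X; rw [← mul_assoc, hco, mul_assoc]
  rw [hco']

theorem mapSnd_coassoc (X : H ⊗[k] H) :
    mapSnd H (mapSnd H Q.comul) (mapSnd H Q.comul X) * oneTmul H (H ⊗[k] (H ⊗[k] H)) Q.assoc =
      oneTmul H (H ⊗[k] (H ⊗[k] H)) Q.assoc * mapSnd H (comulFst Q.comul H) (mapSnd H Q.comul X) := by
  induction X with
  | zero => simp
  | tmul x y => simp [Q.coassoc]
  | add x y hx hy => simp only [map_add, add_mul, mul_add, hx, hy]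

theorem comulFst_coassoc (X : H ⊗[k] H) :
    mapSnd H (comulFst Q.comul H) (comulFst Q.comul H X) * mapSnd H (tmulOne H H) Q.assoc =
      mapSnd H (tmulOne H H) Q.assoc * comulFst Q.comul (H ⊗[k] H) (comulFst Q.comul H X) := by
  have key : ∀ (Z : H ⊗[k] H) (y : H),
      mapSnd H (comulFst Q.comul H) (Algebra.TensorProduct.assoc k k k H H H (Z ⊗ₜ y)) =
       mapSnd H (tmulOne H H) (mapSnd H Q.comul Z) * oneTmul H _ (oneTmul H _ (oneTmul H _ y)) := by
    intro Z y
    induction Z with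
    | zero => simp
    | tmul x z =>
      simp only [Algebra.TensorProduct.assoc_tmul, mapSnd_tmul, comulFst_tmul, oneTmul_apply,
        Algebra.TensorProduct.tmul_mul_tmul, mul_one]
      congr 1
      generalize Q.comul z = W
      induction W with
      | zero => simp
      | tmul z w => simp
      | add x y hx hy => simp [hx, hy, TensorProduct.add_tmul, add_mul]
    | add x y hx hy => simp [hx, hy, TensorProduct.add_tmul, add_mul]
  have key2 : ∀ (Z : H ⊗[k] H) (y : H),
      comulFst Q.comul (H ⊗[k] H) (Algebra.TensorProduct.assoc k k k H H H (Z ⊗ₜ y)) =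
       mapSnd H (tmulOne H H) (comulFst Q.comul H Z) *
         oneTmul H _ (oneTmul H _ (oneTmul H _ y)) := by
    intro Z y
    induction Z with
    | zero => simp
    | tmul x z =>
      simp only [Algebra.TensorProduct.assoc_tmul, comulFst_tmul]
      generalize Q.comul x = W
      induction W with
      | zero => simp
      | tmul z w => simp
      | add x y hx hy => simp only [hx, hy, TensorProduct.add_tmul, add_mul, map_add]
    | add x y hx hy => simp only [hx, hy, TensorProduct.add_tmul, add_mul, map_add]
  have key3 : ∀ (W : H ⊗[k] (H ⊗[k] H)) (y : H),
      oneTmul H _ (oneTmul H _ (oneTmul H _ y)) * mapSnd H (tmulOne H H) W =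
      mapSnd H (tmulOne H H) W * oneTmul H _ (oneTmul H _ (oneTmul H _ y)) := by
    intro W y
    induction W with
    | zero => simp
    | tmul x z =>
      simp only [mapSnd_tmul]
      generalize z = W
      induction W with
      | zero => simp
      | tmul z w => simp
      | add a b ha hb => simp only [ha, hb, TensorProduct.tmul_add, add_mul, mul_add, map_add]
    | add a b ha hb => simp only [ha, hb, add_mul, mul_add, map_add]
  induction X with
  | zero => simp
  | tmul x y =>
    rw [comulFst_tmul, key, key2, mul_assoc, key3, ← mul_assoc, ← mul_assoc, ← map_mul, ← map_mul,
      Q.coassoc]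
  | add x y hx hy => simp only [map_add, add_mul, mul_add, hx, hy]

set_option maxHeartbeats 2000000 in
theorem cocycle :
    mapSnd H (mapSnd H T.comul) T.assoc * comulFst T.comul (H ⊗[k] H) T.assoc =
    oneTmul H (H ⊗[k] (H ⊗[k] H)) T.assoc * mapSnd H (comulFst T.comul H) T.assoc *
      mapSnd H (tmulOne H H) T.assoc := by
  have e3 : mapSnd H T.comul = conjHom (mapSnd H Q.comul) (unitMap (oneTmul H _) T.F) := by
    apply AlgHom.ext; intro x
    rw [conjHom_apply, unitMap_val, unitMap_inv_val, CochainTwist.comul, mapSnd_conjHom]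
  have e2 : comulFst T.comul H = conjHom (comulFst Q.comul H) (unitMap (tmulOne H H) T.F) := by
    apply AlgHom.ext; intro x; simp [comul, conjHom_apply, comulFst_conjHom]
  have i : ∀ {C : Type v} [Ring C] [Algebra k C] (f : H ⊗[k] H →ₐ[k] C),
      f ((T.F⁻¹ : (H ⊗[k] H)ˣ) : H ⊗[k] H) * f T.F = 1 := by
    intro C _ _ f; rw [← map_mul]; simp
  have i' : ∀ {C D : Type v} [Ring C] [Algebra k C] [Ring D] [Algebra k D]
      (g : C →ₐ[k] D) (f : H ⊗[k] H →ₐ[k] C),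
      g (f ((T.F⁻¹ : (H ⊗[k] H)ˣ) : H ⊗[k] H)) * g (f T.F) = 1 := by
    intro C D _ _ _ _ g f; rw [← map_mul, ← map_mul]; simp
  have j' : ∀ {C D : Type v} [Ring C] [Algebra k C] [Ring D] [Algebra k D]
      (g : C →ₐ[k] D) (f : H ⊗[k] H →ₐ[k] C),
      g (f T.F) * g (f ((T.F⁻¹ : (H ⊗[k] H)ˣ) : H ⊗[k] H)) = 1 := by
    intro C D _ _ _ _ g f; rw [← map_mul, ← map_mul]; simp
  have l3 : mapSnd H (mapSnd H T.comul) T.assoc =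
    mapSnd H (conjHom (mapSnd H Q.comul) (unitMap (oneTmul H (H ⊗[k] H)) T.F)) T.assoc := by
    rw [← e3]
  have l1 : comulFst T.comul (H ⊗[k] H) T.assoc =
    comulFst (conjHom Q.comul T.F) (H ⊗[k] H) T.assoc := rfl
  have l3' := mapSnd_conjHom (H := H) (mapSnd H Q.comul) (unitMap (oneTmul H (H ⊗[k] H)) T.F)
    (T.assoc : H ⊗[k] (H ⊗[k] H))
  have l1' := comulFst_conjHom (B := H ⊗[k] H) Q.comul T.F (T.assoc : H ⊗[k] (H ⊗[k] H))
  have l2' := mapSnd_conjHom (H := H) (comulFst Q.comul H) (unitMap (tmulOne H H) T.F)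
    (T.assoc : H ⊗[k] (H ⊗[k] H))
  rw [l3, l1, e2, l3', l1', l2']
  simp only [assoc, Units.val_mul, unitMap_inv_val, unitMap_val, map_mul]
  simp only [mapSnd_oneTmul, mapSnd_comulFst, comulFst_oneTmul, mapSnd_tmulOne,
    mapSnd_comulFst_tmulOne, comulFst_tmulOne, mapSnd_tmulOne_tmulOne]
  apply cocycle_ring_lemma
  case comm => exact tmulOne_comm (T.F : H ⊗[k] H) (T.F : H ⊗[k] H)
  case pent => exact Q.cocycle
  case co1 => exact mapSnd_coassoc (T.F : H ⊗[k] H)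
  case co4 => exact comulFst_coassoc (T.F : H ⊗[k] H)
  case i1 => exact i (tmulOne H (H ⊗[k] H))
  case i2 => exact i' (oneTmul H (H ⊗[k] (H ⊗[k] H))) (tmulOne H H)
  case i3 => exact i' (oneTmul H (H ⊗[k] (H ⊗[k] H))) (oneTmul H (H ⊗[k] H))
  case i4 => exact i' (oneTmul H (H ⊗[k] (H ⊗[k] H))) (comulFst Q.comul H)
  case i5 => exact i' (mapSnd H (tmulOne H H)) (mapSnd H Q.comul)
  case i6 => exact i' (mapSnd H (comulFst Q.comul H)) (comulFst Q.comul H)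
  case i7 => exact j' (comulFst Q.comul (H ⊗[k] H)) (comulFst Q.comul H)
  case i8 => exact i' (comulFst Q.comul (H ⊗[k] H)) (mapSnd H Q.comul)

end CochainTwist

section AntipodeTools

variable {k : Type u} [CommRing k] {H : Type v} [Ring H] [Algebra k H]

theorem sandwichLeft_mul (S : H ≃ₐ[k] Hᵐᵒᵖ) (a : H) (X Y : H ⊗[k] H) :
    sandwichLeft (antiLin S) a (X * Y) =
      sandwichLeft (antiLin S) (sandwichLeft (antiLin S) a X) Y := by
  induction Y with
  | zero => simp
  | tmul y y' =>
    induction X with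
    | zero => simp
    | tmul x x' => simp [antiLin_mul, mul_assoc]
    | add x z hx hz => simp only [add_mul, mul_add, map_add, hx, hz, sandwichLeft_tmul]
  | add x z hx hz => simp only [map_add, mul_add, hx, hz]

theorem sandwichRight_mul (S : H ≃ₐ[k] Hᵐᵒᵖ) (b : H) (X Y : H ⊗[k] H) :
    sandwichRight (antiLin S) b (X * Y) =
      sandwichRight (antiLin S) (sandwichRight (antiLin S) b Y) X := by
  induction X with
  | zero => simp
  | tmul x x' =>
    induction Y with
    | zero => simp
    | tmul y y' => simp [antiLin_mul, mul_assoc]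
    | add y z hy hz => simp only [mul_add, map_add, hy, hz, sandwichRight_tmul, add_mul]
  | add x z hx hz => simp only [map_add, add_mul, hx, hz]

theorem sandwichLeft_smul (S : H →ₗ[k] H) (a : H) (c : k) (X : H ⊗[k] H) :
    sandwichLeft S (c • a) X = c • sandwichLeft S a X := by
  induction X with
  | zero => simp
  | tmul x y => simp
  | add x y hx hy => simp only [map_add, hx, hy, smul_add]

theorem sandwichRight_smul (S : H →ₗ[k] H) (a : H) (c : k) (X : H ⊗[k] H) :
    sandwichRight S (c • a) X = c • sandwichRight S a X := by
  induction X with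
  | zero => simp
  | tmul x y => simp
  | add x y hx hy => simp only [map_add, hx, hy, smul_add]

/-- The linear map `x ⊗ y ⊗ z ↦ x β S(y) α z`. -/
noncomputable def zigzag (S : H →ₗ[k] H) (a b : H) : H ⊗[k] (H ⊗[k] H) →ₗ[k] H :=
  sandwichRight LinearMap.id b ∘ₗ TensorProduct.map LinearMap.id (sandwichLeft S a)

/-- The linear map `x ⊗ y ⊗ z ↦ S(x) α y β S(z)`. -/
noncomputable def zagzig (S : H →ₗ[k] H) (a b : H) : H ⊗[k] (H ⊗[k] H) →ₗ[k] H :=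
  sandwichLeft S a ∘ₗ TensorProduct.map LinearMap.id (sandwichRight S b)

@[simp] theorem zigzag_tmul (S : H →ₗ[k] H) (a b x : H) (Y : H ⊗[k] H) :
    zigzag S a b (x ⊗ₜ Y) = x * b * sandwichLeft S a Y := by simp [zigzag]

@[simp] theorem zagzig_tmul (S : H →ₗ[k] H) (a b x : H) (Y : H ⊗[k] H) :
    zagzig S a b (x ⊗ₜ Y) = S x * a * sandwichRight S b Y := by simp [zagzig]

theorem zigzag_assoc_tmul (S : H →ₗ[k] H) (a b y : H) (X : H ⊗[k] H) :
    zigzag S a b (Algebra.TensorProduct.assoc k k k H H H (X ⊗ₜ y)) =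
      sandwichRight S b X * a * y := by
  induction X with
  | zero => simp
  | tmul x z => simp [mul_assoc]
  | add x z hx hz => simp only [TensorProduct.add_tmul, map_add, hx, hz, add_mul]

theorem zagzig_assoc_tmul (S : H →ₗ[k] H) (a b y : H) (X : H ⊗[k] H) :
    zagzig S a b (Algebra.TensorProduct.assoc k k k H H H (X ⊗ₜ y)) =
      sandwichLeft S a X * b * S y := by
  induction X with
  | zero => simp
  | tmul x z => simp [mul_assoc]
  | add x z hx hz => simp only [TensorProduct.add_tmul, map_add, hx, hz, add_mul]

/-- Induction on the pure tensors of a triple tensor product. -/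
theorem tensor_induction₃ {p : H ⊗[k] (H ⊗[k] H) → Prop} (X : H ⊗[k] (H ⊗[k] H)) (h0 : p 0)
    (ht : ∀ x y z, p (x ⊗ₜ (y ⊗ₜ z))) (ha : ∀ X Y, p X → p Y → p (X + Y)) : p X := by
  induction X with
  | zero => exact h0
  | tmul x y =>
    induction y with
    | zero => simpa using h0
    | tmul y z => exact ht x y z
    | add y z hy hz => rw [TensorProduct.tmul_add]; exact ha _ _ hy hz
  | add x y hx hy => exact ha _ _ hx hy

theorem zigzag_mul (S : H ≃ₐ[k] Hᵐᵒᵖ) (a b : H) (X Y : H ⊗[k] H) (W : H ⊗[k] (H ⊗[k] H)) :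
    zigzag (antiLin S) a b (oneTmul H (H ⊗[k] H) X * W * tmulOne H H Y) =
      zigzag (antiLin S) (sandwichLeft (antiLin S) a X) (sandwichRight (antiLin S) b Y) W := by
  induction W using tensor_induction₃ with
  | h0 => simp
  | ht x y z =>
    induction X with
    | zero => simp
    | tmul f g =>
      induction Y with
      | zero => simp
      | tmul c d => simp [antiLin_mul, mul_assoc]
      | add X Y hX hY =>
        simp only [map_add, mul_add, add_mul, hX, hY, zigzag_tmul]
    | add X Z hX hZ =>
      simp only [map_add, mul_add, add_mul, hX, hZ, zigzag_tmul, sandwichLeft_tmul]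
  | ha X Z hX hZ => simp only [map_add, mul_add, add_mul, hX, hZ]

theorem zagzig_mul (S : H ≃ₐ[k] Hᵐᵒᵖ) (a b : H) (X Y : H ⊗[k] H) (W : H ⊗[k] (H ⊗[k] H)) :
    zagzig (antiLin S) a b (tmulOne H H X * W * oneTmul H (H ⊗[k] H) Y) =
      zagzig (antiLin S) (sandwichLeft (antiLin S) a X) (sandwichRight (antiLin S) b Y) W := by
  induction W using tensor_induction₃ with
  | h0 => simp
  | ht x y z =>
    induction X with
    | zero => simp
    | tmul f g =>
      induction Y with
      | zero => simp
      | tmul c d => simp [antiLin_mul, mul_assoc]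
      | add X Y hX hY =>
        simp only [map_add, mul_add, add_mul, hX, hY, zagzig_tmul, sandwichRight_tmul]
    | add X Z hX hZ =>
      simp only [map_add, mul_add, add_mul, hX, hZ, zagzig_tmul]
  | ha X Z hX hZ => simp only [map_add, mul_add, add_mul, hX, hZ]

end AntipodeTools

namespace CochainTwist

variable {k : Type u} {H : Type v} [CommRing k] [Ring H] [Algebra k H]
  {Q : QuasiHopfAlgebra k H} (T : CochainTwist Q)

theorem zigzag_comul (X Y : H ⊗[k] H) (W : H ⊗[k] (H ⊗[k] H)) :
    zigzag (antiLin Q.antipode) Q.α Q.β (mapSnd H Q.comul X * W * comulFst Q.comul H Y) =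
      counitSnd Q.counit X * zigzag (antiLin Q.antipode) Q.α Q.β W * counitFst Q.counit H Y := by
  induction X with
  | zero => simp
  | tmul a b =>
    induction Y with
    | zero => simp
    | tmul c d =>
      induction W using tensor_induction₃ with
      | h0 => simp
      | ht x y z =>
        have e : (a ⊗ₜ[k] ((1 : H) ⊗ₜ[k] (1 : H))) * (x ⊗ₜ[k] (y ⊗ₜ[k] z)) *
            (Algebra.TensorProduct.assoc k k k H H H (Q.comul c ⊗ₜ d)) =
            Algebra.TensorProduct.assoc k k k H H H
              (((a * x) ⊗ₜ y * Q.comul c) ⊗ₜ (z * d)) := by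
          rw [← Algebra.TensorProduct.tmul_mul_tmul, map_mul]; simp
        have e2 : mapSnd H Q.comul (a ⊗ₜ b) = oneTmul H _ (Q.comul b) * a ⊗ₜ[k] (1 : H ⊗[k] H) := by
          simp
        rw [e2, comulFst_tmul, mul_assoc, mul_assoc, Algebra.TensorProduct.one_def,
          ← mul_assoc (a ⊗ₜ[k] _), e,
          ← mul_one (oneTmul _ _ _ * _)]
        nth_rewrite 1 [← map_one (tmulOne H H)]
        rw [zigzag_mul, Q.antipode_left, zigzag_assoc_tmul]
        simp [sandwichRight_mul, antiLin_one, Algebra.TensorProduct.one_def, Q.antipode_right,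
          mul_assoc]
        exact smul_comm _ _ _
      | ha X Z hX hZ => simp only [map_add, mul_add, add_mul, hX, hZ]
    | add X Z hX hZ => simp only [map_add, mul_add, hX, hZ]
  | add X Z hX hZ => simp only [map_add, add_mul, hX, hZ]

theorem zagzig_comul (X Y : H ⊗[k] H) (W : H ⊗[k] (H ⊗[k] H)) :
    zagzig (antiLin Q.antipode) Q.α Q.β (comulFst Q.comul H X * W * mapSnd H Q.comul Y) =
      antiLin Q.antipode (counitSnd Q.counit Y) * zagzig (antiLin Q.antipode) Q.α Q.β W *
        antiLin Q.antipode (counitFst Q.counit H X) := by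
  induction X with
  | zero => simp
  | tmul a b =>
    induction Y with
    | zero => simp
    | tmul c d =>
      induction W using tensor_induction₃ with
      | h0 => simp
      | ht x y z =>
        have e : (Algebra.TensorProduct.assoc k k k H H H (Q.comul a ⊗ₜ b)) *
            (x ⊗ₜ[k] (y ⊗ₜ[k] z)) * (c ⊗ₜ[k] ((1 : H) ⊗ₜ[k] (1 : H))) =
            Algebra.TensorProduct.assoc k k k H H H
              ((Q.comul a * (x * c) ⊗ₜ y) ⊗ₜ (b * z)) := by
          rw [← Algebra.TensorProduct.tmul_mul_tmul, map_mul]; simp [mul_assoc]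
        have e2 : mapSnd H Q.comul (c ⊗ₜ d) = c ⊗ₜ[k] (1 : H ⊗[k] H) * oneTmul H _ (Q.comul d) := by
          simp
        rw [e2, comulFst_tmul, Algebra.TensorProduct.one_def, ← mul_assoc, e,
          ← one_mul (Algebra.TensorProduct.assoc k k k H H H _)]
        nth_rewrite 1 [← map_one (tmulOne H H)]
        rw [zagzig_mul, Q.antipode_right, zagzig_assoc_tmul]
        simp [sandwichLeft_mul, antiLin_one, Algebra.TensorProduct.one_def, Q.antipode_left,
          mul_assoc, antiLin_mul, smul_smul, mul_comm]
      | ha X Z hX hZ => simp only [map_add, mul_add, add_mul, hX, hZ]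
    | add X Z hX hZ => simp only [map_add, mul_add, add_mul, hX, hZ]
  | add X Z hX hZ => simp only [map_add, add_mul, mul_add, hX, hZ]

theorem counitFst_inv : counitFst Q.counit H ((T.F⁻¹ : (H ⊗[k] H)ˣ) : H ⊗[k] H) = 1 := by
  have h : counitFst Q.counit H (T.F * ((T.F⁻¹ : (H ⊗[k] H)ˣ) : H ⊗[k] H)) = 1 := by simp
  rwa [map_mul, T.counit_left, one_mul] at h

theorem counitSnd_inv : counitSnd Q.counit ((T.F⁻¹ : (H ⊗[k] H)ˣ) : H ⊗[k] H) = 1 := by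
  have h : counitSnd Q.counit (T.F * ((T.F⁻¹ : (H ⊗[k] H)ˣ) : H ⊗[k] H)) = 1 := by simp
  rwa [map_mul, T.counit_right, one_mul] at h

theorem mapSnd_counitFst_comulFst (X : H ⊗[k] H) :
    mapSnd H (counitFst Q.counit H) (comulFst Q.comul H X) = X := by
  induction X with
  | zero => simp
  | tmul x y =>
    have : ∀ Z : H ⊗[k] H, mapSnd H (counitFst Q.counit H)
        (Algebra.TensorProduct.assoc k k k H H H (Z ⊗ₜ y)) = counitSnd Q.counit Z ⊗ₜ y := by
      intro Z
      induction Z with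
      | zero => simp
      | tmul a b => simp [TensorProduct.smul_tmul]
      | add a b ha hb => simp only [TensorProduct.add_tmul, map_add, ha, hb]
    rw [comulFst_tmul, this, Q.comul_counit]
  | add x y hx hy => simp only [map_add, hx, hy]

theorem mapSnd_counitFst_mapSnd (X : H ⊗[k] H) :
    mapSnd H (counitFst Q.counit H) (mapSnd H Q.comul X) = X := by
  induction X with
  | zero => simp
  | tmul x y => simp [Q.counit_comul]
  | add x y hx hy => simp only [map_add, hx, hy]

theorem mapSnd_counitFst_tmulOne (X : H ⊗[k] H) :
    mapSnd H (counitFst Q.counit H) (tmulOne H H X) = counitSnd Q.counit X ⊗ₜ 1 := by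
  induction X with
  | zero => simp
  | tmul x y => simp [TensorProduct.smul_tmul]
  | add x y hx hy => simp only [map_add, hx, hy, TensorProduct.add_tmul]

/-- The twisted quasi-Hopf algebra `H_F`. -/
noncomputable def twist : QuasiHopfAlgebra k H where
  comul := T.comul
  counit := Q.counit
  assoc := T.assoc
  counit_comul h := by
    rw [comul, conjHom_apply, map_mul, map_mul, T.counit_left, T.counitFst_inv, Q.counit_comul,
      one_mul, mul_one]
  comul_counit h := by
    rw [comul, conjHom_apply, map_mul, map_mul, T.counit_right, T.counitSnd_inv, Q.comul_counit,
      one_mul, mul_one]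
  coassoc := T.coassoc
  cocycle := T.cocycle
  counit_assoc := by
    simp only [assoc, Units.val_mul, unitMap_inv_val, unitMap_val, map_mul,
      mapSnd_counitFst_tmulOne, mapSnd_counitFst_comulFst, mapSnd_counitFst_mapSnd, Q.counit_assoc,
      T.counitSnd_inv, mapSnd_oneTmul, T.counit_left]
    simp [← Algebra.TensorProduct.one_def]
  antipode := Q.antipode
  α := T.α
  β := T.β
  antipode_left h := by
    rw [α, ← sandwichLeft_mul, comul, conjHom_apply, ← mul_assoc, ← mul_assoc]
    simp only [Units.inv_mul, one_mul]
    rw [sandwichLeft_mul, Q.antipode_left, sandwichLeft_smul]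
  antipode_right h := by
    rw [β, ← sandwichRight_mul, comul, conjHom_apply, mul_assoc]
    simp only [Units.inv_mul, mul_one]
    rw [sandwichRight_mul, Q.antipode_right, sandwichRight_smul]
  antipode_assoc := by
    change zigzag (antiLin Q.antipode) T.α T.β (T.assoc : H ⊗[k] (H ⊗[k] H)) = 1
    have h : oneTmul H (H ⊗[k] H) ((T.F⁻¹ : (H ⊗[k] H)ˣ) : H ⊗[k] H) * (T.assoc : H ⊗[k] (H ⊗[k] H)) *
        tmulOne H H (T.F : H ⊗[k] H) = mapSnd H Q.comul T.F * (Q.assoc : H ⊗[k] (H ⊗[k] H)) *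
          comulFst Q.comul H ((T.F⁻¹ : (H ⊗[k] H)ˣ) : H ⊗[k] H) := by
      simp only [assoc, Units.val_mul, unitMap_inv_val, unitMap_val, ← mul_assoc, ← map_mul,
        Units.inv_mul, map_one, one_mul]
      simp only [mul_assoc, ← map_mul, Units.inv_mul, map_one, mul_one]
    rw [α, β, ← zigzag_mul, h, zigzag_comul, T.counit_right, T.counitFst_inv, one_mul, mul_one]
    exact Q.antipode_assoc
  antipode_assoc_inv := by
    change zagzig (antiLin Q.antipode) T.α T.β
      ((T.assoc⁻¹ : (H ⊗[k] (H ⊗[k] H))ˣ) : H ⊗[k] (H ⊗[k] H)) = 1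
    have h : tmulOne H H ((T.F⁻¹ : (H ⊗[k] H)ˣ) : H ⊗[k] H) *
        ((T.assoc⁻¹ : (H ⊗[k] (H ⊗[k] H))ˣ) : H ⊗[k] (H ⊗[k] H)) *
        oneTmul H (H ⊗[k] H) (T.F : H ⊗[k] H) = comulFst Q.comul H (T.F : H ⊗[k] H) *
          ((Q.assoc⁻¹ : (H ⊗[k] (H ⊗[k] H))ˣ) : H ⊗[k] (H ⊗[k] H)) *
          mapSnd H Q.comul ((T.F⁻¹ : (H ⊗[k] H)ˣ) : H ⊗[k] H) := by
      simp only [assoc, mul_inv_rev, inv_inv, Units.val_mul, unitMap_inv_val, unitMap_val,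
        ← mul_assoc, ← map_mul, Units.inv_mul, map_one, one_mul]
      simp only [mul_assoc, ← map_mul, Units.inv_mul, map_one, mul_one]
    rw [α, β, ← zagzig_mul, h, zagzig_comul, T.counitSnd_inv, T.counit_left, antiLin_one, one_mul,
      mul_one]
    exact Q.antipode_assoc_inv

end CochainTwist

section TensorAct

variable {k : Type u} [CommRing k]

/-- The action of `B ⊗ C` on `M ⊗ N` induced by an action `ρ` of `B` on `M` and an action `σ` of
`C` on `N`:  `(b ⊗ c) • (m ⊗ n) = (b • m) ⊗ (c • n)`. -/
noncomputable def tensorAct {B C : Type v} [Ring B] [Algebra k B] [Ring C] [Algebra k C]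
    {M N : Type u} [AddCommGroup M] [Module k M] [AddCommGroup N] [Module k N]
    (ρ : B →ₐ[k] Module.End k M) (σ : C →ₐ[k] Module.End k N) :
    B ⊗[k] C →ₐ[k] Module.End k (M ⊗[k] N) :=
  (Module.endTensorEndAlgHom (R := k) (A := k) (M := M) (N := N)).comp
    (Algebra.TensorProduct.map ρ σ)

variable {B B' C D : Type v} [Ring B] [Algebra k B] [Ring B'] [Algebra k B'] [Ring C] [Algebra k C]
  [Ring D] [Algebra k D]
  {H : Type v} [Ring H] [Algebra k H]
  {M M' N N' P : Type u} [AddCommGroup M] [Module k M] [AddCommGroup N] [Module k N]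
  [AddCommGroup M'] [Module k M'] [AddCommGroup N'] [Module k N'] [AddCommGroup P] [Module k P]
  (ρ : B →ₐ[k] Module.End k M) (σ : C →ₐ[k] Module.End k N) (τ : D →ₐ[k] Module.End k P)
  (ρ' : B →ₐ[k] Module.End k M') (σ' : C →ₐ[k] Module.End k N')

theorem tensorAct_tmul (b : B) (c : C) :
    tensorAct ρ σ (b ⊗ₜ c) = TensorProduct.map (ρ b) (σ c) := rfl

@[simp] theorem tensorAct_tmul_tmul (b : B) (c : C) (m : M) (n : N) :
    tensorAct ρ σ (b ⊗ₜ c) (m ⊗ₜ n) = ρ b m ⊗ₜ σ c n := rfl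

theorem map_comp_tensorAct (f : M →ₗ[k] M') (g : N →ₗ[k] N')
    (hf : ∀ b, f ∘ₗ ρ b = ρ' b ∘ₗ f) (hg : ∀ c, g ∘ₗ σ c = σ' c ∘ₗ g) (X : B ⊗[k] C) :
    TensorProduct.map f g ∘ₗ tensorAct ρ σ X = tensorAct ρ' σ' X ∘ₗ TensorProduct.map f g := by
  induction X with
  | zero => simp
  | tmul x y => rw [tensorAct_tmul, tensorAct_tmul, ← TensorProduct.map_comp, hf, hg,
      TensorProduct.map_comp]
  | add x y hx hy => rw [map_add, map_add, LinearMap.comp_add, LinearMap.add_comp, hx, hy]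

theorem tensorAct_comp_right (f : B' →ₐ[k] C) (X : B ⊗[k] B') :
    tensorAct ρ (σ.comp f) X = tensorAct ρ σ (mapSnd B f X) := by
  induction X with
  | zero => simp
  | tmul x y => rfl
  | add x y hx hy => rw [map_add, map_add, map_add, hx, hy]

theorem lTensor_tensorAct (X : C) :
    LinearMap.lTensor M (σ X) = tensorAct ρ σ (oneTmul B C X) := by
  rw [oneTmul_apply, tensorAct_tmul, map_one]; rfl

/-- `M ⊗ (-)` applied to a map that intertwines. -/
theorem lTensor_comp_tensorAct (g : N →ₗ[k] N') (f : C →ₐ[k] D) (τ' : D →ₐ[k] Module.End k N')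
    (hg : ∀ c, g ∘ₗ σ c = τ' (f c) ∘ₗ g) (X : B ⊗[k] C) :
    LinearMap.lTensor M g ∘ₗ tensorAct ρ σ X =
      tensorAct ρ τ' (mapSnd B f X) ∘ₗ LinearMap.lTensor M g := by
  rw [← tensorAct_comp_right]
  exact map_comp_tensorAct ρ σ ρ (τ'.comp f) LinearMap.id g (fun _ => rfl) hg X

theorem assoc_comp_tensorAct (X : (B ⊗[k] C) ⊗[k] D) :
    (TensorProduct.assoc k M N P).toLinearMap ∘ₗ tensorAct (tensorAct ρ σ) τ X =
      tensorAct ρ (tensorAct σ τ) (Algebra.TensorProduct.assoc k k k B C D X) ∘ₗ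
        (TensorProduct.assoc k M N P).toLinearMap := by
  induction X with
  | zero => simp
  | tmul x y =>
    induction x with
    | zero => simp
    | tmul x z => apply TensorProduct.ext_threefold; intro a b c; rfl
    | add x y hx hy =>
      rw [TensorProduct.add_tmul, map_add, map_add, map_add, LinearMap.comp_add,
        LinearMap.add_comp, hx, hy]
  | add x y hx hy =>
    rw [map_add, map_add, map_add, LinearMap.comp_add, LinearMap.add_comp, hx, hy]

theorem tensorAct_comp_left (f : B' →ₐ[k] B) (X : B' ⊗[k] C) :
    tensorAct (ρ.comp f) σ X =
      tensorAct ρ σ (Algebra.TensorProduct.map f (AlgHom.id k C) X) := by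
  induction X with
  | zero => simp
  | tmul x y => rfl
  | add x y hx hy => rw [map_add, map_add, map_add, hx, hy]

theorem rTensor_tensorAct (X : B) :
    LinearMap.rTensor N (ρ X) =
      tensorAct ρ σ ((Algebra.TensorProduct.includeLeft : B →ₐ[k] B ⊗[k] C) X) := by
  rw [Algebra.TensorProduct.includeLeft_apply, tensorAct_tmul, map_one]; rfl

/-- The action of `H` on `k` through `ε`. -/
noncomputable def counitAct (ε : H →ₐ[k] k) : H →ₐ[k] Module.End k k :=
  (Algebra.lmul k k).comp ε

@[simp] theorem counitAct_apply (ε : H →ₐ[k] k) (h : H) (c : k) : counitAct ε h c = ε h * c := rfl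

theorem lid_comp_tensorAct (ε : H →ₐ[k] k) (X : H ⊗[k] C) :
    (TensorProduct.lid k N).toLinearMap ∘ₗ tensorAct (counitAct ε) σ X =
      σ (counitFst ε C X) ∘ₗ (TensorProduct.lid k N).toLinearMap := by
  induction X with
  | zero => simp
  | tmul x y => ext n; simp
  | add x y hx hy =>
    rw [map_add, map_add, map_add, LinearMap.comp_add, LinearMap.add_comp, hx, hy]

theorem rid_comp_tensorAct (ρ : H →ₐ[k] Module.End k M) (ε : H →ₐ[k] k) (X : H ⊗[k] H) :
    (TensorProduct.rid k M).toLinearMap ∘ₗ tensorAct ρ (counitAct ε) X =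
      ρ (counitSnd ε X) ∘ₗ (TensorProduct.rid k M).toLinearMap := by
  induction X with
  | zero => simp
  | tmul x y => ext n; simp
  | add x y hx hy =>
    rw [map_add, map_add, map_add, LinearMap.comp_add, LinearMap.add_comp, hx, hy]

end TensorAct

/-- Left `H`-modules (in the universe of `k`), i.e. `k`-modules with an action of the
`k`-algebra `H`.  The quasi-Hopf structure `Q` enters the monoidal structure only. -/
structure QHMod {k : Type u} {H : Type v} [CommRing k] [Ring H] [Algebra k H]
    (Q : QuasiHopfAlgebra k H) where
  /-- the underlying type -/
  carrier : Type u
  [addCommGroup : AddCommGroup carrier]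
  [module : Module k carrier]
  /-- the action of `H` -/
  act : H →ₐ[k] Module.End k carrier

namespace QHMod

variable {k : Type u} {H : Type v} [CommRing k] [Ring H] [Algebra k H]
  {Q : QuasiHopfAlgebra k H}

instance : CoeSort (QHMod Q) (Type u) := ⟨QHMod.carrier⟩

attribute [instance] QHMod.addCommGroup QHMod.module

/-- Morphisms of left `H`-modules: `k`-linear `H`-equivariant maps. -/
@[ext] structure Hom (V W : QHMod Q) where
  /-- the underlying linear map -/
  toLin : V.carrier →ₗ[k] W.carrier
  comm : ∀ h, toLin ∘ₗ V.act h = W.act h ∘ₗ toLin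

instance : Category (QHMod Q) where
  Hom V W := Hom V W
  id V := ⟨LinearMap.id, fun _ => rfl⟩
  comp f g := ⟨g.toLin ∘ₗ f.toLin, fun h => by
    rw [LinearMap.comp_assoc, f.comm, ← LinearMap.comp_assoc, g.comm, LinearMap.comp_assoc]⟩

/-- The linear map underlying a morphism. -/
def lin {V W : QHMod Q} (f : V ⟶ W) : V.carrier →ₗ[k] W.carrier := Hom.toLin f

/-- A morphism from an equivariant linear map. -/
def ofLin {V W : QHMod Q} (f : V.carrier →ₗ[k] W.carrier)
    (hf : ∀ h, f ∘ₗ V.act h = W.act h ∘ₗ f) : V ⟶ W := ⟨f, hf⟩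

@[ext] theorem hom_ext {V W : QHMod Q} {f g : V ⟶ W} (h : lin f = lin g) : f = g := Hom.ext h

@[simp] theorem lin_id (V : QHMod Q) : lin (𝟙 V) = LinearMap.id := rfl

@[simp] theorem lin_comp {V W X : QHMod Q} (f : V ⟶ W) (g : W ⟶ X) :
    lin (f ≫ g) = lin g ∘ₗ lin f := rfl

@[simp] theorem lin_ofLin {V W : QHMod Q} (f : V.carrier →ₗ[k] W.carrier)
    (hf : ∀ h, f ∘ₗ V.act h = W.act h ∘ₗ f) : lin (ofLin f hf) = f := rfl

theorem lin_comm {V W : QHMod Q} (f : V ⟶ W) (h : H) :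
    lin f ∘ₗ V.act h = W.act h ∘ₗ lin f := Hom.comm f h

theorem lin_act {V W : QHMod Q} (f : V ⟶ W) (h : H) (v : V) :
    lin f (V.act h v) = W.act h (lin f v) := LinearMap.congr_fun (Hom.comm f h) v

/-- An isomorphism from an equivariant linear equivalence. -/
def isoOfLin {V W : QHMod Q} (e : V.carrier ≃ₗ[k] W.carrier)
    (he : ∀ h, e.toLinearMap ∘ₗ V.act h = W.act h ∘ₗ e.toLinearMap) : V ≅ W where
  hom := ofLin e.toLinearMap he
  inv := ofLin e.symm.toLinearMap (fun h => by
    ext w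
    apply e.injective
    have := LinearMap.congr_fun (he h) (e.symm w)
    simp at this
    simp [this])
  hom_inv_id := by ext v; simp
  inv_hom_id := by ext v; simp

@[simp] theorem lin_isoOfLin_hom {V W : QHMod Q} (e : V.carrier ≃ₗ[k] W.carrier)
    (he : ∀ h, e.toLinearMap ∘ₗ V.act h = W.act h ∘ₗ e.toLinearMap) :
    lin (isoOfLin e he).hom = e.toLinearMap := rfl

@[simp] theorem lin_isoOfLin_inv {V W : QHMod Q} (e : V.carrier ≃ₗ[k] W.carrier)
    (he : ∀ h, e.toLinearMap ∘ₗ V.act h = W.act h ∘ₗ e.toLinearMap) :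
    lin (isoOfLin e he).inv = e.symm.toLinearMap := rfl

/-- The tensor product of `H`-modules, `h • (v ⊗ w) = (h₍₁₎ • v) ⊗ (h₍₂₎ • w)`. -/
noncomputable abbrev tensor (V W : QHMod Q) : QHMod Q where
  carrier := V.carrier ⊗[k] W.carrier
  act := (tensorAct V.act W.act).comp Q.comul

/-- The tensor product of morphisms. -/
noncomputable def tensorMap {V W V' W' : QHMod Q} (f : V ⟶ V') (g : W ⟶ W') :
    tensor V W ⟶ tensor V' W' :=
  ofLin (TensorProduct.map (lin f) (lin g)) (fun h =>
    map_comp_tensorAct V.act W.act V'.act W'.act (lin f) (lin g) (lin_comm f) (lin_comm g)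
      (Q.comul h))

/-- The unit object `k`, on which `H` acts by the counit. -/
noncomputable abbrev unit (Q : QuasiHopfAlgebra k H) : QHMod Q where
  carrier := k
  act := counitAct Q.counit

/-- The action of an invertible element of an algebra as a linear equivalence. -/
def unitAct {B : Type v} [Ring B] [Algebra k B] {M : Type u} [AddCommGroup M] [Module k M]
    (ρ : B →ₐ[k] Module.End k M) (u : Bˣ) : M ≃ₗ[k] M :=
  LinearEquiv.ofLinearMap (ρ u) (ρ ((u⁻¹ : Bˣ) : B))
    (by rw [← Module.End.mul_eq_comp, ← map_mul]; simp [Module.End.one_eq_id])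
    (by rw [← Module.End.mul_eq_comp, ← map_mul]; simp [Module.End.one_eq_id])

theorem unitAct_toLinearMap {B : Type v} [Ring B] [Algebra k B] {M : Type u} [AddCommGroup M]
    [Module k M] (ρ : B →ₐ[k] Module.End k M) (u : Bˣ) : (unitAct ρ u).toLinearMap = ρ u := rfl

theorem unitAct_symm_toLinearMap {B : Type v} [Ring B] [Algebra k B] {M : Type u} [AddCommGroup M]
    [Module k M] (ρ : B →ₐ[k] Module.End k M) (u : Bˣ) :
    (unitAct ρ u).symm.toLinearMap = ρ ((u⁻¹ : Bˣ) : B) := rfl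

/-- The associator `(v ⊗ w) ⊗ x ↦ φ⁽¹⁾ v ⊗ (φ⁽²⁾ w ⊗ φ⁽³⁾ x)`, as a linear equivalence. -/
noncomputable def assocLin (V W X : QHMod Q) :
    (V.carrier ⊗[k] W.carrier) ⊗[k] X.carrier ≃ₗ[k] V.carrier ⊗[k] (W.carrier ⊗[k] X.carrier) :=
  (TensorProduct.assoc k V.carrier W.carrier X.carrier).trans
    (unitAct (tensorAct V.act (tensorAct W.act X.act)) Q.assoc)

theorem assocLin_toLinearMap (V W X : QHMod Q) : (assocLin V W X).toLinearMap =
    tensorAct V.act (tensorAct W.act X.act) (Q.assoc : H ⊗[k] (H ⊗[k] H)) ∘ₗ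
      (TensorProduct.assoc k V.carrier W.carrier X.carrier).toLinearMap := rfl

theorem assoc_comp_act (V W : QHMod Q) {M : Type u} [AddCommGroup M] [Module k M] {B : Type v}
    [Ring B] [Algebra k B] (τ : B →ₐ[k] Module.End k M) (X : H ⊗[k] B) :
    (TensorProduct.assoc k V.carrier W.carrier M).toLinearMap ∘ₗ
      tensorAct ((tensorAct V.act W.act).comp Q.comul) τ X =
    tensorAct V.act (tensorAct W.act τ) (comulFst Q.comul B X) ∘ₗ
      (TensorProduct.assoc k V.carrier W.carrier M).toLinearMap := by
  rw [tensorAct_comp_left, assoc_comp_tensorAct]; rfl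

theorem assocLin_comm (V W X : QHMod Q) (h : H) :
    (assocLin V W X).toLinearMap ∘ₗ
        tensorAct ((tensorAct V.act W.act).comp Q.comul) X.act (Q.comul h) =
      tensorAct V.act ((tensorAct W.act X.act).comp Q.comul) (Q.comul h) ∘ₗ
        (assocLin V W X).toLinearMap := by
  rw [assocLin_toLinearMap, LinearMap.comp_assoc, assoc_comp_act, tensorAct_comp_right,
    ← LinearMap.comp_assoc, ← LinearMap.comp_assoc, ← Module.End.mul_eq_comp,
    ← Module.End.mul_eq_comp, ← map_mul, ← map_mul, Q.coassoc]

theorem lid_comm (V : QHMod Q) (h : H) : (TensorProduct.lid k V.carrier).toLinearMap ∘ₗ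
    tensorAct (counitAct Q.counit) V.act (Q.comul h) =
      V.act h ∘ₗ (TensorProduct.lid k V.carrier).toLinearMap := by
  rw [lid_comp_tensorAct, Q.counit_comul]

theorem rid_comm (V : QHMod Q) (h : H) : (TensorProduct.rid k V.carrier).toLinearMap ∘ₗ
    tensorAct V.act (counitAct Q.counit) (Q.comul h) =
      V.act h ∘ₗ (TensorProduct.rid k V.carrier).toLinearMap := by
  rw [rid_comp_tensorAct, Q.comul_counit]

noncomputable instance : MonoidalCategoryStruct (QHMod Q) where
  tensorObj V W := tensor V W
  tensorHom f g := tensorMap f g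
  whiskerLeft V _ _ g := tensorMap (𝟙 V) g
  whiskerRight f W := tensorMap f (𝟙 W)
  tensorUnit := unit Q
  associator V W X := isoOfLin (assocLin V W X) (assocLin_comm V W X)
  leftUnitor V := isoOfLin (TensorProduct.lid k V.carrier) (lid_comm V)
  rightUnitor V := isoOfLin (TensorProduct.rid k V.carrier) (rid_comm V)

theorem lin_tensorHom {V W V' W' : QHMod Q} (f : V ⟶ V') (g : W ⟶ W') :
    lin (f ⊗ₘ g) = TensorProduct.map (lin f) (lin g) := rfl

theorem lin_whiskerLeft (V : QHMod Q) {W W' : QHMod Q} (g : W ⟶ W') :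
    lin (V ◁ g) = LinearMap.lTensor V.carrier (lin g) := rfl

theorem lin_whiskerRight {V V' : QHMod Q} (f : V ⟶ V') (W : QHMod Q) :
    lin (f ▷ W) = LinearMap.rTensor W.carrier (lin f) := rfl

theorem lin_associator_hom (V W X : QHMod Q) : lin (α_ V W X).hom =
    tensorAct V.act (tensorAct W.act X.act) (Q.assoc : H ⊗[k] (H ⊗[k] H)) ∘ₗ
      (TensorProduct.assoc k V.carrier W.carrier X.carrier).toLinearMap := rfl

theorem lin_associator_inv (V W X : QHMod Q) : lin (α_ V W X).inv =
    (TensorProduct.assoc k V.carrier W.carrier X.carrier).symm.toLinearMap ∘ₗ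
    tensorAct V.act (tensorAct W.act X.act)
      ((Q.assoc⁻¹ : (H ⊗[k] (H ⊗[k] H))ˣ) : H ⊗[k] (H ⊗[k] H)) := rfl

theorem lin_leftUnitor_hom (V : QHMod Q) :
    lin (λ_ V).hom = (TensorProduct.lid k V.carrier).toLinearMap := rfl

theorem lin_rightUnitor_hom (V : QHMod Q) :
    lin (ρ_ V).hom = (TensorProduct.rid k V.carrier).toLinearMap := rfl

theorem assocLin_natural {V W X V' W' X' : QHMod Q} (f : V ⟶ V') (g : W ⟶ W') (h : X ⟶ X') :
    (assocLin V' W' X').toLinearMap ∘ₗ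
        TensorProduct.map (TensorProduct.map (lin f) (lin g)) (lin h) =
      TensorProduct.map (lin f) (TensorProduct.map (lin g) (lin h)) ∘ₗ
        (assocLin V W X).toLinearMap := by
  rw [assocLin_toLinearMap, assocLin_toLinearMap, ← LinearMap.comp_assoc,
    map_comp_tensorAct V.act (tensorAct W.act X.act) V'.act (tensorAct W'.act X'.act) (lin f)
      (TensorProduct.map (lin g) (lin h)) (lin_comm f)
      (map_comp_tensorAct _ _ _ _ _ _ (lin_comm g) (lin_comm h)),
    LinearMap.comp_assoc, LinearMap.comp_assoc]
  congr 1
  apply TensorProduct.ext_threefold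
  intro a b c
  rfl

theorem assocLin_triangle (V W : QHMod Q) :
    LinearMap.lTensor V.carrier (TensorProduct.lid k W.carrier).toLinearMap ∘ₗ
        (assocLin V (unit Q) W).toLinearMap =
      LinearMap.rTensor W.carrier (TensorProduct.rid k V.carrier).toLinearMap := by
  have h := lTensor_comp_tensorAct V.act (tensorAct (counitAct Q.counit) W.act)
    (TensorProduct.lid k W.carrier).toLinearMap (counitFst Q.counit H) W.act
    (lid_comp_tensorAct W.act Q.counit) (Q.assoc : H ⊗[k] (H ⊗[k] H))
  rw [assocLin_toLinearMap, ← LinearMap.comp_assoc]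
  erw [h]
  rw [Q.counit_assoc, map_one]
  apply TensorProduct.ext_threefold
  intro a b c
  simp [TensorProduct.smul_tmul]

theorem mapSnd_assoc_assoc (X : H ⊗[k] (H ⊗[k] H)) :
    mapSnd H (Algebra.TensorProduct.assoc k k k H H H).toAlgHom
      (Algebra.TensorProduct.assoc k k k H (H ⊗[k] H) H (X ⊗ₜ 1)) =
    mapSnd H (tmulOne H H) X := by
  induction X using tensor_induction₃ with
  | h0 => simp
  | ht x y z => simp
  | ha X Y hX hY => rw [TensorProduct.add_tmul, map_add, map_add, map_add, hX, hY]

theorem lTensor_assocLin (W X Y Z : QHMod Q) :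
    LinearMap.lTensor W.carrier (assocLin X Y Z).toLinearMap =
    tensorAct W.act (tensorAct X.act (tensorAct Y.act Z.act)) (oneTmul H (H ⊗[k] (H ⊗[k] H)) Q.assoc)
      ∘ₗ LinearMap.lTensor W.carrier
        (TensorProduct.assoc k X.carrier Y.carrier Z.carrier).toLinearMap := by
  rw [assocLin_toLinearMap, LinearMap.lTensor_comp, lTensor_tensorAct W.act (tensorAct X.act (tensorAct Y.act Z.act))]

theorem lTensor_assoc_comp (W X Y Z : QHMod Q) :
    LinearMap.lTensor W.carrier
        (TensorProduct.assoc k X.carrier Y.carrier Z.carrier).toLinearMap ∘ₗ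
      (assocLin W (tensor X Y) Z).toLinearMap =
    tensorAct W.act (tensorAct X.act (tensorAct Y.act Z.act))
      (mapSnd H (comulFst Q.comul H) Q.assoc) ∘ₗ
    LinearMap.lTensor W.carrier
        (TensorProduct.assoc k X.carrier Y.carrier Z.carrier).toLinearMap ∘ₗ
      (TensorProduct.assoc k W.carrier (X.carrier ⊗[k] Y.carrier) Z.carrier).toLinearMap := by
  have h := lTensor_comp_tensorAct W.act (tensorAct ((tensorAct X.act Y.act).comp Q.comul) Z.act)
    (TensorProduct.assoc k X.carrier Y.carrier Z.carrier).toLinearMap (comulFst Q.comul H)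
    (tensorAct X.act (tensorAct Y.act Z.act)) (assoc_comp_act X Y Z.act)
    (Q.assoc : H ⊗[k] (H ⊗[k] H))
  rw [assocLin_toLinearMap, ← LinearMap.comp_assoc, ← LinearMap.comp_assoc, ← h]

theorem assoc_rTensor_assocLin (W X Y Z : QHMod Q) :
    LinearMap.lTensor W.carrier
        (TensorProduct.assoc k X.carrier Y.carrier Z.carrier).toLinearMap ∘ₗ
      (TensorProduct.assoc k W.carrier (X.carrier ⊗[k] Y.carrier) Z.carrier).toLinearMap ∘ₗ
        LinearMap.rTensor Z.carrier (assocLin W X Y).toLinearMap =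
    tensorAct W.act (tensorAct X.act (tensorAct Y.act Z.act))
      (mapSnd H (tmulOne H H) Q.assoc) ∘ₗ
    (TensorProduct.assoc k W.carrier X.carrier (Y.carrier ⊗[k] Z.carrier)).toLinearMap ∘ₗ
      (TensorProduct.assoc k (W.carrier ⊗[k] X.carrier) Y.carrier Z.carrier).toLinearMap := by
  rw [assocLin_toLinearMap, LinearMap.rTensor_comp, rTensor_tensorAct (tensorAct W.act (tensorAct X.act Y.act)) Z.act,
    ← LinearMap.comp_assoc (LinearMap.rTensor _ _), assoc_comp_tensorAct, LinearMap.comp_assoc,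
    ← LinearMap.comp_assoc,
    lTensor_comp_tensorAct W.act (tensorAct (tensorAct X.act Y.act) Z.act)
      (TensorProduct.assoc k X.carrier Y.carrier Z.carrier).toLinearMap
      (Algebra.TensorProduct.assoc k k k H H H).toAlgHom
      (tensorAct X.act (tensorAct Y.act Z.act)) (assoc_comp_tensorAct _ _ _),
    Algebra.TensorProduct.includeLeft_apply, mapSnd_assoc_assoc, LinearMap.comp_assoc]
  congr 1
  apply TensorProduct.ext_fourfold
  intro a b c d
  rfl

theorem assocLin_tensor_right (W X Y Z : QHMod Q) :
    (assocLin W X (tensor Y Z)).toLinearMap =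
      tensorAct W.act (tensorAct X.act (tensorAct Y.act Z.act))
        (mapSnd H (mapSnd H Q.comul) Q.assoc) ∘ₗ
      (TensorProduct.assoc k W.carrier X.carrier (Y.carrier ⊗[k] Z.carrier)).toLinearMap := by
  have h : (tensorAct X.act (tensorAct Y.act Z.act)).comp (mapSnd H Q.comul) =
      tensorAct X.act ((tensorAct Y.act Z.act).comp Q.comul) := by
    apply AlgHom.ext; intro x; exact (tensorAct_comp_right X.act (tensorAct Y.act Z.act) Q.comul x).symm
  have h2 := tensorAct_comp_right W.act (tensorAct X.act (tensorAct Y.act Z.act))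
    (mapSnd H Q.comul) (Q.assoc : H ⊗[k] (H ⊗[k] H))
  rw [h] at h2
  rw [← h2, assocLin_toLinearMap]

theorem assoc_assocLin_tensor_left (W X Y Z : QHMod Q) :
    (TensorProduct.assoc k W.carrier X.carrier (Y.carrier ⊗[k] Z.carrier)).toLinearMap ∘ₗ
      (assocLin (tensor W X) Y Z).toLinearMap =
      tensorAct W.act (tensorAct X.act (tensorAct Y.act Z.act))
        (comulFst Q.comul (H ⊗[k] H) Q.assoc) ∘ₗ
      (TensorProduct.assoc k W.carrier X.carrier (Y.carrier ⊗[k] Z.carrier)).toLinearMap ∘ₗ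
      (TensorProduct.assoc k (W.carrier ⊗[k] X.carrier) Y.carrier Z.carrier).toLinearMap := by
  have := assoc_comp_act W X (tensorAct Y.act Z.act) (Q.assoc : H ⊗[k] (H ⊗[k] H))
  rw [← LinearMap.comp_assoc, ← this, LinearMap.comp_assoc, assocLin_toLinearMap]

theorem assocLin_pentagon (W X Y Z : QHMod Q) :
    LinearMap.lTensor W.carrier (assocLin X Y Z).toLinearMap ∘ₗ
      (assocLin W (tensor X Y) Z).toLinearMap ∘ₗ
        LinearMap.rTensor Z.carrier (assocLin W X Y).toLinearMap =
    (assocLin W X (tensor Y Z)).toLinearMap ∘ₗ (assocLin (tensor W X) Y Z).toLinearMap := by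
  have r1 := assocLin_tensor_right W X Y Z
  have r2 := assoc_assocLin_tensor_left W X Y Z
  have l2 := lTensor_assoc_comp W X Y Z
  have l3 := assoc_rTensor_assocLin W X Y Z
  have c := congrArg (tensorAct W.act (tensorAct X.act (tensorAct Y.act Z.act))) Q.cocycle
  rw [map_mul, map_mul, map_mul, Module.End.mul_eq_comp, Module.End.mul_eq_comp,
    Module.End.mul_eq_comp] at c
  calc _ = tensorAct W.act (tensorAct X.act (tensorAct Y.act Z.act))
        (oneTmul H (H ⊗[k] (H ⊗[k] H)) Q.assoc) ∘ₗ
        (LinearMap.lTensor W.carrier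
        (TensorProduct.assoc k X.carrier Y.carrier Z.carrier).toLinearMap ∘ₗ
      (assocLin W (tensor X Y) Z).toLinearMap) ∘ₗ
        LinearMap.rTensor Z.carrier (assocLin W X Y).toLinearMap := by
        rw [lTensor_assocLin, LinearMap.comp_assoc, LinearMap.comp_assoc]
    _ = _ := by
      rw [l2, LinearMap.comp_assoc, LinearMap.comp_assoc, l3, r1, LinearMap.comp_assoc, r2]
      rw [← LinearMap.comp_assoc, ← LinearMap.comp_assoc, ← LinearMap.comp_assoc, ← c]
      simp only [LinearMap.comp_assoc]

noncomputable instance : MonoidalCategory (QHMod Q) where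
  whiskerLeft_id _ _ := hom_ext TensorProduct.map_id
  id_whiskerRight _ _ := hom_ext TensorProduct.map_id
  tensorHom_def f g := by
    apply hom_ext
    exact TensorProduct.ext' (fun _ _ => rfl)
  id_tensorHom_id V W := by
    apply hom_ext
    exact TensorProduct.map_id
  tensorHom_comp_tensorHom f f' g g' := by
    apply hom_ext
    exact (TensorProduct.map_comp _ _ _ _).symm
  associator_naturality f g h := hom_ext (assocLin_natural f g h)
  leftUnitor_naturality f := by
    apply hom_ext
    exact TensorProduct.ext' (fun x y => by
      change TensorProduct.lid k _ (x ⊗ₜ lin f y) = lin f (TensorProduct.lid k _ (x ⊗ₜ y))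
      simp)
  rightUnitor_naturality f := by
    apply hom_ext
    exact TensorProduct.ext' (fun y x => by
      change TensorProduct.rid k _ (lin f y ⊗ₜ x) = lin f (TensorProduct.rid k _ (y ⊗ₜ x))
      simp)
  pentagon W X Y Z := hom_ext (assocLin_pentagon W X Y Z)
  triangle V W := hom_ext (assocLin_triangle V W)

end QHMod

section InternalHomTools

variable {k : Type u} [CommRing k] {H : Type v} [Ring H] [Algebra k H]
  {M N P : Type u} [AddCommGroup M] [Module k M] [AddCommGroup N] [Module k N]
  [AddCommGroup P] [Module k P]

/-- For actions `ρ` on `M` and `σ` on `N`, the element `x ⊗ y` sends a linear map `L : M → N` to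
the linear map `m ↦ x • L (y • m)`. -/
noncomputable def biAct (ρ : H →ₐ[k] Module.End k M) (σ : H →ₐ[k] Module.End k N) :
    H ⊗[k] H →ₗ[k] Module.End k (M →ₗ[k] N) :=
  TensorProduct.lift (LinearMap.mk₂ k
    (fun x y => LinearMap.lcomp k N (ρ y) ∘ₗ LinearMap.llcomp k M N N (σ x))
    (fun x x' y => by ext L m; simp) (fun c x y => by ext L m; simp)
    (fun x y y' => by ext L m; simp) (fun c x y => by ext L m; simp))

@[simp] theorem biAct_tmul (ρ : H →ₐ[k] Module.End k M) (σ : H →ₐ[k] Module.End k N) (x y : H)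
    (L : M →ₗ[k] N) : biAct ρ σ (x ⊗ₜ y) L = σ x ∘ₗ L ∘ₗ ρ y := by
  ext m; simp [biAct]

/-- The action of `H ⊗ H` on linear maps, `(x ⊗ y) • L = x ∘ L ∘ S(y)`. -/
noncomputable def homAct (S : H ≃ₐ[k] Hᵐᵒᵖ) (ρ : H →ₐ[k] Module.End k M)
    (σ : H →ₐ[k] Module.End k N) : H ⊗[k] H →ₐ[k] Module.End k (M →ₗ[k] N) :=
  Algebra.TensorProduct.algHomOfLinearMapTensorProduct
    (biAct ρ σ ∘ₗ TensorProduct.map LinearMap.id (antiLin S))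
    (by
      intro a a' b b'
      ext L m
      simp [antiLin_mul])
    (by ext L m; simp [antiLin_one])

theorem homAct_apply (S : H ≃ₐ[k] Hᵐᵒᵖ) (ρ : H →ₐ[k] Module.End k M)
    (σ : H →ₐ[k] Module.End k N) (X : H ⊗[k] H) :
    homAct S ρ σ X = biAct ρ σ (TensorProduct.map LinearMap.id (antiLin S) X) := rfl

@[simp] theorem homAct_tmul (S : H ≃ₐ[k] Hᵐᵒᵖ) (ρ : H →ₐ[k] Module.End k M)
    (σ : H →ₐ[k] Module.End k N) (x y : H) (L : M →ₗ[k] N) :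
    homAct S ρ σ (x ⊗ₜ y) L = σ x ∘ₗ L ∘ₗ ρ (antiLin S y) := by
  rw [homAct_apply]; simp

/-- `x ⊗ y ⊗ z ↦ x ⊗ S(y) a z`. -/
noncomputable def foldLeft (S : H →ₗ[k] H) (a : H) : H ⊗[k] (H ⊗[k] H) →ₗ[k] H ⊗[k] H :=
  TensorProduct.map LinearMap.id (sandwichLeft S a)

/-- `x ⊗ y ⊗ z ↦ x ⊗ y b S(z)`. -/
noncomputable def foldRight (S : H →ₗ[k] H) (b : H) : H ⊗[k] (H ⊗[k] H) →ₗ[k] H ⊗[k] H :=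
  TensorProduct.map LinearMap.id (sandwichRight S b)

@[simp] theorem foldLeft_tmul (S : H →ₗ[k] H) (a x : H) (Y : H ⊗[k] H) :
    foldLeft S a (x ⊗ₜ Y) = x ⊗ₜ sandwichLeft S a Y := rfl

@[simp] theorem foldRight_tmul (S : H →ₗ[k] H) (a x : H) (Y : H ⊗[k] H) :
    foldRight S a (x ⊗ₜ Y) = x ⊗ₜ sandwichRight S a Y := rfl

/-- For `X ∈ H ⊗ H`, the linear map `L ⊗ m ↦ X⁽¹⁾ • L (X⁽²⁾ • m)`. -/
noncomputable def evLin (ρ : H →ₐ[k] Module.End k M) (σ : H →ₐ[k] Module.End k N)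
    (X : H ⊗[k] H) : (M →ₗ[k] N) ⊗[k] M →ₗ[k] N :=
  TensorProduct.lift (biAct ρ σ X)

@[simp] theorem evLin_tmul (ρ : H →ₐ[k] Module.End k M) (σ : H →ₐ[k] Module.End k N)
    (X : H ⊗[k] H) (L : M →ₗ[k] N) (m : M) : evLin ρ σ X (L ⊗ₜ m) = biAct ρ σ X L m := by
  simp [evLin]

/-- For `X ∈ H ⊗ H` and `f : M ⊗ N → P`, the linear map `m ↦ (n ↦ f (X⁽¹⁾ • m ⊗ X⁽²⁾ • n))`. -/
noncomputable def curryLin (ρ : H →ₐ[k] Module.End k M) (σ : H →ₐ[k] Module.End k N)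
    (X : H ⊗[k] H) (f : M ⊗[k] N →ₗ[k] P) : M →ₗ[k] N →ₗ[k] P :=
  TensorProduct.curry (f ∘ₗ tensorAct ρ σ X)

@[simp] theorem curryLin_apply (ρ : H →ₐ[k] Module.End k M) (σ : H →ₐ[k] Module.End k N)
    (X : H ⊗[k] H) (f : M ⊗[k] N →ₗ[k] P) (m : M) (n : N) :
    curryLin ρ σ X f m n = f (tensorAct ρ σ X (m ⊗ₜ n)) := rfl

theorem biAct_tmul_one_mul (ρ : H →ₐ[k] Module.End k M) (σ : H →ₐ[k] Module.End k N)
    (h : H) (X : H ⊗[k] H) (L : M →ₗ[k] N) :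
    biAct ρ σ ((h ⊗ₜ 1) * X) L = σ h ∘ₗ biAct ρ σ X L := by
  induction X with
  | zero => simp
  | tmul x y => ext m; simp
  | add x y hx hy =>
    rw [mul_add, map_add, map_add, LinearMap.add_apply, LinearMap.add_apply, hx, hy,
      LinearMap.comp_add]

theorem biAct_foldLeft_assoc (S : H ≃ₐ[k] Hᵐᵒᵖ) (a : H)
    (ρ : H →ₐ[k] Module.End k M) (σ : H →ₐ[k] Module.End k N)
    (X : H ⊗[k] (H ⊗[k] H)) (Z : H ⊗[k] H) (b : H) (L : M →ₗ[k] N) :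
    biAct ρ σ (foldLeft (antiLin S) a X) (homAct S ρ σ Z L) ∘ₗ ρ b =
      biAct ρ σ (foldLeft (antiLin S) a
        (X * Algebra.TensorProduct.assoc k k k H H H (Z ⊗ₜ b))) L := by
  induction Z with
  | zero => simp
  | tmul c d =>
    induction X using tensor_induction₃ with
    | h0 => simp
    | ht x y z => ext m; simp [antiLin_mul]
    | ha X Y hX hY =>
      rw [add_mul, map_add, map_add, map_add, map_add, LinearMap.add_apply, LinearMap.add_apply,
        LinearMap.add_comp, hX, hY]
  | add Z W hZ hW =>
    rw [TensorProduct.add_tmul, map_add, map_add, mul_add, map_add, map_add, LinearMap.add_apply,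
      LinearMap.add_apply, map_add, LinearMap.add_comp, hZ, hW]

/-- `a ⊗ b ⊗ c ⊗ d ↦ a ⊗ b β S(c) α d`. -/
noncomputable def mapZigzag (S : H →ₗ[k] H) (a b : H) :
    H ⊗[k] (H ⊗[k] (H ⊗[k] H)) →ₗ[k] H ⊗[k] H :=
  TensorProduct.map LinearMap.id (zigzag S a b)

/-- `a ⊗ b ⊗ c ⊗ d ↦ a ⊗ S(b) α c β S(d)`. -/
noncomputable def mapZagzig (S : H →ₗ[k] H) (a b : H) :
    H ⊗[k] (H ⊗[k] (H ⊗[k] H)) →ₗ[k] H ⊗[k] H :=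
  TensorProduct.map LinearMap.id (zagzig S a b)

@[simp] theorem mapZigzag_tmul (S : H →ₗ[k] H) (a b x : H) (Y : H ⊗[k] (H ⊗[k] H)) :
    mapZigzag S a b (x ⊗ₜ Y) = x ⊗ₜ zigzag S a b Y := rfl

@[simp] theorem mapZagzig_tmul (S : H →ₗ[k] H) (a b x : H) (Y : H ⊗[k] (H ⊗[k] H)) :
    mapZagzig S a b (x ⊗ₜ Y) = x ⊗ₜ zagzig S a b Y := rfl

end InternalHomTools

namespace QuasiHopfAlgebra

variable {k : Type u} {H : Type v} [CommRing k] [Ring H] [Algebra k H] (Q : QuasiHopfAlgebra k H)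

/-- The element `φ⁽¹⁾ ⊗ S(φ⁽²⁾) α φ⁽³⁾`. -/
noncomputable def evElem : H ⊗[k] H :=
  foldLeft (antiLin Q.antipode) Q.α (Q.assoc : H ⊗[k] (H ⊗[k] H))

/-- The element `φ⁽⁻¹⁾ ⊗ φ⁽⁻²⁾ β S(φ⁽⁻³⁾)`. -/
noncomputable def curryElem : H ⊗[k] H :=
  foldRight (antiLin Q.antipode) Q.β ((Q.assoc⁻¹ : (H ⊗[k] (H ⊗[k] H))ˣ) : H ⊗[k] (H ⊗[k] H))

theorem foldLeft_comul (Y : H ⊗[k] H) (X : H ⊗[k] (H ⊗[k] H)) :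
    foldLeft (antiLin Q.antipode) Q.α (mapSnd H Q.comul Y * X) =
      (counitSnd Q.counit Y ⊗ₜ 1) * foldLeft (antiLin Q.antipode) Q.α X := by
  induction Y with
  | zero => simp
  | tmul a b =>
    induction X with
    | zero => simp
    | tmul x Z => simp [sandwichLeft_mul, Q.antipode_left, sandwichLeft_smul,
        TensorProduct.smul_tmul]
    | add X Z hX hZ => rw [mul_add, map_add, map_add, mul_add, hX, hZ]
  | add Y Z hY hZ =>
    rw [map_add, map_add, add_mul, map_add, TensorProduct.add_tmul, add_mul, hY, hZ]

theorem foldRight_comul (Y : H ⊗[k] H) (X : H ⊗[k] (H ⊗[k] H)) :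
    foldRight (antiLin Q.antipode) Q.β (X * mapSnd H Q.comul Y) =
      foldRight (antiLin Q.antipode) Q.β X * (counitSnd Q.counit Y ⊗ₜ 1) := by
  induction Y with
  | zero => simp
  | tmul a b =>
    induction X with
    | zero => simp
    | tmul x Z => simp [sandwichRight_mul, Q.antipode_right, sandwichRight_smul,
        TensorProduct.smul_tmul]
    | add X Z hX hZ => rw [add_mul, map_add, map_add, add_mul, hX, hZ]
  | add Y Z hY hZ =>
    rw [map_add, map_add, mul_add, map_add, TensorProduct.add_tmul, mul_add, hY, hZ]

theorem counit_assoc_right : mapSnd H (counitSnd Q.counit) Q.assoc = 1 := by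
  have h1 : ∀ X : H ⊗[k] (H ⊗[k] H),
      mapSnd H (mapSnd H (counitFst Q.counit H)) (mapSnd H (mapSnd H Q.comul) X) = X := by
    intro X
    induction X with
    | zero => simp
    | tmul x Y => simp [CochainTwist.mapSnd_counitFst_mapSnd]
    | add x y hx hy => rw [map_add, map_add, hx, hy]
  have h2 : ∀ X : H ⊗[k] (H ⊗[k] H),
      mapSnd H (mapSnd H (counitFst Q.counit H)) (mapSnd H (comulFst Q.comul H) X) = X := by
    intro X
    induction X with
    | zero => simp
    | tmul x Y => simp [CochainTwist.mapSnd_counitFst_comulFst]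
    | add x y hx hy => rw [map_add, map_add, hx, hy]
  have h3 : ∀ X : H ⊗[k] (H ⊗[k] H),
      mapSnd H (mapSnd H (counitFst Q.counit H)) (mapSnd H (tmulOne H H) X) =
        tmulOne H H (mapSnd H (counitSnd Q.counit) X) := by
    intro X
    induction X with
    | zero => simp
    | tmul x Y => simp [CochainTwist.mapSnd_counitFst_tmulOne]
    | add x y hx hy => rw [map_add, map_add, map_add, map_add, hx, hy]
  have h4 : ∀ X : H ⊗[k] H, mapSnd H (counitSnd Q.counit) (tmulOne H H X) = X := by
    intro X
    induction X with
    | zero => simp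
    | tmul x Y => simp
    | add x y hx hy => rw [map_add, map_add, hx, hy]
  have c := congrArg (mapSnd H (mapSnd H (counitFst Q.counit H))) Q.cocycle
  rw [map_mul, map_mul, map_mul, h1, h2, h3, mapSnd_comulFst, mapSnd_oneTmul, Q.counit_assoc,
    map_one, map_one, one_mul] at c
  have c' := congrArg (fun X => mapSnd H (counitSnd Q.counit)
    (((Q.assoc⁻¹ : (H ⊗[k] (H ⊗[k] H))ˣ) : H ⊗[k] (H ⊗[k] H)) * X)) c
  simp only [← mul_assoc, Units.inv_mul, one_mul, map_one, h4] at c'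
  exact c'.symm

theorem counit_assoc_inv : mapSnd H (counitFst Q.counit H)
    ((Q.assoc⁻¹ : (H ⊗[k] (H ⊗[k] H))ˣ) : H ⊗[k] (H ⊗[k] H)) = 1 := by
  have h : mapSnd H (counitFst Q.counit H)
    (Q.assoc * ((Q.assoc⁻¹ : (H ⊗[k] (H ⊗[k] H))ˣ) : H ⊗[k] (H ⊗[k] H))) = 1 := by simp
  rwa [map_mul, Q.counit_assoc, one_mul] at h

theorem mapZigzag_eq : mapZigzag (antiLin Q.antipode) Q.α Q.β
    (comulFst Q.comul (H ⊗[k] H) Q.assoc * mapSnd H (tmulOne H H)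
      ((Q.assoc⁻¹ : (H ⊗[k] (H ⊗[k] H))ˣ) : H ⊗[k] (H ⊗[k] H))) = 1 := by
  have h1 : ∀ (X : H ⊗[k] (H ⊗[k] H)) (W : H ⊗[k] (H ⊗[k] (H ⊗[k] H))),
      mapZigzag (antiLin Q.antipode) Q.α Q.β (mapSnd H (mapSnd H Q.comul) X * W) =
        mapSnd H (counitSnd Q.counit) X * mapZigzag (antiLin Q.antipode) Q.α Q.β W := by
    intro X W
    induction X with
    | zero => simp
    | tmul x X =>
      induction W with
      | zero => simp
      | tmul w W =>
        have := CochainTwist.zigzag_comul (Q := Q) X 1 W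
        rw [map_one, mul_one, map_one, mul_one] at this
        simp [this]
      | add X Z hX hZ => rw [mul_add, map_add, map_add, mul_add, hX, hZ]
    | add X Z hX hZ => rw [map_add, map_add, add_mul, map_add, add_mul, hX, hZ]
  have h2 : ∀ (X : H ⊗[k] (H ⊗[k] H)),
      mapZigzag (antiLin Q.antipode) Q.α Q.β (oneTmul H (H ⊗[k] (H ⊗[k] H)) Q.assoc *
        mapSnd H (comulFst Q.comul H) X) = mapSnd H (counitFst Q.counit H) X := by
    intro X
    induction X with
    | zero => simp
    | tmul x X =>
      have := CochainTwist.zigzag_comul (Q := Q) 1 X Q.assoc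
      rw [map_one, one_mul, map_one, one_mul] at this
      have h3 : zigzag (antiLin Q.antipode) Q.α Q.β (Q.assoc : H ⊗[k] (H ⊗[k] H)) = 1 :=
        Q.antipode_assoc
      simp [this, h3]
    | add X Z hX hZ => rw [map_add, map_add, mul_add, map_add, hX, hZ]
  have h3 : mapSnd H (mapSnd H Q.comul) Q.assoc * (comulFst Q.comul (H ⊗[k] H) Q.assoc *
      mapSnd H (tmulOne H H) ((Q.assoc⁻¹ : (H ⊗[k] (H ⊗[k] H))ˣ) : H ⊗[k] (H ⊗[k] H))) =
      oneTmul H (H ⊗[k] (H ⊗[k] H)) Q.assoc * mapSnd H (comulFst Q.comul H) Q.assoc := by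
    rw [← mul_assoc, Q.cocycle, mul_assoc, ← map_mul]
    simp
  have h4 := congrArg (mapZigzag (antiLin Q.antipode) Q.α Q.β) h3
  rwa [h1, h2, Q.counit_assoc, Q.counit_assoc_right, one_mul] at h4

theorem mapZagzig_eq : mapZagzig (antiLin Q.antipode) Q.α Q.β
    (mapSnd H (tmulOne H H) Q.assoc * comulFst Q.comul (H ⊗[k] H)
      ((Q.assoc⁻¹ : (H ⊗[k] (H ⊗[k] H))ˣ) : H ⊗[k] (H ⊗[k] H))) = 1 := by
  have h1 : ∀ (X Y : H ⊗[k] (H ⊗[k] H)),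
      mapZagzig (antiLin Q.antipode) Q.α Q.β (mapSnd H (comulFst Q.comul H) X *
        oneTmul H (H ⊗[k] (H ⊗[k] H)) ((Q.assoc⁻¹ : (H ⊗[k] (H ⊗[k] H))ˣ) : H ⊗[k] (H ⊗[k] H)) *
          mapSnd H (mapSnd H Q.comul) Y) =
        TensorProduct.map LinearMap.id (antiLin Q.antipode)
          (mapSnd H (counitFst Q.counit H) X * mapSnd H (counitSnd Q.counit) Y) := by
    intro X Y
    induction X with
    | zero => simp
    | tmul x X =>
      induction Y with
      | zero => simp
      | tmul y Y =>
        have h := CochainTwist.zagzig_comul (Q := Q) X Y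
          ((Q.assoc⁻¹ : (H ⊗[k] (H ⊗[k] H))ˣ) : H ⊗[k] (H ⊗[k] H))
        have h3 : zagzig (antiLin Q.antipode) Q.α Q.β
            ((Q.assoc⁻¹ : (H ⊗[k] (H ⊗[k] H))ˣ) : H ⊗[k] (H ⊗[k] H)) = 1 :=
          Q.antipode_assoc_inv
        rw [h3, mul_one] at h
        simp [h, antiLin_mul]
      | add X Z hX hZ => rw [map_add, mul_add, map_add, map_add, mul_add, map_add, hX, hZ]
    | add X Z hX hZ =>
      rw [map_add, map_add, add_mul, add_mul, add_mul, map_add, map_add, hX, hZ]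
  have i1 : mapSnd H (comulFst Q.comul H)
      ((Q.assoc⁻¹ : (H ⊗[k] (H ⊗[k] H))ˣ) : H ⊗[k] (H ⊗[k] H)) *
      mapSnd H (comulFst Q.comul H) Q.assoc = 1 := by
    rw [← map_mul]; simp
  have i2 : oneTmul (k := k) H (H ⊗[k] (H ⊗[k] H))
      ((Q.assoc⁻¹ : (H ⊗[k] (H ⊗[k] H))ˣ) : H ⊗[k] (H ⊗[k] H)) *
      oneTmul (k := k) H (H ⊗[k] (H ⊗[k] H)) Q.assoc = 1 := by
    rw [← map_mul, Units.inv_mul, map_one]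
  have i3 : comulFst Q.comul (H ⊗[k] H) Q.assoc * comulFst Q.comul (H ⊗[k] H)
      ((Q.assoc⁻¹ : (H ⊗[k] (H ⊗[k] H))ˣ) : H ⊗[k] (H ⊗[k] H)) = 1 := by
    rw [← map_mul]; simp
  have h3 : mapSnd H (tmulOne H H) Q.assoc * comulFst Q.comul (H ⊗[k] H)
      ((Q.assoc⁻¹ : (H ⊗[k] (H ⊗[k] H))ˣ) : H ⊗[k] (H ⊗[k] H)) =
      mapSnd H (comulFst Q.comul H)
        ((Q.assoc⁻¹ : (H ⊗[k] (H ⊗[k] H))ˣ) : H ⊗[k] (H ⊗[k] H)) *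
        oneTmul H (H ⊗[k] (H ⊗[k] H)) ((Q.assoc⁻¹ : (H ⊗[k] (H ⊗[k] H))ˣ) : H ⊗[k] (H ⊗[k] H)) *
          mapSnd H (mapSnd H Q.comul) Q.assoc := by
    calc
      _ = mapSnd H (comulFst Q.comul H)
          ((Q.assoc⁻¹ : (H ⊗[k] (H ⊗[k] H))ˣ) : H ⊗[k] (H ⊗[k] H)) *
          (oneTmul H (H ⊗[k] (H ⊗[k] H)) ((Q.assoc⁻¹ : (H ⊗[k] (H ⊗[k] H))ˣ) : H ⊗[k] (H ⊗[k] H)) *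
          oneTmul H (H ⊗[k] (H ⊗[k] H)) Q.assoc) *
          mapSnd H (comulFst Q.comul H) Q.assoc *
          mapSnd H (tmulOne H H) Q.assoc * comulFst Q.comul (H ⊗[k] H)
          ((Q.assoc⁻¹ : (H ⊗[k] (H ⊗[k] H))ˣ) : H ⊗[k] (H ⊗[k] H)) := by
          rw [i2, mul_one, i1, one_mul]
      _ = mapSnd H (comulFst Q.comul H)
          ((Q.assoc⁻¹ : (H ⊗[k] (H ⊗[k] H))ˣ) : H ⊗[k] (H ⊗[k] H)) *
          oneTmul H (H ⊗[k] (H ⊗[k] H)) ((Q.assoc⁻¹ : (H ⊗[k] (H ⊗[k] H))ˣ) : H ⊗[k] (H ⊗[k] H)) *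
          (oneTmul H (H ⊗[k] (H ⊗[k] H)) Q.assoc *
          mapSnd H (comulFst Q.comul H) Q.assoc *
          mapSnd H (tmulOne H H) Q.assoc) * comulFst Q.comul (H ⊗[k] H)
          ((Q.assoc⁻¹ : (H ⊗[k] (H ⊗[k] H))ˣ) : H ⊗[k] (H ⊗[k] H)) := by
          simp only [mul_assoc]
      _ = _ := by
          rw [← Q.cocycle]
          simp only [mul_assoc]
          rw [i3, mul_one]
  rw [h3, h1, Q.counit_assoc_inv, Q.counit_assoc_right]
  simp [Algebra.TensorProduct.one_def, antiLin_one]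

end QuasiHopfAlgebra

/-- A (right) closed structure on a monoidal category: an internal hom functor
`Cᵒᵖ ⥤ C ⥤ C` and bijections `Hom(V ⊗ W, X) ≃ Hom(V, hom(W, X))`, natural in `V`, `W` and `X`. -/
class RightMonoidalClosed (C : Type*) [Category C] [MonoidalCategory C] where
  /-- the internal hom functor -/
  ihom : Cᵒᵖ ⥤ C ⥤ C
  /-- the currying bijections -/
  curry {V W X : C} : (V ⊗ W ⟶ X) ≃ (V ⟶ (ihom.obj (Opposite.op W)).obj X)
  curry_natural_left {V V' W X : C} (f : V' ⟶ V) (g : V ⊗ W ⟶ X) :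
    curry (f ▷ W ≫ g) = f ≫ curry g
  curry_natural_mid {V W W' X : C} (f : W' ⟶ W) (g : V ⊗ W ⟶ X) :
    curry (V ◁ f ≫ g) = curry g ≫ (ihom.map f.op).app X
  curry_natural_right {V W X X' : C} (g : V ⊗ W ⟶ X) (h : X ⟶ X') :
    curry (g ≫ h) = curry g ≫ (ihom.obj (Opposite.op W)).map h

namespace RightMonoidalClosed

variable {C : Type*} [Category C] [MonoidalCategory C] [RightMonoidalClosed C]

/-- The internal hom object `hom(V, W)`. -/
abbrev hom (V W : C) : C := ((ihom (C := C)).obj (Opposite.op V)).obj W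

/-- The evaluation `hom(V, W) ⊗ V ⟶ W`. -/
def ev (V W : C) : hom V W ⊗ V ⟶ W := curry.symm (𝟙 (hom V W))

/-- The internal composition `hom(W, X) ⊗ hom(V, W) ⟶ hom(V, X)`. -/
def icomp (V W X : C) : hom W X ⊗ hom V W ⟶ hom V X :=
  curry ((α_ (hom W X) (hom V W) V).hom ≫ hom W X ◁ ev V W ≫ ev W X)

end RightMonoidalClosed

namespace QHMod

variable {k : Type u} {H : Type v} [CommRing k] [Ring H] [Algebra k H]
  {Q : QuasiHopfAlgebra k H}

/-- The internal hom object: all `k`-linear maps `L : V → W`, with the adjoint action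
`h • L = h₍₁₎ ∘ L ∘ S(h₍₂₎)`. -/
noncomputable abbrev internalHom (V W : QHMod Q) : QHMod Q where
  carrier := V.carrier →ₗ[k] W.carrier
  act := (homAct Q.antipode V.act W.act).comp Q.comul

theorem internalHom_act (V W : QHMod Q) (h : H) (L : V.carrier →ₗ[k] W.carrier) :
    (internalHom V W).act h L = homAct Q.antipode V.act W.act (Q.comul h) L := rfl

theorem homAct_comp (S : H ≃ₐ[k] Hᵐᵒᵖ) {V W V' W' : QHMod Q} (f : V' ⟶ V) (g : W ⟶ W')
    (X : H ⊗[k] H) (L : V.carrier →ₗ[k] W.carrier) :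
    lin g ∘ₗ (homAct S V.act W.act X L) ∘ₗ lin f =
      homAct S V'.act W'.act X (lin g ∘ₗ L ∘ₗ lin f) := by
  induction X with
  | zero => simp
  | tmul x y =>
    ext v
    simp [lin_act]
  | add X Y hX hY =>
    rw [map_add, map_add, LinearMap.add_apply, LinearMap.add_apply, LinearMap.add_comp,
      LinearMap.comp_add, hX, hY]

/-- The map `L ↦ g ∘ L ∘ f` between internal homs. -/
noncomputable def internalHomMap {V W V' W' : QHMod Q} (f : V' ⟶ V) (g : W ⟶ W') :
    internalHom V W ⟶ internalHom V' W' :=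
  ofLin (LinearMap.lcomp k W'.carrier (lin f) ∘ₗ LinearMap.llcomp k V.carrier _ _ (lin g))
    (fun h => by
      apply LinearMap.ext; intro L
      exact homAct_comp Q.antipode f g (Q.comul h) L)

theorem internalHomMap_apply {V W V' W' : QHMod Q} (f : V' ⟶ V) (g : W ⟶ W')
    (L : V.carrier →ₗ[k] W.carrier) :
    lin (internalHomMap f g) L = lin g ∘ₗ L ∘ₗ lin f := rfl

/-- The internal hom functor. -/
noncomputable def internalHomFunctor (Q : QuasiHopfAlgebra k H) :
    (QHMod Q)ᵒᵖ ⥤ QHMod Q ⥤ QHMod Q where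
  obj V :=
    { obj := fun W => internalHom V.unop W
      map := fun g => internalHomMap (𝟙 _) g }
  map f := { app := fun W => internalHomMap f.unop (𝟙 W) }

theorem evLin_comp_tensorAct (V W : QHMod Q) (X : H ⊗[k] (H ⊗[k] H)) (Y : H ⊗[k] H) :
    evLin V.act W.act (foldLeft (antiLin Q.antipode) Q.α X) ∘ₗ
        tensorAct ((homAct Q.antipode V.act W.act).comp Q.comul) V.act Y =
      evLin V.act W.act (foldLeft (antiLin Q.antipode) Q.α (X * comulFst Q.comul H Y)) := by
  induction Y with
  | zero => ext; simp
  | tmul a b =>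
    apply TensorProduct.ext'
    intro L v
    have := LinearMap.congr_fun
      (biAct_foldLeft_assoc Q.antipode Q.α V.act W.act X (Q.comul a) b L) v
    rw [← comulFst_tmul] at this
    simpa using this
  | add Y Z hY hZ =>
    rw [map_add, LinearMap.comp_add, hY, hZ]
    ext; simp [mul_add]

/-- The evaluation `hom(V, W) ⊗ V → W`, `L ⊗ v ↦ φ⁽¹⁾ • L ((S(φ⁽²⁾) α φ⁽³⁾) • v)`. -/
noncomputable def eval (V W : QHMod Q) : tensor (internalHom V W) V ⟶ W :=
  ofLin (evLin V.act W.act Q.evElem) (fun h => by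
    have h1 := evLin_comp_tensorAct V W (Q.assoc : H ⊗[k] (H ⊗[k] H)) (Q.comul h)
    rw [← Q.coassoc, Q.foldLeft_comul, Q.comul_counit] at h1
    refine Eq.trans h1 ?_
    apply TensorProduct.ext'
    intro L v
    have := LinearMap.congr_fun (biAct_tmul_one_mul V.act W.act h
      (foldLeft (antiLin Q.antipode) Q.α (Q.assoc : H ⊗[k] (H ⊗[k] H))) L) v
    simpa [QuasiHopfAlgebra.evElem] using this)

theorem curryLin_mul_tmul_one {V W : QHMod Q} {P : Type u} [AddCommGroup P] [Module k P]
    (f : V.carrier ⊗[k] W.carrier →ₗ[k] P) (X : H ⊗[k] H) (h : H) (v : V.carrier) :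
    curryLin V.act W.act (X * (h ⊗ₜ 1)) f v = curryLin V.act W.act X f (V.act h v) := by
  ext w
  rw [curryLin_apply, curryLin_apply, map_mul, Module.End.mul_apply]
  simp

theorem homAct_curryLin {V W X : QHMod Q} (f : tensor V W ⟶ X) (Y : H ⊗[k] (H ⊗[k] H))
    (Z : H ⊗[k] H) (v : V.carrier) :
    homAct Q.antipode W.act X.act Z
        (curryLin V.act W.act (foldRight (antiLin Q.antipode) Q.β Y) (lin f) v) =
      curryLin V.act W.act (foldRight (antiLin Q.antipode) Q.β (comulFst Q.comul H Z * Y))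
        (lin f) v := by
  induction Z with
  | zero => ext w; simp
  | tmul a b =>
    have key : ∀ D : H ⊗[k] H, ∀ w,
        lin f (tensorAct V.act W.act D (tensorAct V.act W.act
          (foldRight (antiLin Q.antipode) Q.β Y) (v ⊗ₜ W.act (antiLin Q.antipode b) w))) =
        lin f (tensorAct V.act W.act (foldRight (antiLin Q.antipode) Q.β
          (Algebra.TensorProduct.assoc k k k H H H (D ⊗ₜ b) * Y)) (v ⊗ₜ w)) := by
      intro D w
      induction D with
      | zero => simp
      | tmul c d =>
        induction Y using tensor_induction₃ with
        | h0 => simp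
        | ht x y z => simp [antiLin_mul]
        | ha X Y hX hY =>
          simp only [map_add, mul_add, LinearMap.add_apply, hX, hY]
      | add X Y hX hY =>
        simp only [map_add, add_mul, TensorProduct.add_tmul, LinearMap.add_apply, hX, hY]
    ext w
    rw [homAct_tmul, LinearMap.comp_apply, LinearMap.comp_apply, curryLin_apply, curryLin_apply,
      ← lin_act, comulFst_tmul]
    exact key (Q.comul a) w
  | add Z Z' hZ hZ' =>
    ext w
    rw [map_add, LinearMap.add_apply, hZ, hZ']
    simp [add_mul]

theorem biAct_curryLin {V W X : QHMod Q} (f : tensor V W ⟶ X) (Y Z : H ⊗[k] (H ⊗[k] H))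
    (v : V.carrier) :
    biAct W.act X.act (foldLeft (antiLin Q.antipode) Q.α Z)
        (curryLin V.act W.act (foldRight (antiLin Q.antipode) Q.β Y) (lin f) v) =
      curryLin V.act W.act (mapZigzag (antiLin Q.antipode) Q.α Q.β
        (comulFst Q.comul (H ⊗[k] H) Z * mapSnd H (tmulOne H H) Y)) (lin f) v := by
  induction Z using tensor_induction₃ with
  | h0 => ext w; simp
  | ht a b c =>
    have key : ∀ D : H ⊗[k] H, ∀ w,
        lin f (tensorAct V.act W.act D (tensorAct V.act W.act
          (foldRight (antiLin Q.antipode) Q.β Y)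
            (v ⊗ₜ W.act (antiLin Q.antipode b * Q.α * c) w))) =
        lin f (tensorAct V.act W.act (mapZigzag (antiLin Q.antipode) Q.α Q.β
          (Algebra.TensorProduct.assoc k k k H H (H ⊗[k] H) (D ⊗ₜ (b ⊗ₜ c)) *
            mapSnd H (tmulOne H H) Y)) (v ⊗ₜ w)) := by
      intro D w
      induction D with
      | zero => simp
      | tmul x y =>
        induction Y using tensor_induction₃ with
        | h0 => simp
        | ht x y z => simp [antiLin_mul]
        | ha X Y hX hY =>
          simp only [map_add, mul_add, LinearMap.add_apply, hX, hY]
      | add X Y hX hY =>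
        simp only [map_add, add_mul, TensorProduct.add_tmul, LinearMap.add_apply, hX, hY]
    ext w
    rw [foldLeft_tmul, sandwichLeft_tmul, biAct_tmul, LinearMap.comp_apply, LinearMap.comp_apply,
      curryLin_apply, curryLin_apply, ← lin_act, comulFst_tmul]
    exact key (Q.comul a) w
  | ha Z Z' hZ hZ' =>
    ext w
    rw [map_add, map_add, LinearMap.add_apply, hZ, hZ']
    simp [add_mul]

theorem curryLin_evLin {V W X : QHMod Q} (g : V ⟶ internalHom W X) (Y Z : H ⊗[k] (H ⊗[k] H))
    (v : V.carrier) :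
    curryLin V.act W.act (foldRight (antiLin Q.antipode) Q.β Y)
        (evLin W.act X.act (foldLeft (antiLin Q.antipode) Q.α Z) ∘ₗ
          LinearMap.rTensor W.carrier (lin g)) v =
      biAct W.act X.act (mapZagzig (antiLin Q.antipode) Q.α Q.β
        (mapSnd H (tmulOne H H) Z * comulFst Q.comul (H ⊗[k] H) Y)) (lin g v) := by
  induction Y using tensor_induction₃ with
  | h0 => ext w; simp
  | ht a b c =>
    have key : ∀ (D : H ⊗[k] H) (L : W.carrier →ₗ[k] X.carrier) (w : W.carrier),
        biAct W.act X.act (foldLeft (antiLin Q.antipode) Q.α Z)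
          (homAct Q.antipode W.act X.act D L) (W.act (b * Q.β * antiLin Q.antipode c) w) =
        biAct W.act X.act (mapZagzig (antiLin Q.antipode) Q.α Q.β
        (mapSnd H (tmulOne H H) Z *
          Algebra.TensorProduct.assoc k k k H H (H ⊗[k] H) (D ⊗ₜ (b ⊗ₜ c)))) L w := by
      intro D L w
      induction D with
      | zero => simp
      | tmul x y =>
        induction Z using tensor_induction₃ with
        | h0 => simp
        | ht x y z => simp [antiLin_mul]
        | ha X Y hX hY =>
          simp only [map_add, add_mul, LinearMap.add_apply, hX, hY]
      | add X Y hX hY =>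
        simp only [map_add, mul_add, TensorProduct.add_tmul, LinearMap.add_apply, hX, hY]
    ext w
    rw [foldRight_tmul, sandwichRight_tmul, curryLin_apply, tensorAct_tmul_tmul,
      LinearMap.comp_apply, LinearMap.rTensor_tmul, evLin_tmul, lin_act, comulFst_tmul]
    exact key (Q.comul a) (lin g v) w
  | ha Z Z' hZ hZ' =>
    rw [map_add, map_add, mul_add, map_add, map_add, LinearMap.add_apply, ← hZ, ← hZ']
    ext w
    simp

/-- The currying map `ζ(f)(v) = f (φ⁽⁻¹⁾ • v ⊗ (φ⁽⁻²⁾ β S(φ⁽⁻³⁾)) • (-))`. -/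
noncomputable def curryHom {V W X : QHMod Q} (f : tensor V W ⟶ X) : V ⟶ internalHom W X :=
  ofLin (curryLin V.act W.act Q.curryElem (lin f)) (fun h => by
    have h0 : ((Q.assoc⁻¹ : (H ⊗[k] (H ⊗[k] H))ˣ) : H ⊗[k] (H ⊗[k] H)) *
        mapSnd H Q.comul (Q.comul h) = comulFst Q.comul H (Q.comul h) *
        ((Q.assoc⁻¹ : (H ⊗[k] (H ⊗[k] H))ˣ) : H ⊗[k] (H ⊗[k] H)) := by
      rw [Units.inv_mul_eq_iff_eq_mul, ← mul_assoc, Units.eq_mul_inv_iff_mul_eq, Q.coassoc]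
    apply LinearMap.ext
    intro v
    have h1 := homAct_curryLin f
      ((Q.assoc⁻¹ : (H ⊗[k] (H ⊗[k] H))ˣ) : H ⊗[k] (H ⊗[k] H)) (Q.comul h) v
    rw [← h0, Q.foldRight_comul, Q.comul_counit, curryLin_mul_tmul_one] at h1
    exact h1.symm)

/-- The inverse `g ↦ ev ∘ (g ⊗ id)` of the currying map. -/
noncomputable def uncurryHom {V W X : QHMod Q} (g : V ⟶ internalHom W X) : tensor V W ⟶ X :=
  tensorMap g (𝟙 W) ≫ eval W X

theorem uncurry_curry {V W X : QHMod Q} (f : tensor V W ⟶ X) : uncurryHom (curryHom f) = f := by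
  apply hom_ext
  apply TensorProduct.ext'
  intro v w
  have h := LinearMap.congr_fun (biAct_curryLin f
    ((Q.assoc⁻¹ : (H ⊗[k] (H ⊗[k] H))ˣ) : H ⊗[k] (H ⊗[k] H)) Q.assoc v) w
  rw [Q.mapZigzag_eq, curryLin_apply, map_one, Module.End.one_apply] at h
  rw [← h]
  exact evLin_tmul _ _ _ _ _

theorem curry_uncurry {V W X : QHMod Q} (g : V ⟶ internalHom W X) :
    curryHom (uncurryHom g) = g := by
  apply hom_ext
  apply LinearMap.ext
  intro v
  have h := curryLin_evLin g
    ((Q.assoc⁻¹ : (H ⊗[k] (H ⊗[k] H))ˣ) : H ⊗[k] (H ⊗[k] H)) Q.assoc v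
  rw [Q.mapZagzig_eq, Algebra.TensorProduct.one_def, biAct_tmul, map_one, map_one] at h
  exact h

noncomputable instance : RightMonoidalClosed (QHMod Q) where
  ihom := internalHomFunctor Q
  curry {V W X} :=
    { toFun := fun f => (curryHom (V := V) (W := W) (X := X) f : V ⟶ internalHom W X)
      invFun := fun g => uncurryHom (V := V) (W := W) (X := X) g
      left_inv := fun f => uncurry_curry f
      right_inv := fun g => curry_uncurry g }
  curry_natural_left {V V' W X} f g := by
    apply hom_ext
    apply LinearMap.ext; intro v
    apply LinearMap.ext; intro w
    exact congrArg (lin g) (LinearMap.congr_fun (map_comp_tensorAct V'.act W.act V.act W.act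
      (lin f) LinearMap.id (lin_comm f) (fun _ => rfl) Q.curryElem) (v ⊗ₜ w))
  curry_natural_mid {V W W' X} f g := by
    apply hom_ext
    apply LinearMap.ext; intro v
    apply LinearMap.ext; intro w
    exact congrArg (lin g) (LinearMap.congr_fun (map_comp_tensorAct V.act W'.act V.act W.act
      LinearMap.id (lin f) (fun _ => rfl) (lin_comm f) Q.curryElem) (v ⊗ₜ w))
  curry_natural_right {V W X X'} g h := rfl

/-- The evaluation of the closed structure is `L ⊗ v ↦ φ⁽¹⁾ • L ((S(φ⁽²⁾) α φ⁽³⁾) • v)`. -/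
theorem lin_ev_tmul (V W : QHMod Q) (L : V.carrier →ₗ[k] W.carrier) (v : V.carrier) :
    lin (RightMonoidalClosed.ev V W) (L ⊗ₜ v) = biAct V.act W.act Q.evElem L v :=
  evLin_tmul _ _ _ _ _

/-- The currying bijection is `ζ(f)(v)(w) = f (φ⁽⁻¹⁾ • v ⊗ (φ⁽⁻²⁾ β S(φ⁽⁻³⁾)) • w)`. -/
theorem lin_curry_apply {V W X : QHMod Q} (f : V ⊗ W ⟶ X) (v : V.carrier) :
    lin (RightMonoidalClosed.curry f) v = curryLin V.act W.act Q.curryElem (lin f) v := rfl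

end QHMod

namespace QHMod

variable {k : Type u} {H : Type v} [CommRing k] [Ring H] [Algebra k H]

section Limits

variable (Q : QuasiHopfAlgebra k H)

/-- The underlying `k`-module of an `H`-module. -/
noncomputable def forgetToModule : QHMod Q ⥤ ModuleCat.{u} k where
  obj V := ModuleCat.of k V.carrier
  map f := ModuleCat.ofHom (lin f)

/-- The `H`-module structure on the carrier, in the sense of unbundled modules over a ring. -/
abbrev ringModule {Q : QuasiHopfAlgebra k H} (V : QHMod Q) : Module H V.carrier :=
  Module.compHom V.carrier (V.act : H →+* Module.End k V.carrier)

/-- The functor to the category of modules over the ring `H`. -/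
noncomputable def toModuleCat : QHMod Q ⥤ ModuleCat.{u} H where
  obj V := letI := ringModule V; ModuleCat.of H V.carrier
  map {V W} f := letI := ringModule V; letI := ringModule W
    ModuleCat.ofHom
      { toFun := lin f
        map_add' := map_add _
        map_smul' := fun h v => lin_act f h v }

instance : (toModuleCat Q).Faithful where
  map_injective {V W f g} h := by
    apply hom_ext
    ext v
    exact congrArg (fun m => m.hom v) h

instance : (toModuleCat Q).Full where
  map_surjective {V W} f := by
    let _ := ringModule V
    let _ := ringModule W
    refine ⟨ofLin { toFun := f.hom, map_add' := map_add _, map_smul' := fun c v => ?_ }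
      (fun h => ?_), ?_⟩
    · have h := f.hom.map_smul (algebraMap k H c) v
      change f.hom (V.act (algebraMap k H c) v) = W.act (algebraMap k H c) (f.hom v) at h
      rw [V.act.commutes, W.act.commutes] at h
      exact h
    · ext v
      exact f.hom.map_smul h v
    · rfl

instance : (toModuleCat Q).EssSurj where
  mem_essImage M := by
    let _ : Module k M := Module.compHom M (algebraMap k H)
    have : IsScalarTower k H M := IsScalarTower.of_algebraMap_smul (fun _ _ => rfl)
    refine ⟨{ carrier := M, act := Algebra.lsmul k k M }, ⟨LinearEquiv.toModuleIso ?_⟩⟩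
    exact
      { toFun := fun m => m
        invFun := fun m => m
        map_add' := fun _ _ => rfl
        map_smul' := fun _ _ => rfl }

instance : (toModuleCat Q).IsEquivalence where

/-- Both ways to forget to `k`-modules agree. -/
noncomputable def forgetIso :
    toModuleCat Q ⋙ ModuleCat.restrictScalars (algebraMap k H) ≅ forgetToModule Q :=
  NatIso.ofComponents (fun V =>
    let X := (ModuleCat.restrictScalars (algebraMap k H)).obj ((toModuleCat Q).obj V)
    let e : X ≃ₗ[k] V.carrier :=
      { toFun := fun m => m
        invFun := fun m => m
        map_add' := fun _ _ => rfl
        map_smul' := fun c m => by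
          change V.act (algebraMap k H c) m = c • (show V.carrier from m)
          rw [V.act.commutes]
          rfl }
    { hom := ModuleCat.ofHom (X := X) e.toLinearMap
      inv := ModuleCat.ofHom (Y := X) e.symm.toLinearMap
      hom_inv_id := rfl
      inv_hom_id := rfl }) (fun f => rfl)

instance : HasColimitsOfSize.{0, 0} (QHMod Q) :=
  Adjunction.has_colimits_of_equivalence (toModuleCat Q)

instance : HasLimitsOfSize.{0, 0} (QHMod Q) :=
  Adjunction.has_limits_of_equivalence (toModuleCat Q)

theorem preservesColimits_restrictScalars :
    PreservesColimitsOfSize.{0, 0} (ModuleCat.restrictScalars.{u} (algebraMap k H)) :=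
  ⟨⟨fun {_} => ModuleCat.preservesColimit_restrictScalars _ _⟩⟩

instance : PreservesColimitsOfSize.{0, 0} (forgetToModule Q) :=
  have := preservesColimits_restrictScalars (k := k) (H := H)
  have : PreservesColimitsOfSize.{0, 0}
    (toModuleCat Q ⋙ ModuleCat.restrictScalars.{u} (algebraMap k H)) :=
    comp_preservesColimits _ _
  preservesColimits_of_natIso (forgetIso Q)

instance : (forgetToModule Q).ReflectsIsomorphisms where
  reflects {V W} f hf := by
    let e : V.carrier ≃ₗ[k] W.carrier :=
      (asIso ((forgetToModule Q).map f)).toLinearEquiv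
    have he : e.toLinearMap = lin f := rfl
    have : f = (isoOfLin e (fun h => by rw [he]; exact lin_comm f h)).hom := rfl
    rw [this]
    infer_instance

instance : ReflectsColimitsOfSize.{0, 0} (forgetToModule Q) :=
  reflectsColimits_of_reflectsIsomorphisms

instance (X : QHMod Q) : PreservesColimitsOfSize.{0, 0} (tensorLeft X) := by
  have i : tensorLeft X ⋙ forgetToModule Q ≅
    forgetToModule Q ⋙ tensorLeft ((forgetToModule Q).obj X) :=
    NatIso.ofComponents (fun V => Iso.refl _) (fun f => rfl)
  have : PreservesColimitsOfSize.{0, 0} (tensorLeft X ⋙ forgetToModule Q) :=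
    preservesColimits_of_natIso i.symm
  exact preservesColimits_of_reflects_of_preserves _ (forgetToModule Q)

instance (X : QHMod Q) : PreservesColimitsOfSize.{0, 0} (tensorRight X) := by
  have i : tensorRight X ⋙ forgetToModule Q ≅
    forgetToModule Q ⋙ tensorRight ((forgetToModule Q).obj X) :=
    NatIso.ofComponents (fun V => Iso.refl _) (fun f => rfl)
  have : PreservesColimitsOfSize.{0, 0} (tensorRight X ⋙ forgetToModule Q) :=
    preservesColimits_of_natIso i.symm
  exact preservesColimits_of_reflects_of_preserves _ (forgetToModule Q)

instance : HasCoequalizers (QHMod Q) := inferInstance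
instance : HasEqualizers (QHMod Q) := inferInstance

end Limits

end QHMod

namespace RightMonoidalClosed

section

variable {C : Type*} [Category C] [MonoidalCategory C] [RightMonoidalClosed C]

theorem curry_whiskerRight_ev {V W X : C} (g : V ⟶ hom W X) :
    curry (g ▷ W ≫ ev W X) = g := by
  rw [curry_natural_left, ev, Equiv.apply_symm_apply, Category.comp_id]

theorem whiskerRight_curry_ev {V W X : C} (f : V ⊗ W ⟶ X) : curry f ▷ W ≫ ev W X = f := by
  apply curry.injective
  rw [curry_whiskerRight_ev]

theorem hom_ext_ev {V W X : C} {f g : V ⟶ hom W X} (h : f ▷ W ≫ ev W X = g ▷ W ≫ ev W X) :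
    f = g := by
  rw [← curry_whiskerRight_ev f, h, curry_whiskerRight_ev]

theorem ihom_map_app_ev {V V' W : C} (f : V' ⟶ V) :
    ((ihom (C := C)).map f.op).app W ▷ V' ≫ ev V' W = hom V W ◁ f ≫ ev V W := by
  apply curry.injective
  rw [curry_whiskerRight_ev, curry_natural_mid, ev, Equiv.apply_symm_apply, Category.id_comp]

theorem ihom_obj_map_ev {V W W' : C} (g : W ⟶ W') :
    ((ihom (C := C)).obj (Opposite.op V)).map g ▷ V ≫ ev V W' = ev V W ≫ g := by
  apply curry.injective
  rw [curry_whiskerRight_ev, curry_natural_right, ev, Equiv.apply_symm_apply, Category.id_comp]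

theorem icomp_ev (V W X : C) : icomp V W X ▷ V ≫ ev V X =
    (α_ (hom W X) (hom V W) V).hom ≫ hom W X ◁ ev V W ≫ ev W X :=
  whiskerRight_curry_ev _

end

end RightMonoidalClosed

namespace BimodHom

open RightMonoidalClosed MonObj

variable {C : Type*} [Category C] [MonoidalCategory C] [RightMonoidalClosed C] {A : Mon C}

/-- The map `A ⟶ hom(W, W)` that corresponds to the left action on `W`. -/
def lhat (W : Bimod A A) : A.X ⟶ hom W.X W.X := curry W.actLeft

/-- The left `A`-action on `hom(V, W)`: compose with the left action on `W`. -/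
def homActLeft (V W : Bimod A A) : A.X ⊗ hom V.X W.X ⟶ hom V.X W.X :=
  lhat W ▷ hom V.X W.X ≫ icomp V.X W.X W.X

/-- The right `A`-action on `hom(V, W)`: precompose with the left action on `V`. -/
def homActRight (V W : Bimod A A) : hom V.X W.X ⊗ A.X ⟶ hom V.X W.X :=
  hom V.X W.X ◁ lhat V ≫ icomp V.X V.X W.X

/-- The map `hom(V, W) ⟶ hom(V ⊗ A, W)`, `L ↦ (v ⊗ a ↦ L (v a))`. -/
def evR (V W : Bimod A A) : hom V.X W.X ⟶ hom (V.X ⊗ A.X) W.X :=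
  curry (hom V.X W.X ◁ V.actRight ≫ ev V.X W.X)

/-- The map `hom(V, W) ⟶ hom(V ⊗ A, W)`, `L ↦ (v ⊗ a ↦ L (v) a)` (up to the associator). -/
def rEv (V W : Bimod A A) : hom V.X W.X ⟶ hom (V.X ⊗ A.X) W.X :=
  curry ((α_ (hom V.X W.X) V.X A.X).inv ≫ ev V.X W.X ▷ A.X ≫ W.actRight)

theorem homActLeft_ev (V W : Bimod A A) : homActLeft V W ▷ V.X ≫ ev V.X W.X =
    (α_ _ _ _).hom ≫ A.X ◁ ev V.X W.X ≫ W.actLeft := by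
  rw [homActLeft, comp_whiskerRight, Category.assoc, icomp_ev, associator_naturality_left_assoc,
    ← whisker_exchange_assoc, lhat, whiskerRight_curry_ev]

theorem homActRight_ev (V W : Bimod A A) : homActRight V W ▷ V.X ≫ ev V.X W.X =
    (α_ _ _ _).hom ≫ hom V.X W.X ◁ V.actLeft ≫ ev V.X W.X := by
  rw [homActRight, comp_whiskerRight, Category.assoc, icomp_ev, associator_naturality_middle_assoc,
    ← whiskerLeft_comp_assoc, lhat, whiskerRight_curry_ev]

theorem comp_evR_eq_rEv_iff {V W : Bimod A A} {Z : C} (g : Z ⟶ hom V.X W.X) :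
    g ≫ evR V W = g ≫ rEv V W ↔
      Z ◁ V.actRight ≫ g ▷ V.X ≫ ev V.X W.X =
        (α_ _ _ _).inv ≫ (g ▷ V.X ≫ ev V.X W.X) ▷ A.X ≫ W.actRight := by
  rw [evR, rEv, ← curry_natural_left, ← curry_natural_left, curry.apply_eq_iff_eq,
    ← whisker_exchange_assoc, associator_inv_naturality_left_assoc, comp_whiskerRight,
    Category.assoc]

section

variable [HasEqualizers C]

/-- The object `hom_A(V, W)` of right `A`-linear internal homomorphisms, as an equalizer. -/
noncomputable def homA (V W : Bimod A A) : C := equalizer (evR V W) (rEv V W)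

/-- The inclusion of `hom_A(V, W)` into `hom(V, W)`. -/
noncomputable def incl (V W : Bimod A A) : homA V W ⟶ hom V.X W.X :=
  equalizer.ι (evR V W) (rEv V W)

/-- The evaluation `hom_A(V, W) ⊗ V ⟶ W`. -/
noncomputable def evA (V W : Bimod A A) : homA V W ⊗ V.X ⟶ W.X := incl V W ▷ V.X ≫ ev V.X W.X

theorem evA_right (V W : Bimod A A) : homA V W ◁ V.actRight ≫ evA V W =
    (α_ _ _ _).inv ≫ evA V W ▷ A.X ≫ W.actRight :=
  (comp_evR_eq_rEv_iff (incl V W)).1 (equalizer.condition _ _)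

/-- A morphism into `hom_A(V, W)` from a morphism into `hom(V, W)`. -/
noncomputable def lift {V W : Bimod A A} {Z : C} (g : Z ⟶ hom V.X W.X)
    (h : Z ◁ V.actRight ≫ g ▷ V.X ≫ ev V.X W.X =
        (α_ _ _ _).inv ≫ (g ▷ V.X ≫ ev V.X W.X) ▷ A.X ≫ W.actRight) : Z ⟶ homA V W :=
  equalizer.lift g ((comp_evR_eq_rEv_iff g).2 h)

theorem lift_incl {V W : Bimod A A} {Z : C} (g : Z ⟶ hom V.X W.X)
    (h : Z ◁ V.actRight ≫ g ▷ V.X ≫ ev V.X W.X =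
        (α_ _ _ _).inv ≫ (g ▷ V.X ≫ ev V.X W.X) ▷ A.X ≫ W.actRight) : lift g h ≫ incl V W = g :=
  equalizer.lift_ι _ _

theorem lift_evA {V W : Bimod A A} {Z : C} (g : Z ⟶ hom V.X W.X)
    (h : Z ◁ V.actRight ≫ g ▷ V.X ≫ ev V.X W.X =
        (α_ _ _ _).inv ≫ (g ▷ V.X ≫ ev V.X W.X) ▷ A.X ≫ W.actRight) :
    lift g h ▷ V.X ≫ evA V W = g ▷ V.X ≫ ev V.X W.X := by
  rw [evA, ← comp_whiskerRight_assoc, lift_incl]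

theorem hom_ext_evA {V W : Bimod A A} {Z : C} {f g : Z ⟶ homA V W}
    (h : f ▷ V.X ≫ evA V W = g ▷ V.X ≫ evA V W) : f = g := by
  apply equalizer.hom_ext
  apply hom_ext_ev
  rw [evA, ← comp_whiskerRight_assoc, ← comp_whiskerRight_assoc] at h
  exact h

theorem actLeft_aux (V W : Bimod A A) :
    (A.X ⊗ homA V W) ◁ V.actRight ≫ (α_ _ _ _).hom ≫ A.X ◁ evA V W ≫ W.actLeft =
    (α_ _ _ _).inv ≫ ((α_ _ _ _).hom ≫ A.X ◁ evA V W ≫ W.actLeft) ▷ A.X ≫ W.actRight := by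
  rw [associator_naturality_right_assoc, ← whiskerLeft_comp_assoc, evA_right]
  simp [W.middle_assoc]

theorem actRight_aux (V W : Bimod A A) :
    (homA V W ⊗ A.X) ◁ V.actRight ≫ (α_ _ _ _).hom ≫ homA V W ◁ V.actLeft ≫ evA V W =
    (α_ _ _ _).inv ≫ ((α_ _ _ _).hom ≫ homA V W ◁ V.actLeft ≫ evA V W) ▷ A.X ≫ W.actRight := by
  have h : A.X ◁ V.actRight ≫ V.actLeft = (α_ _ _ _).inv ≫ V.actLeft ▷ A.X ≫ V.actRight := by
    rw [V.middle_assoc]; simp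
  rw [associator_naturality_right_assoc, ← whiskerLeft_comp_assoc, h, whiskerLeft_comp,
    whiskerLeft_comp, Category.assoc, Category.assoc, evA_right]
  simp

/-- The left `A`-action on `hom_A(V, W)`, restricted from `hom(V, W)`. -/
noncomputable def actLeft (V W : Bimod A A) : A.X ⊗ homA V W ⟶ homA V W :=
  lift (A.X ◁ incl V W ≫ homActLeft V W) (by
    have h : (A.X ◁ incl V W ≫ homActLeft V W) ▷ V.X ≫ ev V.X W.X =
      (α_ _ _ _).hom ≫ A.X ◁ evA V W ≫ W.actLeft := by
      rw [comp_whiskerRight, Category.assoc, homActLeft_ev, evA]; simp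
    rw [h]
    exact actLeft_aux V W)

/-- The right `A`-action on `hom_A(V, W)`, restricted from `hom(V, W)`. -/
noncomputable def actRight (V W : Bimod A A) : homA V W ⊗ A.X ⟶ homA V W :=
  lift (incl V W ▷ A.X ≫ homActRight V W) (by
    have h : (incl V W ▷ A.X ≫ homActRight V W) ▷ V.X ≫ ev V.X W.X =
      (α_ _ _ _).hom ≫ homA V W ◁ V.actLeft ≫ evA V W := by
      rw [comp_whiskerRight, Category.assoc, homActRight_ev, evA,
        associator_naturality_left_assoc, whisker_exchange_assoc]
    rw [h]
    exact actRight_aux V W)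

theorem actLeft_evA (V W : Bimod A A) : actLeft V W ▷ V.X ≫ evA V W =
    (α_ _ _ _).hom ≫ A.X ◁ evA V W ≫ W.actLeft := by
  rw [actLeft, lift_evA, comp_whiskerRight, Category.assoc, homActLeft_ev, evA]; simp

theorem actRight_evA (V W : Bimod A A) : actRight V W ▷ V.X ≫ evA V W =
    (α_ _ _ _).hom ≫ homA V W ◁ V.actLeft ≫ evA V W := by
  rw [actRight, lift_evA, comp_whiskerRight, Category.assoc, homActRight_ev, evA,
        associator_naturality_left_assoc, whisker_exchange_assoc]

/-- The `A`-bimodule `hom_A(V, W)`. -/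
noncomputable def bimod (V W : Bimod A A) : Bimod A A where
  X := homA V W
  actLeft := actLeft V W
  actRight := actRight V W
  one_actLeft := by
    apply hom_ext_evA
    rw [comp_whiskerRight, Category.assoc, actLeft_evA, associator_naturality_left_assoc,
      ← whisker_exchange_assoc, W.one_actLeft]
    simp
  left_assoc := by
    apply hom_ext_evA
    rw [comp_whiskerRight, Category.assoc, actLeft_evA, associator_naturality_left_assoc,
      ← whisker_exchange_assoc, W.left_assoc]
    simp only [comp_whiskerRight, Category.assoc, actLeft_evA, whisker_assoc,
      Iso.inv_hom_id_assoc]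
    simp only [← whiskerLeft_comp_assoc, actLeft_evA]
    simp
  actRight_one := by
    apply hom_ext_evA
    rw [comp_whiskerRight, Category.assoc, actRight_evA, associator_naturality_middle_assoc,
      ← whiskerLeft_comp_assoc, V.one_actLeft]
    simp
  right_assoc := by
    apply hom_ext_evA
    rw [comp_whiskerRight, Category.assoc, actRight_evA, associator_naturality_middle_assoc,
      ← whiskerLeft_comp_assoc, V.left_assoc]
    simp only [comp_whiskerRight, Category.assoc, actRight_evA]
    rw [associator_naturality_left_assoc, ← whisker_exchange_assoc, actRight_evA]
    simp
  middle_assoc := by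
    apply hom_ext_evA
    simp only [comp_whiskerRight, Category.assoc, actRight_evA, actLeft_evA]
    rw [associator_naturality_left_assoc, ← whisker_exchange_assoc, actLeft_evA]
    simp only [whisker_assoc, Category.assoc, Iso.inv_hom_id_assoc]
    rw [← whiskerLeft_comp_assoc, actRight_evA]
    simp

theorem uncurry_balanced {V W X : Bimod A A} (m : V.X ⟶ homA W X)
    (hr : V.actRight ≫ m = m ▷ A.X ≫ actRight W X) :
    V.actRight ▷ W.X ≫ m ▷ W.X ≫ evA W X =
      (α_ V.X A.X W.X).hom ≫ V.X ◁ W.actLeft ≫ m ▷ W.X ≫ evA W X := by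
  rw [← comp_whiskerRight_assoc, hr, comp_whiskerRight_assoc, actRight_evA,
    associator_naturality_left_assoc, ← whisker_exchange_assoc]

/-- The map `L ↦ g ∘ L ∘ f` between internal homs of bimodules. -/
noncomputable def homMap {V V' W W' : Bimod A A} (f : V' ⟶ V) (g : W ⟶ W') :
    homA V W ⟶ homA V' W' :=
  lift (incl V W ≫ ((RightMonoidalClosed.ihom (C := C)).map f.hom.op).app W.X ≫
      ((RightMonoidalClosed.ihom (C := C)).obj (Opposite.op V'.X)).map g.hom) (by
    have h : (incl V W ≫ ((RightMonoidalClosed.ihom (C := C)).map f.hom.op).app W.X ≫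
      ((RightMonoidalClosed.ihom (C := C)).obj (Opposite.op V'.X)).map g.hom) ▷ V'.X ≫ ev V'.X W'.X =
      homA V W ◁ f.hom ≫ evA V W ≫ g.hom := by
      simp only [comp_whiskerRight, Category.assoc]
      rw [ihom_obj_map_ev, reassoc_of% (ihom_map_app_ev (W := W.X) f.hom),
        ← whisker_exchange_assoc, evA, Category.assoc]
    rw [h, ← whiskerLeft_comp_assoc, f.right_act_hom, whiskerLeft_comp_assoc,
      reassoc_of% (evA_right V W), g.right_act_hom]
    simp)

theorem homMap_evA {V V' W W' : Bimod A A} (f : V' ⟶ V) (g : W ⟶ W') :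
    homMap f g ▷ V'.X ≫ evA V' W' = homA V W ◁ f.hom ≫ evA V W ≫ g.hom := by
  rw [homMap, lift_evA]
  simp only [comp_whiskerRight, Category.assoc]
  rw [ihom_obj_map_ev, reassoc_of% (ihom_map_app_ev (W := W.X) f.hom),
        ← whisker_exchange_assoc, evA, Category.assoc]

theorem homMap_id (V W : Bimod A A) : homMap (𝟙 V) (𝟙 W) = 𝟙 _ := by
  apply hom_ext_evA
  rw [homMap_evA]
  simp

theorem homMap_comp {V V' V'' W W' W'' : Bimod A A} (f : V' ⟶ V) (f' : V'' ⟶ V') (g : W ⟶ W')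
    (g' : W' ⟶ W'') : homMap f g ≫ homMap f' g' = homMap (f' ≫ f) (g ≫ g') := by
  apply hom_ext_evA
  rw [homMap_evA, comp_whiskerRight, Category.assoc, homMap_evA, ← whisker_exchange_assoc,
    reassoc_of% (homMap_evA f g)]
  simp

/-- The map `L ↦ g ∘ L ∘ f` as a morphism of bimodules. -/
noncomputable def map {V V' W W' : Bimod A A} (f : V' ⟶ V) (g : W ⟶ W') :
    bimod V W ⟶ bimod V' W' :=
  Bimod.Hom.mk (homMap f g)
    (by
      apply hom_ext_evA
      change (actLeft V W ≫ homMap f g) ▷ _ ≫ _ = (A.X ◁ homMap f g ≫ actLeft V' W') ▷ _ ≫ _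
      simp only [comp_whiskerRight, Category.assoc]
      rw [homMap_evA, actLeft_evA, ← whisker_exchange_assoc, reassoc_of% (actLeft_evA V W)]
      simp only [whisker_assoc, Category.assoc, Iso.inv_hom_id_assoc]
      rw [← whiskerLeft_comp_assoc, homMap_evA]
      simp [g.left_act_hom])
    (by
      apply hom_ext_evA
      change (actRight V W ≫ homMap f g) ▷ _ ≫ _ = (homMap f g ▷ A.X ≫ actRight V' W') ▷ _ ≫ _
      simp only [comp_whiskerRight, Category.assoc]
      rw [homMap_evA, actRight_evA, ← whisker_exchange_assoc, reassoc_of% (actRight_evA V W),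
        associator_naturality_left_assoc, ← whisker_exchange_assoc, homMap_evA,
        ← whiskerLeft_comp_assoc, f.left_act_hom]
      simp)

theorem map_id_id (V W : Bimod A A) : map (𝟙 V) (𝟙 W) = 𝟙 (bimod V W) :=
  Bimod.hom_ext _ _ (homMap_id V W)

theorem map_comp_map {V V' V'' W W' W'' : Bimod A A} (f : V' ⟶ V) (f' : V'' ⟶ V') (g : W ⟶ W')
    (g' : W' ⟶ W'') : map f g ≫ map f' g' = map (f' ≫ f) (g ≫ g') :=
  Bimod.hom_ext _ _ (homMap_comp f f' g g')

/-- The internal hom functor of bimodules. -/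
noncomputable def functor (A : Mon C) : (Bimod A A)ᵒᵖ ⥤ Bimod A A ⥤ Bimod A A where
  obj V :=
    { obj := fun W => bimod V.unop W
      map := fun g => map (𝟙 _) g
      map_id := fun W => map_id_id _ _
      map_comp := fun f g => by rw [map_comp_map, Category.id_comp] }
  map f :=
    { app := fun W => map f.unop (𝟙 W)
      naturality := fun W W' g => by simp [map_comp_map] }
  map_id V := by
    ext W : 2
    exact map_id_id _ _
  map_comp f g := by
    ext W : 2
    simp [map_comp_map]

end

end BimodHom

section BimodMonoidal

variable {C : Type*} [Category C] [MonoidalCategory C] [HasCoequalizers C]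
  [∀ X : C, PreservesColimitsOfSize.{0, 0} (tensorLeft X)]
  [∀ X : C, PreservesColimitsOfSize.{0, 0} (tensorRight X)]

/-- The monoidal category of `A`-bimodules, with the tensor product over `A`. -/
noncomputable instance bimodMonoidal (A : Mon C) : MonoidalCategory (Bimod A A) where
  tensorObj V W := Bimod.tensorBimod V W
  tensorHom {_ V' W _} f g := Bimod.whiskerRight f W ≫ Bimod.whiskerLeft V' g
  whiskerLeft V _ _ g := Bimod.whiskerLeft V g
  whiskerRight f W := Bimod.whiskerRight f W
  tensorUnit := Bimod.regular A
  associator U V W := Bimod.associatorBimod U V W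
  leftUnitor V := Bimod.leftUnitorBimod V
  rightUnitor V := Bimod.rightUnitorBimod V
  tensorHom_def _ _ := rfl
  id_tensorHom_id V W := by
    rw [Bimod.id_whiskerRight_bimod, Bimod.whiskerLeft_id_bimod, Category.id_comp]
  tensorHom_comp_tensorHom f g f' g' := by
    rw [Bimod.comp_whiskerRight_bimod, Bimod.whiskerLeft_comp_bimod, Category.assoc,
      Category.assoc, ← reassoc_of% (Bimod.whisker_exchange_bimod f' g)]
  whiskerLeft_id _ _ := Bimod.whiskerLeft_id_bimod
  id_whiskerRight _ _ := Bimod.id_whiskerRight_bimod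
  associator_naturality {X₁ X₂ X₃ Y₁ Y₂ Y₃} f g h := by
    rw [Bimod.comp_whiskerRight_bimod, Bimod.whiskerLeft_comp_bimod,
      Bimod.whiskerRight_comp_bimod, Bimod.comp_whiskerLeft_bimod, Bimod.whisker_assoc_bimod]
    simp
  leftUnitor_naturality f := by
    rw [Bimod.id_whiskerLeft_bimod]; simp
  rightUnitor_naturality f := by
    rw [Bimod.whiskerRight_id_bimod]; simp
  pentagon := Bimod.pentagon_bimod
  triangle := Bimod.triangle_bimod

/-- The projection `V ⊗ W ⟶ V ⊗_A W`. -/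
noncomputable def bimodProj {A : Mon C} (V W : Bimod A A) :
    V.X ⊗ W.X ⟶ (V ⊗ W : Bimod A A).X :=
  coequalizer.π (V.actRight ▷ W.X) ((α_ V.X A.X W.X).hom ≫ V.X ◁ W.actLeft)

theorem bimodProj_condition {A : Mon C} (V W : Bimod A A) :
    V.actRight ▷ W.X ≫ bimodProj V W =
      (α_ V.X A.X W.X).hom ≫ V.X ◁ W.actLeft ≫ bimodProj V W := by
  have := coequalizer.condition (V.actRight ▷ W.X) ((α_ V.X A.X W.X).hom ≫ V.X ◁ W.actLeft)
  rwa [Category.assoc] at this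

theorem bimodProj_actLeft {A : Mon C} (V W : Bimod A A) :
    A.X ◁ bimodProj V W ≫ (V ⊗ W : Bimod A A).actLeft =
      (α_ _ _ _).inv ≫ V.actLeft ▷ W.X ≫ bimodProj V W :=
  Bimod.TensorBimod.whiskerLeft_π_actLeft V W

theorem bimodProj_actRight {A : Mon C} (V W : Bimod A A) :
    bimodProj V W ▷ A.X ≫ (V ⊗ W : Bimod A A).actRight =
      (α_ _ _ _).hom ≫ V.X ◁ W.actRight ≫ bimodProj V W :=
  Bimod.TensorBimod.π_tensor_id_actRight V W

theorem bimodProj_whiskerLeft {A : Mon C} (V : Bimod A A) {W W' : Bimod A A} (f : W ⟶ W') :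
    bimodProj V W ≫ (V ◁ f).hom = V.X ◁ f.hom ≫ bimodProj V W' :=
  ι_colimMap _ _

theorem bimodProj_whiskerRight {A : Mon C} {V V' : Bimod A A} (f : V ⟶ V') (W : Bimod A A) :
    bimodProj V W ≫ (f ▷ W).hom = f.hom ▷ W.X ≫ bimodProj V' W :=
  ι_colimMap _ _

instance {A : Mon C} (V W : Bimod A A) : Epi (bimodProj V W) :=
  inferInstanceAs (Epi (coequalizer.π _ _))

instance {A : Mon C} (V W : Bimod A A) (X : C) : Epi (X ◁ bimodProj V W) :=
  inferInstanceAs (Epi ((tensorLeft X).map (coequalizer.π _ _)))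

instance {A : Mon C} (V W : Bimod A A) (X : C) : Epi (bimodProj V W ▷ X) :=
  inferInstanceAs (Epi ((tensorRight X).map (coequalizer.π _ _)))

/-- The morphism out of `V ⊗_A W` induced by a balanced morphism out of `V ⊗ W`. -/
noncomputable def bimodDesc {A : Mon C} {V W : Bimod A A} {Z : C} (u : V.X ⊗ W.X ⟶ Z)
    (h : V.actRight ▷ W.X ≫ u = (α_ V.X A.X W.X).hom ≫ V.X ◁ W.actLeft ≫ u) :
    (V ⊗ W : Bimod A A).X ⟶ Z :=
  coequalizer.desc u (by rw [h, Category.assoc])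

theorem bimodProj_desc {A : Mon C} {V W : Bimod A A} {Z : C} (u : V.X ⊗ W.X ⟶ Z)
    (h : V.actRight ▷ W.X ≫ u = (α_ V.X A.X W.X).hom ≫ V.X ◁ W.actLeft ≫ u) :
    bimodProj V W ≫ bimodDesc u h = u :=
  coequalizer.π_desc _ _

namespace BimodHom

open RightMonoidalClosed

variable [RightMonoidalClosed C] [HasEqualizers C] {A : Mon C} {V W X : Bimod A A}

/-- Currying for bimodules. -/
noncomputable def curryMap (f : V ⊗ W ⟶ X) : V.X ⟶ homA W X :=
  lift (curry (bimodProj V W ≫ f.hom)) (by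
    rw [whiskerRight_curry_ev, comp_whiskerRight, Category.assoc, ← f.right_act_hom,
      reassoc_of% (bimodProj_actRight V W)]
    simp)

theorem curryMap_evA (f : V ⊗ W ⟶ X) : curryMap f ▷ W.X ≫ evA W X = bimodProj V W ≫ f.hom := by
  rw [curryMap, lift_evA, whiskerRight_curry_ev]

/-- Currying for bimodules, as a morphism of bimodules. -/
noncomputable def curryHom (f : V ⊗ W ⟶ X) : V ⟶ bimod W X :=
  Bimod.Hom.mk (curryMap f)
    (by
      apply hom_ext_evA
      change (V.actLeft ≫ curryMap f) ▷ _ ≫ _ = (A.X ◁ curryMap f ≫ actLeft W X) ▷ _ ≫ _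
      simp only [comp_whiskerRight, Category.assoc]
      rw [curryMap_evA, actLeft_evA]
      simp only [whisker_assoc, Category.assoc, Iso.inv_hom_id_assoc]
      rw [← whiskerLeft_comp_assoc, curryMap_evA, whiskerLeft_comp_assoc, ← f.left_act_hom,
        reassoc_of% (bimodProj_actLeft V W)]
      simp)
    (by
      apply hom_ext_evA
      change (V.actRight ≫ curryMap f) ▷ _ ≫ _ = (curryMap f ▷ A.X ≫ actRight W X) ▷ _ ≫ _
      simp only [comp_whiskerRight, Category.assoc]
      rw [curryMap_evA, actRight_evA, associator_naturality_left_assoc, ← whisker_exchange_assoc,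
        curryMap_evA, reassoc_of% (bimodProj_condition V W)])

/-- The bimodule morphism `V ⊗_A W ⟶ X` that corresponds to `m : V ⟶ hom_A(W, X)`. -/
noncomputable def uncurryMap (m : V.X ⟶ homA W X)
    (hl : V.actLeft ≫ m = A.X ◁ m ≫ actLeft W X)
    (hr : V.actRight ≫ m = m ▷ A.X ≫ actRight W X) : V ⊗ W ⟶ X :=
  Bimod.Hom.mk (bimodDesc (m ▷ W.X ≫ evA W X) (uncurry_balanced m hr))
    (by
      rw [← cancel_epi (A.X ◁ bimodProj V W), reassoc_of% (bimodProj_actLeft V W), bimodProj_desc,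
        ← whiskerLeft_comp_assoc, bimodProj_desc, ← comp_whiskerRight_assoc, hl,
        comp_whiskerRight_assoc, actLeft_evA]
      simp)
    (by
      rw [← cancel_epi (bimodProj V W ▷ A.X), reassoc_of% (bimodProj_actRight V W), bimodProj_desc,
        ← comp_whiskerRight_assoc, bimodProj_desc, whisker_exchange_assoc, evA_right]
      simp)

/-- The inverse of currying for bimodules. -/
noncomputable def uncurryHom (g : V ⟶ bimod W X) : V ⊗ W ⟶ X :=
  uncurryMap g.hom g.left_act_hom g.right_act_hom

theorem bimodProj_uncurryHom (g : V ⟶ bimod W X) :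
    bimodProj V W ≫ (uncurryHom g).hom = (show V.X ⟶ homA W X from g.hom) ▷ W.X ≫ evA W X :=
  bimodProj_desc _ (uncurry_balanced (W := W) (X := X) g.hom g.right_act_hom)

theorem uncurryHom_curryHom (f : V ⊗ W ⟶ X) : uncurryHom (curryHom f) = f := by
  apply Bimod.hom_ext
  rw [← cancel_epi (bimodProj V W), bimodProj_uncurryHom]
  exact curryMap_evA f

theorem curryHom_uncurryHom (g : V ⟶ bimod W X) : curryHom (uncurryHom g) = g := by
  apply Bimod.hom_ext
  apply hom_ext_evA
  refine (curryMap_evA _).trans ?_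
  rw [bimodProj_uncurryHom]

noncomputable instance rightMonoidalClosed (A : Mon C) : RightMonoidalClosed (Bimod A A) where
  ihom := functor A
  curry {V W X} :=
    { toFun := fun f => (curryHom f : V ⟶ bimod W X)
      invFun := fun g => uncurryHom g
      left_inv := uncurryHom_curryHom
      right_inv := curryHom_uncurryHom }
  curry_natural_left {V V' W X} f g := by
    apply Bimod.hom_ext
    apply hom_ext_evA
    refine (curryMap_evA _).trans ?_
    change _ = (f.hom ≫ curryMap g) ▷ _ ≫ _
    rw [comp_whiskerRight_assoc, curryMap_evA]
    change _ ≫ _ ≫ _ = _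
    rw [reassoc_of% (bimodProj_whiskerRight f W)]
  curry_natural_mid {V W W' X} f g := by
    apply Bimod.hom_ext
    apply hom_ext_evA
    refine (curryMap_evA _).trans ?_
    change _ = (curryMap g ≫ homMap f (𝟙 X)) ▷ _ ≫ _
    rw [comp_whiskerRight_assoc, homMap_evA, ← whisker_exchange_assoc,
      reassoc_of% (curryMap_evA g)]
    change _ ≫ _ ≫ _ = _
    rw [reassoc_of% (bimodProj_whiskerLeft V f)]
    simp
  curry_natural_right {V W X X'} g h := by
    apply Bimod.hom_ext
    apply hom_ext_evA
    refine (curryMap_evA _).trans ?_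
    change _ = (curryMap g ≫ homMap (𝟙 W) h) ▷ _ ≫ _
    rw [comp_whiskerRight_assoc, homMap_evA, ← whisker_exchange_assoc,
      reassoc_of% (curryMap_evA g)]
    simp

end BimodHom

end BimodMonoidal

namespace CochainTwist

open QHMod

variable {k : Type u} {H : Type v} [CommRing k] [Ring H] [Algebra k H]
  {Q : QuasiHopfAlgebra k H} (T : CochainTwist Q)

theorem twist_comul : T.twist.comul = T.comul := rfl

theorem twist_counit : T.twist.counit = Q.counit := rfl

theorem twist_assoc : T.twist.assoc = T.assoc := rfl

theorem twist_antipode : T.twist.antipode = Q.antipode := rfl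

theorem twist_α : T.twist.α = T.α := rfl

theorem twist_β : T.twist.β = T.β := rfl

section Functor

attribute [local irreducible] CochainTwist.twist

/-- An `H`-module regarded as an `H_F`-module (with the same action, as `H_F = H` as algebras). -/
abbrev obj (V : QHMod Q) : QHMod T.twist where
  carrier := V.carrier
  act := V.act

/-- The functor from `H`-modules to `H_F`-modules that is the identity on the underlying modules. -/
noncomputable def functor : QHMod Q ⥤ QHMod T.twist where
  obj V := T.obj V
  map {V W} f := ofLin (V := T.obj V) (W := T.obj W) (lin (V := V) (W := W) f) (lin_comm f)

theorem lin_functor_map {V W : QHMod Q} (f : V ⟶ W) : lin (T.functor.map f) = lin f := rfl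

/-- The action of `F⁻¹` on `V ⊗ W`. -/
noncomputable def inverseAct (V W : QHMod Q) :
    V.carrier ⊗[k] W.carrier ≃ₗ[k] V.carrier ⊗[k] W.carrier :=
  unitAct (tensorAct V.act W.act) T.F⁻¹

theorem inverseAct_toLinearMap (V W : QHMod Q) : (T.inverseAct V W).toLinearMap =
    tensorAct V.act W.act ((T.F⁻¹ : (H ⊗[k] H)ˣ) : H ⊗[k] H) := rfl

theorem inverseAct_comm (V W : QHMod Q) (h : H) :
    (T.inverseAct V W).toLinearMap ∘ₗ tensorAct V.act W.act (T.twist.comul h) =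
      tensorAct V.act W.act (Q.comul h) ∘ₗ (T.inverseAct V W).toLinearMap := by
  rw [twist_comul, inverseAct_toLinearMap, ← Module.End.mul_eq_comp, ← Module.End.mul_eq_comp, ← map_mul,
    ← map_mul, comul, conjHom_apply, ← mul_assoc, ← mul_assoc, Units.inv_mul, one_mul]

/-- The coherence map `φ_{V,W} : F(V) ⊗_F F(W) ⟶ F(V ⊗ W)`,
`v ⊗ w ↦ F⁽⁻¹⁾ • v ⊗ F⁽⁻²⁾ • w`. -/
noncomputable def tensorIso (V W : QHMod Q) :
    T.functor.obj V ⊗ T.functor.obj W ≅ T.functor.obj (V ⊗ W) :=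
  isoOfLin (T.inverseAct V W) (T.inverseAct_comm V W)

/-- The coherence map `ψ : k ⟶ F(k)`, the identity. -/
noncomputable def unitIso : 𝟙_ (QHMod T.twist) ≅ T.functor.obj (𝟙_ (QHMod Q)) :=
  isoOfLin (V := unit T.twist) (W := T.obj (unit Q)) (LinearEquiv.refl k k)
    (fun h => by simp only [twist_counit]; rfl)

theorem lin_unitIso_hom : lin T.unitIso.hom = (LinearMap.id : k →ₗ[k] k) := rfl

theorem lin_tensorIso_hom (V W : QHMod Q) : lin (T.tensorIso V W).hom =
    tensorAct V.act W.act ((T.F⁻¹ : (H ⊗[k] H)ˣ) : H ⊗[k] H) := rfl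

theorem assoc_elem : (Q.assoc : H ⊗[k] (H ⊗[k] H)) *
      comulFst Q.comul H ((T.F⁻¹ : (H ⊗[k] H)ˣ) : H ⊗[k] H) *
        tmulOne H H ((T.F⁻¹ : (H ⊗[k] H)ˣ) : H ⊗[k] H) =
    mapSnd H Q.comul ((T.F⁻¹ : (H ⊗[k] H)ˣ) : H ⊗[k] H) *
      oneTmul H (H ⊗[k] H) ((T.F⁻¹ : (H ⊗[k] H)ˣ) : H ⊗[k] H) * (T.assoc : H ⊗[k] (H ⊗[k] H)) := by
  have cc : ∀ (f : H ⊗[k] H →ₐ[k] H ⊗[k] (H ⊗[k] H)) (X : H ⊗[k] (H ⊗[k] H)),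
      f ((T.F⁻¹ : (H ⊗[k] H)ˣ) : H ⊗[k] H) * (f T.F * X) = X := by
    intro f X; rw [← mul_assoc, ← map_mul]; simp
  simp only [assoc, Units.val_mul, unitMap_val, unitMap_inv_val, mul_assoc, cc]

theorem tensorIso_associativity (V W X : QHMod Q) :
    tensorAct V.act (tensorAct W.act X.act) (Q.assoc : H ⊗[k] (H ⊗[k] H)) ∘ₗ
      (TensorProduct.assoc k V.carrier W.carrier X.carrier).toLinearMap ∘ₗ
      tensorAct ((tensorAct V.act W.act).comp Q.comul) X.act
        ((T.F⁻¹ : (H ⊗[k] H)ˣ) : H ⊗[k] H) ∘ₗ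
      LinearMap.rTensor X.carrier
        (tensorAct V.act W.act ((T.F⁻¹ : (H ⊗[k] H)ˣ) : H ⊗[k] H)) =
    tensorAct V.act ((tensorAct W.act X.act).comp Q.comul)
        ((T.F⁻¹ : (H ⊗[k] H)ˣ) : H ⊗[k] H) ∘ₗ
      LinearMap.lTensor V.carrier
        (tensorAct W.act X.act ((T.F⁻¹ : (H ⊗[k] H)ˣ) : H ⊗[k] H)) ∘ₗ
      tensorAct V.act (tensorAct W.act X.act) (T.assoc : H ⊗[k] (H ⊗[k] H)) ∘ₗ
      (TensorProduct.assoc k V.carrier W.carrier X.carrier).toLinearMap := by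
  rw [← LinearMap.comp_assoc (LinearMap.rTensor _ _), assoc_comp_act, LinearMap.comp_assoc,
    rTensor_tensorAct (tensorAct V.act W.act) X.act, assoc_comp_tensorAct,
    Algebra.TensorProduct.includeLeft_apply, assoc_tmul_one, tensorAct_comp_right,
    lTensor_tensorAct V.act (tensorAct W.act X.act)]
  simp only [← LinearMap.comp_assoc]
  congr 1
  simp only [← Module.End.mul_eq_comp, ← map_mul]
  rw [T.assoc_elem]

theorem lin_associator_twist (V W X : QHMod Q) :
    lin (α_ (T.functor.obj V) (T.functor.obj W) (T.functor.obj X)).hom =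
    tensorAct V.act (tensorAct W.act X.act) (T.twist.assoc : H ⊗[k] (H ⊗[k] H)) ∘ₗ
      (TensorProduct.assoc k V.carrier W.carrier X.carrier).toLinearMap := by
  exact lin_associator_hom (T.obj V) (T.obj W) (T.obj X)

theorem tensorIso_associativity' (V W X : QHMod Q) :
    ((tensorAct V.act (tensorAct W.act X.act) (Q.assoc : H ⊗[k] (H ⊗[k] H)) ∘ₗ
      (TensorProduct.assoc k V.carrier W.carrier X.carrier).toLinearMap) ∘ₗ
      tensorAct ((tensorAct V.act W.act).comp Q.comul) X.act
        ((T.F⁻¹ : (H ⊗[k] H)ˣ) : H ⊗[k] H)) ∘ₗ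
      LinearMap.rTensor X.carrier
        (tensorAct V.act W.act ((T.F⁻¹ : (H ⊗[k] H)ˣ) : H ⊗[k] H)) =
    (tensorAct V.act ((tensorAct W.act X.act).comp Q.comul)
        ((T.F⁻¹ : (H ⊗[k] H)ˣ) : H ⊗[k] H) ∘ₗ
      LinearMap.lTensor V.carrier
        (tensorAct W.act X.act ((T.F⁻¹ : (H ⊗[k] H)ˣ) : H ⊗[k] H))) ∘ₗ
      tensorAct V.act (tensorAct W.act X.act) (T.twist.assoc : H ⊗[k] (H ⊗[k] H)) ∘ₗ
      (TensorProduct.assoc k V.carrier W.carrier X.carrier).toLinearMap := by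
  rw [T.twist_assoc]
  have h := T.tensorIso_associativity V W X
  simp only [LinearMap.comp_assoc] at h ⊢
  exact h

theorem lin_tensorIso_whiskerRight (V W X : QHMod Q) :
    lin ((T.tensorIso V W).hom ▷ T.functor.obj X) = LinearMap.rTensor X.carrier
        (tensorAct V.act W.act ((T.F⁻¹ : (H ⊗[k] H)ˣ) : H ⊗[k] H)) := by
  exact lin_whiskerRight _ _

theorem lin_whiskerLeft_tensorIso (V W X : QHMod Q) :
    lin (T.functor.obj V ◁ (T.tensorIso W X).hom) = LinearMap.lTensor V.carrier
        (tensorAct W.act X.act ((T.F⁻¹ : (H ⊗[k] H)ˣ) : H ⊗[k] H)) := by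
  exact lin_whiskerLeft _ _

theorem lin_tensorIso_left (V W X : QHMod Q) : lin (T.tensorIso (V ⊗ W) X).hom =
      tensorAct ((tensorAct V.act W.act).comp Q.comul) X.act
        ((T.F⁻¹ : (H ⊗[k] H)ˣ) : H ⊗[k] H) := by
  exact lin_tensorIso_hom _ _ _

theorem lin_tensorIso_right (V W X : QHMod Q) : lin (T.tensorIso V (W ⊗ X)).hom =
      tensorAct V.act ((tensorAct W.act X.act).comp Q.comul)
        ((T.F⁻¹ : (H ⊗[k] H)ˣ) : H ⊗[k] H) := by
  exact lin_tensorIso_hom _ _ _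

theorem lin_functor_associator (V W X : QHMod Q) : lin (T.functor.map (α_ V W X).hom) =
    tensorAct V.act (tensorAct W.act X.act) (Q.assoc : H ⊗[k] (H ⊗[k] H)) ∘ₗ
      (TensorProduct.assoc k V.carrier W.carrier X.carrier).toLinearMap := by
  exact lin_associator_hom _ _ _

theorem tensorIso_assoc (V W X : QHMod Q) :
    (T.tensorIso V W).hom ▷ T.functor.obj X ≫ (T.tensorIso (V ⊗ W) X).hom ≫
        T.functor.map (α_ V W X).hom =
      (α_ (T.functor.obj V) (T.functor.obj W) (T.functor.obj X)).hom ≫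
        T.functor.obj V ◁ (T.tensorIso W X).hom ≫ (T.tensorIso V (W ⊗ X)).hom := by
  apply hom_ext
  rw [lin_comp, lin_comp, lin_comp, lin_comp]
  refine Eq.trans ?_ ((T.tensorIso_associativity' V W X).trans ?_)
  · exact congrArg₂ LinearMap.comp
      (congrArg₂ LinearMap.comp (T.lin_functor_associator V W X) (T.lin_tensorIso_left V W X))
      (T.lin_tensorIso_whiskerRight V W X)
  · exact (congrArg₂ LinearMap.comp
      (congrArg₂ LinearMap.comp (T.lin_tensorIso_right V W X) (T.lin_whiskerLeft_tensorIso V W X))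
      (T.lin_associator_twist V W X)).symm

noncomputable instance : T.functor.Monoidal :=
  Functor.CoreMonoidal.toMonoidal
    { εIso := T.unitIso
      μIso := T.tensorIso
      μIso_hom_natural_left := fun {V V'} f W => hom_ext
        (map_comp_tensorAct V.act W.act V'.act W.act (lin f) LinearMap.id (lin_comm f)
          (fun _ => rfl) _).symm
      μIso_hom_natural_right := fun {V V'} W f => hom_ext
        (map_comp_tensorAct W.act V.act W.act V'.act LinearMap.id (lin f) (fun _ => rfl)
          (lin_comm f) _).symm
      associativity := fun V W X => T.tensorIso_assoc V W X
      left_unitality := fun V => hom_ext (by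
        have h := lid_comp_tensorAct V.act Q.counit ((T.F⁻¹ : (H ⊗[k] H)ˣ) : H ⊗[k] H)
        rw [T.counitFst_inv, map_one] at h
        change (TensorProduct.lid k V.carrier).toLinearMap =
          ((TensorProduct.lid k V.carrier).toLinearMap ∘ₗ
            tensorAct (counitAct Q.counit) V.act _) ∘ₗ LinearMap.rTensor V.carrier LinearMap.id
        rw [h, LinearMap.rTensor_id]
        rfl)
      right_unitality := fun V => hom_ext (by
        have h := rid_comp_tensorAct V.act Q.counit ((T.F⁻¹ : (H ⊗[k] H)ˣ) : H ⊗[k] H)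
        rw [T.counitSnd_inv, map_one] at h
        change (TensorProduct.rid k V.carrier).toLinearMap =
          ((TensorProduct.rid k V.carrier).toLinearMap ∘ₗ
            tensorAct V.act (counitAct Q.counit) _) ∘ₗ LinearMap.lTensor V.carrier LinearMap.id
        rw [h, LinearMap.lTensor_id]
        rfl) }

theorem lin_μ (V W : QHMod Q) : lin (Functor.LaxMonoidal.μ T.functor V W) =
    tensorAct V.act W.act ((T.F⁻¹ : (H ⊗[k] H)ˣ) : H ⊗[k] H) := rfl

theorem lin_ε : lin (Functor.LaxMonoidal.ε T.functor) = (LinearMap.id : k →ₗ[k] k) := rfl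

/-- The deformation `A_F` of an algebra `A`: the same `H`-module and unit, with the star product
as multiplication. -/
noncomputable abbrev algebra (A : Mon (QHMod Q)) : Mon (QHMod T.twist) := T.functor.mapMon.obj A

/-- The multiplication of `A_F` is `a ⊗ a' ↦ (F⁽⁻¹⁾ • a) (F⁽⁻²⁾ • a')`. -/
theorem lin_algebra_mul (A : Mon (QHMod Q)) :
    lin (MonObj.mul (X := (T.algebra A).X)) =
      (show A.X.carrier ⊗[k] A.X.carrier →ₗ[k] A.X.carrier from lin (MonObj.mul (X := A.X))) ∘ₗ
        tensorAct A.X.act A.X.act ((T.F⁻¹ : (H ⊗[k] H)ˣ) : H ⊗[k] H) := rfl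

/-- The unit of `A_F` is the unit of `A`. -/
theorem lin_algebra_one (A : Mon (QHMod Q)) : lin (MonObj.one (X := (T.algebra A).X)) =
    lin (V := unit Q) (W := A.X) (MonObj.one (X := A.X)) := rfl

end Functor

end CochainTwist

section BimodFunctor

open Functor

variable {C D : Type*} [Category C] [MonoidalCategory C] [Category D] [MonoidalCategory D]

namespace BimodFunctor

variable (F : C ⥤ D) [F.LaxMonoidal] {A : Mon C} (V : Bimod A A)

/-- The left action on `F(V)`. -/
def actLeft : F.obj A.X ⊗ F.obj V.X ⟶ F.obj V.X :=
  LaxMonoidal.μ F A.X V.X ≫ F.map V.actLeft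

/-- The right action on `F(V)`. -/
def actRight : F.obj V.X ⊗ F.obj A.X ⟶ F.obj V.X :=
  LaxMonoidal.μ F V.X A.X ≫ F.map V.actRight

theorem one_actLeft : (LaxMonoidal.ε F ≫ F.map (MonObj.one (X := A.X))) ▷ F.obj V.X ≫
    actLeft F V = (λ_ (F.obj V.X)).hom := by
  rw [actLeft, comp_whiskerRight, Category.assoc, LaxMonoidal.μ_natural_left_assoc, ← F.map_comp,
    V.one_actLeft, LaxMonoidal.left_unitality]

theorem actRight_one : F.obj V.X ◁ (LaxMonoidal.ε F ≫ F.map (MonObj.one (X := A.X))) ≫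
    actRight F V = (ρ_ (F.obj V.X)).hom := by
  rw [actRight, MonoidalCategory.whiskerLeft_comp, Category.assoc, LaxMonoidal.μ_natural_right_assoc, ← F.map_comp,
    V.actRight_one, LaxMonoidal.right_unitality]

theorem left_assoc :
    (LaxMonoidal.μ F A.X A.X ≫ F.map (MonObj.mul (X := A.X))) ▷ F.obj V.X ≫ actLeft F V =
      (α_ (F.obj A.X) (F.obj A.X) (F.obj V.X)).hom ≫ F.obj A.X ◁ actLeft F V ≫ actLeft F V := by
  rw [actLeft, comp_whiskerRight, Category.assoc, LaxMonoidal.μ_natural_left_assoc, ← F.map_comp,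
    V.left_assoc]
  simp

theorem right_assoc :
    F.obj V.X ◁ (LaxMonoidal.μ F A.X A.X ≫ F.map (MonObj.mul (X := A.X))) ≫ actRight F V =
      (α_ (F.obj V.X) (F.obj A.X) (F.obj A.X)).inv ≫ actRight F V ▷ F.obj A.X ≫ actRight F V := by
  rw [actRight, MonoidalCategory.whiskerLeft_comp, Category.assoc, LaxMonoidal.μ_natural_right_assoc, ← F.map_comp,
    V.right_assoc]
  simp

theorem middle_assoc : actLeft F V ▷ F.obj A.X ≫ actRight F V =
    (α_ (F.obj A.X) (F.obj V.X) (F.obj A.X)).hom ≫ F.obj A.X ◁ actRight F V ≫ actLeft F V := by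
  rw [actLeft, actRight, comp_whiskerRight, Category.assoc, LaxMonoidal.μ_natural_left_assoc,
    ← F.map_comp, V.middle_assoc]
  simp

variable {V}

theorem map_left {W : Bimod A A} (f : V ⟶ W) :
    actLeft F V ≫ F.map f.hom = F.obj A.X ◁ F.map f.hom ≫ actLeft F W := by
  rw [actLeft, actLeft, Category.assoc, ← F.map_comp, f.left_act_hom, F.map_comp,
    LaxMonoidal.μ_natural_right_assoc]

theorem map_right {W : Bimod A A} (f : V ⟶ W) :
    actRight F V ≫ F.map f.hom = F.map f.hom ▷ F.obj A.X ≫ actRight F W := by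
  rw [actRight, actRight, Category.assoc, ← F.map_comp, f.right_act_hom, F.map_comp,
    LaxMonoidal.μ_natural_left_assoc]

end BimodFunctor

/-- The functor induced by a lax monoidal functor `F` on bimodules: the `F(A)`-actions on `F(V)` are
the images under `F` of the `A`-actions on `V`, precomposed with the tensorator of `F`. -/
def bimodFunctor (F : C ⥤ D) [F.LaxMonoidal] (A : Mon C) :
    Bimod A A ⥤ Bimod (F.mapMon.obj A) (F.mapMon.obj A) where
  obj V :=
    { X := F.obj V.X
      actLeft := BimodFunctor.actLeft F V
      actRight := BimodFunctor.actRight F V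
      one_actLeft := BimodFunctor.one_actLeft F V
      left_assoc := BimodFunctor.left_assoc F V
      actRight_one := BimodFunctor.actRight_one F V
      right_assoc := BimodFunctor.right_assoc F V
      middle_assoc := BimodFunctor.middle_assoc F V }
  map f :=
    { hom := F.map f.hom
      left_act_hom := BimodFunctor.map_left F f
      right_act_hom := BimodFunctor.map_right F f }
  map_id V := Bimod.hom_ext _ _ (F.map_id V.X)
  map_comp f g := Bimod.hom_ext _ _ (F.map_comp f.hom g.hom)

end BimodFunctor

namespace QHMod

variable {k : Type u} {H : Type v} [CommRing k] [Ring H] [Algebra k H]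
  {Q : QuasiHopfAlgebra k H} {A : Mon (QHMod Q)}

/-- The projection `V ⊗ W → V ⊗_A W` onto the tensor product over `A`, as a linear map; the image of
`v ⊗ w` is the class `v ⊗_A w`. -/
noncomputable def projA (V W : Bimod A A) :
    V.X.carrier ⊗[k] W.X.carrier →ₗ[k] (V ⊗ W : Bimod A A).X.carrier :=
  lin (bimodProj V W)

/-- The inclusion of `hom_A(V, W)` into the `k`-linear maps `V → W`. -/
noncomputable def inclA (V W : Bimod A A) :
    (RightMonoidalClosed.hom V W).X.carrier →ₗ[k] (V.X.carrier →ₗ[k] W.X.carrier) :=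
  lin (BimodHom.incl V W)

end QHMod

/-- The structure on a functor `G` that makes it an equivalence of (right) closed monoidal
categories: `G` is an equivalence of categories, it is (strong) monoidal, and there are natural
isomorphisms `γ : hom(G V, G W) ≅ G (hom(V, W))` that are compatible with the evaluations. -/
structure ClosedMonoidalEquivalence {C D : Type*} [Category C] [MonoidalCategory C]
    [RightMonoidalClosed C] [Category D] [MonoidalCategory D] [RightMonoidalClosed D]
    (G : C ⥤ D) where
  isEquivalence : G.IsEquivalence
  /-- the coherence maps `ε : 1 ⟶ G 1` and `μ : G V ⊗ G W ⟶ G (V ⊗ W)` -/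
  monoidal : G.Monoidal
  /-- the coherence map `γ` -/
  γ : G.op ⋙ RightMonoidalClosed.ihom ⋙ (Functor.whiskeringLeft C D D).obj G ≅
    RightMonoidalClosed.ihom ⋙ (Functor.whiskeringRight C C D).obj G
  γ_ev (V W : C) : ((γ.hom.app (Opposite.op V)).app W) ▷ G.obj V ≫
      Functor.LaxMonoidal.μ G (RightMonoidalClosed.hom V W) V ≫
        G.map (RightMonoidalClosed.ev V W) =
    RightMonoidalClosed.ev (G.obj V) (G.obj W)

namespace ClosedMonoidalEquivalence

variable {C D : Type*} [Category C] [MonoidalCategory C] [RightMonoidalClosed C] [Category D]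
  [MonoidalCategory D] [RightMonoidalClosed D] {G : C ⥤ D} (E : ClosedMonoidalEquivalence G)

/-- The coherence map `G V ⊗ G W ⟶ G (V ⊗ W)`. -/
def tensorMap (V W : C) : G.obj V ⊗ G.obj W ⟶ G.obj (V ⊗ W) :=
  letI := E.monoidal; Functor.LaxMonoidal.μ G V W

/-- The coherence map `1 ⟶ G 1`. -/
def unitMap : 𝟙_ D ⟶ G.obj (𝟙_ C) :=
  letI := E.monoidal; Functor.LaxMonoidal.ε G

/-- The coherence map `hom(G V, G W) ⟶ G (hom(V, W))`. -/
def homMap (V W : C) : RightMonoidalClosed.hom (G.obj V) (G.obj W) ⟶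
    G.obj (RightMonoidalClosed.hom V W) :=
  (E.γ.hom.app (Opposite.op V)).app W

end ClosedMonoidalEquivalence

/-! The twist enters only at the level of $H$-modules; the passage to bimodules is formal. As
algebras $H_F = H$, so `T.functor` changes neither modules nor morphisms and is an equivalence. With
tensorator the action of $F^{-1}$ and identity unit it is strong monoidal, because $\phi_F$ is
exactly the associator that makes the associativity square commute. Three general facts then do the
work.

Let $F : C \to D$ be a strong monoidal equivalence. An $A$-action on $V$ is the same thing as an
$F(A)$-action on $F(V)$, since the tensorator is invertible and $F$ is full and faithful; hence
`bimodFunctor F A` is an equivalence. As an equivalence, $F$ preserves the coequalizer defining $V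
\otimes_A W$, so the tensorator descends to an isomorphism $F(V) \otimes_{F(A)} F(W) \cong F(V
\otimes_A W)$ (`tensorObjIso`). The projections onto tensor products over $A$ are epimorphisms and
remain so after tensoring, so every coherence law for the descended map follows from the law for the
tensorator of $F$.

A strong monoidal equivalence $G$ of closed monoidal categories preserves internal homs:
$G(\mathrm{hom}(V,W))$, with the image of the evaluation, has the universal property of
$\mathrm{hom}(G V, G W)$ (`hom_ext_map_ev`, `homComparisonInv_ev`). This gives $\gamma$, its
naturality and its compatibility with evaluation in one stroke, and shows that $\gamma$ is the only
map compatible with the evaluations. Applied to $G$ = `bimodFunctor T.functor A`, it gives the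
closed monoidal equivalence.

What remains is the formula for $\gamma^A$. By uniqueness (`homMap_incl`) $\gamma^A$ is the
restriction of any ambient map $\mathrm{hom}(F V, F W) \to F(\mathrm{hom}(V,W))$ compatible with
evaluation, so it suffices that $L \mapsto F^{(-1)} L\, S(F^{(-2)})$ is such a map
(`internalHomTwist_ev`). That is an identity in $H \otimes H$, `foldLeft_assoc_twist`, which comes
from the definitions of $\phi_F$ and $\alpha_F$ and the antipode axiom for $\alpha$. -/

section BimodCoherence

/-! ### Coherence isomorphisms of the tensor product over an algebra, computed on the ambient tensor
product. -/

variable {C : Type*} [Category C] [MonoidalCategory C] [HasCoequalizers C]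
  [∀ X : C, PreservesColimitsOfSize.{0, 0} (tensorLeft X)]
  [∀ X : C, PreservesColimitsOfSize.{0, 0} (tensorRight X)] {A : Mon C}

theorem bimodProj_hom_ext {V W : Bimod A A} {Z : C} {f g : (V ⊗ W : Bimod A A).X ⟶ Z}
    (h : bimodProj V W ≫ f = bimodProj V W ≫ g) : f = g :=
  (cancel_epi _).1 h

/-- The associator of bimodules is a descent along the outer projection of a descent along the inner
one. The inner descent makes sense because tensoring with `X` on the right preserves the
coequalizer; each descent is undone by its own projection. -/
theorem bimodProj_associator (V W X : Bimod A A) :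
    bimodProj V W ▷ X.X ≫ bimodProj (V ⊗ W) X ≫ (α_ V W X).hom.hom =
      (α_ V.X W.X X.X).hom ≫ V.X ◁ bimodProj W X ≫ bimodProj V (W ⊗ X) := by
  have h : bimodProj (V ⊗ W) X ≫ (α_ V W X).hom.hom = Bimod.AssociatorBimod.homAux V W X :=
    coequalizer.π_desc _ _
  rw [h]
  exact π_tensor_id_preserves_coequalizer_inv_desc _ _ _ _

/-- By construction the unitors are the descents of the two actions. -/
theorem bimodProj_leftUnitor (V : Bimod A A) :
    bimodProj (𝟙_ (Bimod A A)) V ≫ (λ_ V).hom.hom = V.actLeft :=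
  coequalizer.π_desc _ _

theorem bimodProj_rightUnitor (V : Bimod A A) :
    bimodProj V (𝟙_ (Bimod A A)) ≫ (ρ_ V).hom.hom = V.actRight :=
  coequalizer.π_desc _ _

end BimodCoherence

/-! ### A monoidal equivalence induces an equivalence of bimodule categories. -/

namespace BimodFunctor

open Functor

variable {C D : Type*} [Category C] [MonoidalCategory C] [Category D] [MonoidalCategory D]
  (F : C ⥤ D) [F.Monoidal] {A : Mon C}

section Equivalence

instance [F.Faithful] : (bimodFunctor F A).Faithful where
  map_injective h :=
    Bimod.hom_ext _ _ (F.map_injective (congrArg Bimod.Hom.hom h))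

/-- A preimage under `F` of an `F(A)`-linear map is automatically `A`-linear: the linearity
condition in the target is the image of the one in the source, precomposed with the invertible
tensorator, and `F` is faithful. -/
instance [F.Full] [F.Faithful] : (bimodFunctor F A).Full where
  map_surjective {V W} g := by
    obtain ⟨f, hf⟩ := F.map_surjective (show F.obj V.X ⟶ F.obj W.X from g.hom)
    -- Linearity of `g`, restated with the actions in terms of `F` so that the tensorator can be
    -- cancelled from both sides.
    have hl : actLeft F V ≫ F.map f = F.obj A.X ◁ F.map f ≫ actLeft F W := by
      rw [hf]; exact g.left_act_hom
    have hr : actRight F V ≫ F.map f = F.map f ▷ F.obj A.X ≫ actRight F W := by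
      rw [hf]; exact g.right_act_hom
    refine ⟨⟨f, F.map_injective ?_, F.map_injective ?_⟩, Bimod.hom_ext _ _ hf⟩
    · rw [← cancel_epi (LaxMonoidal.μ F A.X V.X), F.map_comp, F.map_comp,
        ← LaxMonoidal.μ_natural_right_assoc]
      simpa [actLeft] using hl
    · rw [← cancel_epi (LaxMonoidal.μ F V.X A.X), F.map_comp, F.map_comp,
        ← LaxMonoidal.μ_natural_left_assoc]
      simpa [actRight] using hr

variable (N : Bimod (F.mapMon.obj A) (F.mapMon.obj A))

/-- The left action of `F(A)` on a bimodule `N`. -/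
def imageActLeft : F.obj A.X ⊗ N.X ⟶ N.X := N.actLeft

/-- The right action of `F(A)` on a bimodule `N`. -/
def imageActRight : N.X ⊗ F.obj A.X ⟶ N.X := N.actRight

/-- This and the next four are the bimodule axioms of `N` with the unit and the product of `F(A)`
unfolded into `ε`, `μ` and the images of those of `A`. In that form the coherence laws of `F` can be
used to rewrite them. -/
theorem one_imageActLeft :
    (LaxMonoidal.ε F ≫ F.map (MonObj.one (X := A.X))) ▷ N.X ≫ imageActLeft F N = (λ_ N.X).hom :=
  N.one_actLeft

theorem imageActRight_one :
    N.X ◁ (LaxMonoidal.ε F ≫ F.map (MonObj.one (X := A.X))) ≫ imageActRight F N = (ρ_ N.X).hom :=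
  N.actRight_one

theorem imageActLeft_assoc :
    (LaxMonoidal.μ F A.X A.X ≫ F.map (MonObj.mul (X := A.X))) ▷ N.X ≫ imageActLeft F N =
      (α_ _ _ _).hom ≫ F.obj A.X ◁ imageActLeft F N ≫ imageActLeft F N :=
  N.left_assoc

theorem imageActRight_assoc :
    N.X ◁ (LaxMonoidal.μ F A.X A.X ≫ F.map (MonObj.mul (X := A.X))) ≫ imageActRight F N =
      (α_ _ _ _).inv ≫ imageActRight F N ▷ F.obj A.X ≫ imageActRight F N :=
  N.right_assoc

theorem imageAct_middle_assoc :
    imageActLeft F N ▷ F.obj A.X ≫ imageActRight F N =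
      (α_ _ _ _).hom ≫ F.obj A.X ◁ imageActRight F N ≫ imageActLeft F N :=
  N.middle_assoc

variable [F.Full] {V : C} (e : F.obj V ≅ N.X)

/-- The left action on `V` that corresponds to the left action on `N ≅ F(V)`. -/
noncomputable def preimageActLeft : A.X ⊗ V ⟶ V :=
  F.preimage (OplaxMonoidal.δ F A.X V ≫ F.obj A.X ◁ e.hom ≫ imageActLeft F N ≫ e.inv)

/-- The right action on `V` that corresponds to the right action on `N ≅ F(V)`. -/
noncomputable def preimageActRight : V ⊗ A.X ⟶ V :=
  F.preimage (OplaxMonoidal.δ F V A.X ≫ e.hom ▷ F.obj A.X ≫ imageActRight F N ≫ e.inv)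

/-- The characterization used from here on: the image of the new action, read through the
tensorator, is the action on `N` conjugated by `e`. The `δ` in the definition cancels against `μ`.
-/
theorem μ_map_preimageActLeft : LaxMonoidal.μ F A.X V ≫ F.map (preimageActLeft F N e) =
    F.obj A.X ◁ e.hom ≫ imageActLeft F N ≫ e.inv := by
  simp [preimageActLeft]

theorem μ_map_preimageActRight : LaxMonoidal.μ F V A.X ≫ F.map (preimageActRight F N e) =
    e.hom ▷ F.obj A.X ≫ imageActRight F N ≫ e.inv := by
  simp [preimageActRight]

variable [F.Faithful]

/-- The bimodule structure on `V` that corresponds to the bimodule `N ≅ F(V)`. -/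
noncomputable def preimage : Bimod A A where
  X := V
  actLeft := preimageActLeft F N e
  actRight := preimageActRight F N e
  -- All five axioms follow one pattern. By faithfulness they are checked after `F`; precomposing
  -- with invertible tensorators brings each image action next to a `μ`, where it becomes the action
  -- on `N` conjugated by `e`; then the axiom of `N` applies.
  one_actLeft := F.map_injective (by
    rw [← cancel_epi (LaxMonoidal.μ F (𝟙_ C) V), F.map_comp,
      ← LaxMonoidal.μ_natural_left_assoc, μ_map_preimageActLeft,
      -- Precomposing with the invertible `ε` as well lets left unitality of `F` replace the image
      -- of the unitor by the unitor of `F.obj V`, and completes the unit of `F(A)`.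
      ← cancel_epi (LaxMonoidal.ε F ▷ F.obj V), ← LaxMonoidal.left_unitality,
      ← comp_whiskerRight_assoc, ← whisker_exchange_assoc, reassoc_of% (one_imageActLeft F N)]
    simp)
  left_assoc := F.map_injective (by
    -- Two tensorators are needed, since the axiom lives on a threefold tensor product;
    -- associativity of `F` then moves the associator out of the image.
    rw [← cancel_epi (LaxMonoidal.μ F (A.X ⊗ A.X) V),
      ← cancel_epi (LaxMonoidal.μ F A.X A.X ▷ F.obj V), F.map_comp, F.map_comp, F.map_comp,
      ← LaxMonoidal.μ_natural_left_assoc, μ_map_preimageActLeft,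
      LaxMonoidal.associativity_assoc, ← LaxMonoidal.μ_natural_right_assoc,
      μ_map_preimageActLeft, ← comp_whiskerRight_assoc, ← whisker_exchange_assoc,
      reassoc_of% (imageActLeft_assoc F N), ← MonoidalCategory.whiskerLeft_comp_assoc,
      ← MonoidalCategory.whiskerLeft_comp_assoc, Category.assoc,
      reassoc_of% (μ_map_preimageActLeft F N e)]
    simp)
  actRight_one := F.map_injective (by
    rw [← cancel_epi (LaxMonoidal.μ F V (𝟙_ C)), F.map_comp,
      ← LaxMonoidal.μ_natural_right_assoc, μ_map_preimageActRight,
      ← cancel_epi (F.obj V ◁ LaxMonoidal.ε F), ← LaxMonoidal.right_unitality,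
      ← MonoidalCategory.whiskerLeft_comp_assoc, whisker_exchange_assoc,
      reassoc_of% (imageActRight_one F N)]
    simp)
  right_assoc := F.map_injective (by
    rw [← cancel_epi (LaxMonoidal.μ F V (A.X ⊗ A.X)),
      ← cancel_epi (F.obj V ◁ LaxMonoidal.μ F A.X A.X), F.map_comp, F.map_comp, F.map_comp,
      ← LaxMonoidal.μ_natural_right_assoc, μ_map_preimageActRight,
      LaxMonoidal.associativity_inv_assoc, ← LaxMonoidal.μ_natural_left_assoc,
      μ_map_preimageActRight, ← MonoidalCategory.whiskerLeft_comp_assoc, whisker_exchange_assoc,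
      reassoc_of% (imageActRight_assoc F N), ← comp_whiskerRight_assoc, ← comp_whiskerRight_assoc,
      Category.assoc, reassoc_of% (μ_map_preimageActRight F N e)]
    simp)
  middle_assoc := F.map_injective (by
    rw [← cancel_epi (LaxMonoidal.μ F (A.X ⊗ V) A.X),
      ← cancel_epi (LaxMonoidal.μ F A.X V ▷ F.obj A.X), F.map_comp, F.map_comp, F.map_comp,
      ← LaxMonoidal.μ_natural_left_assoc, μ_map_preimageActRight,
      LaxMonoidal.associativity_assoc, ← LaxMonoidal.μ_natural_right_assoc,
      -- The characterization of the left action is used once for the outer action on one side and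
      -- once inside the whiskering on the other, since the two sides act in opposite orders.
      μ_map_preimageActLeft, ← comp_whiskerRight_assoc, μ_map_preimageActLeft,
      ← MonoidalCategory.whiskerLeft_comp_assoc, ← MonoidalCategory.whiskerLeft_comp_assoc,
      Category.assoc, reassoc_of% (μ_map_preimageActRight F N e)]
    simp [reassoc_of% (imageAct_middle_assoc F N)])

/-- The bimodule `N` is isomorphic to the image of `preimage F N e`. -/
noncomputable def objPreimageIso : (bimodFunctor F A).obj (preimage F N e) ≅ N :=
  Bimod.isoOfIso (P := (bimodFunctor F A).obj (preimage F N e)) (Q := N) e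
    (by
      change (LaxMonoidal.μ F A.X V ≫ F.map (preimageActLeft F N e)) ≫ e.hom =
        F.obj A.X ◁ e.hom ≫ imageActLeft F N
      rw [μ_map_preimageActLeft]
      simp)
    (by
      change (LaxMonoidal.μ F V A.X ≫ F.map (preimageActRight F N e)) ≫ e.hom =
        e.hom ▷ F.obj A.X ≫ imageActRight F N
      rw [μ_map_preimageActRight]
      simp)

instance [F.EssSurj] : (bimodFunctor F A).EssSurj where
  mem_essImage N := ⟨_, ⟨objPreimageIso F N (F.objObjPreimageIso N.X)⟩⟩

end Equivalence

instance [F.IsEquivalence] : (bimodFunctor F A).IsEquivalence where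

end BimodFunctor

/-! ### The induced functor on bimodules is strong monoidal. -/

namespace BimodFunctor

open Functor

variable {C D : Type*} [Category C] [MonoidalCategory C] [Category D] [MonoidalCategory D]
  [HasCoequalizers C] [∀ X : C, PreservesColimitsOfSize.{0, 0} (tensorLeft X)]
  [∀ X : C, PreservesColimitsOfSize.{0, 0} (tensorRight X)]
  [HasCoequalizers D] [∀ X : D, PreservesColimitsOfSize.{0, 0} (tensorLeft X)]
  [∀ X : D, PreservesColimitsOfSize.{0, 0} (tensorRight X)]
  (F : C ⥤ D) [F.Monoidal] {A : Mon C} (V W X : Bimod A A)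

/-- The projection `F(V) ⊗ F(W) ⟶ F(V) ⊗_{F(A)} F(W)`. -/
noncomputable def proj :
    F.obj V.X ⊗ F.obj W.X ⟶ ((bimodFunctor F A).obj V ⊗ (bimodFunctor F A).obj W : Bimod _ _).X :=
  bimodProj ((bimodFunctor F A).obj V) ((bimodFunctor F A).obj W)

/-- `proj` is `bimodProj` for the two image bimodules, typed with `F.obj V.X` instead of the carrier
of the image bimodule. The properties of `bimodProj` are restated for it so that rewriting with the
coherence laws of `F` finds its patterns. -/
instance : Epi (proj F V W) :=
  inferInstanceAs (Epi (bimodProj ((bimodFunctor F A).obj V) ((bimodFunctor F A).obj W)))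

instance (Z : D) : Epi (Z ◁ proj F V W) :=
  inferInstanceAs (Epi (Z ◁ bimodProj ((bimodFunctor F A).obj V) ((bimodFunctor F A).obj W)))

instance (Z : D) : Epi (proj F V W ▷ Z) :=
  inferInstanceAs (Epi (bimodProj ((bimodFunctor F A).obj V) ((bimodFunctor F A).obj W) ▷ Z))

theorem proj_condition : actRight F V ▷ F.obj W.X ≫ proj F V W =
    (α_ _ _ _).hom ≫ F.obj V.X ◁ actLeft F W ≫ proj F V W :=
  bimodProj_condition ((bimodFunctor F A).obj V) ((bimodFunctor F A).obj W)

/-- Balancedness of the tensorator followed by the image of the projection, which allows it to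
descend to the tensor product over `F(A)`. It is the image of the balancedness of `bimodProj`, moved
past the tensorators by associativity of `F`. -/
theorem actRight_μ_map_bimodProj :
    actRight F V ▷ F.obj W.X ≫ LaxMonoidal.μ F V.X W.X ≫ F.map (bimodProj V W) =
      (α_ (F.obj V.X) (F.obj A.X) (F.obj W.X)).hom ≫ F.obj V.X ◁ actLeft F W ≫
        LaxMonoidal.μ F V.X W.X ≫ F.map (bimodProj V W) := by
  rw [actRight, actLeft, comp_whiskerRight, Category.assoc, LaxMonoidal.μ_natural_left_assoc,
    ← F.map_comp, bimodProj_condition, F.map_comp, F.map_comp, LaxMonoidal.associativity_assoc,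
    MonoidalCategory.whiskerLeft_comp, Category.assoc, LaxMonoidal.μ_natural_right_assoc]

/-- The map `F(V) ⊗_{F(A)} F(W) ⟶ F(V ⊗_A W)` induced by the tensorator of `F`. -/
noncomputable def tensorHom :
    ((bimodFunctor F A).obj V ⊗ (bimodFunctor F A).obj W : Bimod _ _).X ⟶
      F.obj (V ⊗ W : Bimod A A).X :=
  bimodDesc (V := (bimodFunctor F A).obj V) (W := (bimodFunctor F A).obj W)
    (LaxMonoidal.μ F V.X W.X ≫ F.map (bimodProj V W)) (actRight_μ_map_bimodProj F V W)

theorem proj_tensorHom : proj F V W ≫ tensorHom F V W =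
    LaxMonoidal.μ F V.X W.X ≫ F.map (bimodProj V W) :=
  bimodProj_desc (V := (bimodFunctor F A).obj V) (W := (bimodFunctor F A).obj W) _
    (actRight_μ_map_bimodProj F V W)

/-- The converse balancedness, for the inverse tensorator followed by `proj`. It provides the
inverse of `tensorHom`, once `F` is known to preserve the coequalizer. -/
theorem δ_proj_condition :
    F.map (V.actRight ▷ W.X) ≫ OplaxMonoidal.δ F V.X W.X ≫ proj F V W =
      F.map ((α_ V.X A.X W.X).hom ≫ V.X ◁ W.actLeft) ≫ OplaxMonoidal.δ F V.X W.X ≫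
        proj F V W := by
  have h := proj_condition F V W
  rw [actRight, actLeft, comp_whiskerRight, Category.assoc,
    MonoidalCategory.whiskerLeft_comp, Category.assoc] at h
  -- Precomposing with two invertible tensorators moves the claim from the image of a threefold
  -- tensor product to the tensor product of the images, where it is `proj_condition`.
  rw [← cancel_epi (LaxMonoidal.μ F (V.X ⊗ A.X) W.X),
    ← cancel_epi (LaxMonoidal.μ F V.X A.X ▷ F.obj W.X), ← LaxMonoidal.μ_natural_left_assoc,
    Monoidal.μ_δ_assoc, h, F.map_comp, Category.assoc, LaxMonoidal.associativity_assoc,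
    ← LaxMonoidal.μ_natural_right_assoc, Monoidal.μ_δ_assoc]

theorem proj_actLeft :
    F.obj A.X ◁ proj F V W ≫
      imageActLeft F ((bimodFunctor F A).obj V ⊗ (bimodFunctor F A).obj W) =
      (α_ _ _ _).inv ≫ actLeft F V ▷ F.obj W.X ≫ proj F V W :=
  bimodProj_actLeft ((bimodFunctor F A).obj V) ((bimodFunctor F A).obj W)

theorem proj_actRight :
    proj F V W ▷ F.obj A.X ≫
      imageActRight F ((bimodFunctor F A).obj V ⊗ (bimodFunctor F A).obj W) =
      (α_ _ _ _).hom ≫ F.obj V.X ◁ actRight F W ≫ proj F V W :=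
  bimodProj_actRight ((bimodFunctor F A).obj V) ((bimodFunctor F A).obj W)

section

variable [F.IsEquivalence]

/-- The inverse of `tensorHom`. -/
noncomputable def tensorInv : F.obj (V ⊗ W : Bimod A A).X ⟶
    ((bimodFunctor F A).obj V ⊗ (bimodFunctor F A).obj W : Bimod _ _).X :=
  Cofork.IsColimit.desc (isColimitOfHasCoequalizerOfPreservesColimit F (V.actRight ▷ W.X)
    ((α_ V.X A.X W.X).hom ≫ V.X ◁ W.actLeft)) (OplaxMonoidal.δ F V.X W.X ≫ proj F V W)
    (δ_proj_condition F V W)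

theorem map_bimodProj_tensorInv :
    F.map (bimodProj V W) ≫ tensorInv F V W = OplaxMonoidal.δ F V.X W.X ≫ proj F V W :=
  Cofork.IsColimit.π_desc' (isColimitOfHasCoequalizerOfPreservesColimit F (V.actRight ▷ W.X)
    ((α_ V.X A.X W.X).hom ≫ V.X ◁ W.actLeft)) _ _

/-- The isomorphism `F(V) ⊗_{F(A)} F(W) ≅ F(V ⊗_A W)` induced by the tensorator of `F`. -/
noncomputable def tensorObjIso :
    ((bimodFunctor F A).obj V ⊗ (bimodFunctor F A).obj W : Bimod _ _).X ≅
      F.obj (V ⊗ W : Bimod A A).X where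
  hom := tensorHom F V W
  inv := tensorInv F V W
  hom_inv_id := by
    -- Before descending, the two maps are the tensorator and its inverse; both projections are
    -- epimorphisms, so the composites descend to identities.
    rw [← cancel_epi (proj F V W), reassoc_of% (proj_tensorHom F V W), map_bimodProj_tensorInv,
      Monoidal.μ_δ_assoc, Category.comp_id]
  inv_hom_id := by
    -- The image of the projection is an epimorphism because an equivalence preserves epimorphisms.
    rw [← cancel_epi (F.map (bimodProj V W)), reassoc_of% (map_bimodProj_tensorInv F V W),
      proj_tensorHom,
      Monoidal.δ_μ_assoc, Category.comp_id]

/-- Tensoring on the left preserves the coequalizer, so `F.obj A.X ◁ proj F V W` is an epimorphism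
and can be cancelled. On representatives the actions come from the action on `V`, and the claim is
naturality and associativity of the tensorator. -/
theorem tensorHom_left :
    imageActLeft F ((bimodFunctor F A).obj V ⊗ (bimodFunctor F A).obj W) ≫ tensorHom F V W =
      F.obj A.X ◁ tensorHom F V W ≫ actLeft F (V ⊗ W) := by
  rw [← cancel_epi (F.obj A.X ◁ proj F V W), reassoc_of% (proj_actLeft F V W), proj_tensorHom,
    ← MonoidalCategory.whiskerLeft_comp_assoc, proj_tensorHom, actLeft, actLeft,
    MonoidalCategory.whiskerLeft_comp_assoc, LaxMonoidal.μ_natural_right_assoc, ← F.map_comp,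
    bimodProj_actLeft, comp_whiskerRight_assoc, LaxMonoidal.μ_natural_left_assoc]
  simp

theorem tensorHom_right :
    imageActRight F ((bimodFunctor F A).obj V ⊗ (bimodFunctor F A).obj W) ≫ tensorHom F V W =
      tensorHom F V W ▷ F.obj A.X ≫ actRight F (V ⊗ W) := by
  rw [← cancel_epi (proj F V W ▷ F.obj A.X), reassoc_of% (proj_actRight F V W), proj_tensorHom,
    ← comp_whiskerRight_assoc, proj_tensorHom, actRight, actRight,
    comp_whiskerRight_assoc, LaxMonoidal.μ_natural_left_assoc, ← F.map_comp,
    bimodProj_actRight, MonoidalCategory.whiskerLeft_comp_assoc, LaxMonoidal.μ_natural_right_assoc]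
  simp

/-- The isomorphism of bimodules `F(V) ⊗_{F(A)} F(W) ≅ F(V ⊗_A W)`. -/
noncomputable def tensorIso : (bimodFunctor F A).obj V ⊗ (bimodFunctor F A).obj W ≅
    (bimodFunctor F A).obj (V ⊗ W) :=
  Bimod.isoOfIso (Q := (bimodFunctor F A).obj (V ⊗ W)) (tensorObjIso F V W)
    (tensorHom_left F V W) (tensorHom_right F V W)

end

variable (A) in
/-- The unit bimodule `F(A)` is the image of the unit bimodule `A`. -/
def unitIso : 𝟙_ (Bimod (F.mapMon.obj A) (F.mapMon.obj A)) ≅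
    (bimodFunctor F A).obj (𝟙_ (Bimod A A)) :=
  Bimod.isoOfIso (P := Bimod.regular (F.mapMon.obj A))
    (Q := (bimodFunctor F A).obj (Bimod.regular A)) (Iso.refl (F.obj A.X))
    (by
      -- Both unit bimodules have underlying object `F.obj A.X`, and on both the action is the
      -- product of `F(A)`, so the identity is equivariant.
      change (LaxMonoidal.μ F A.X A.X ≫ F.map MonObj.mul) ≫ 𝟙 (F.obj A.X) =
        F.obj A.X ◁ 𝟙 (F.obj A.X) ≫ LaxMonoidal.μ F A.X A.X ≫ F.map MonObj.mul
      simp)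
    (by
      change (LaxMonoidal.μ F A.X A.X ≫ F.map MonObj.mul) ≫ 𝟙 (F.obj A.X) =
        𝟙 (F.obj A.X) ▷ F.obj A.X ≫ LaxMonoidal.μ F A.X A.X ≫ F.map MonObj.mul
      simp)

variable {V W}

theorem proj_whiskerRight {V' : Bimod A A} (f : V ⟶ V') (W : Bimod A A) :
    proj F V W ≫ ((bimodFunctor F A).map f ▷ (bimodFunctor F A).obj W).hom =
      F.map f.hom ▷ F.obj W.X ≫ proj F V' W :=
  bimodProj_whiskerRight ((bimodFunctor F A).map f) ((bimodFunctor F A).obj W)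

theorem proj_whiskerLeft (V : Bimod A A) {W' : Bimod A A} (f : W ⟶ W') :
    proj F V W ≫ ((bimodFunctor F A).obj V ◁ (bimodFunctor F A).map f).hom =
      F.obj V.X ◁ F.map f.hom ≫ proj F V W' :=
  bimodProj_whiskerLeft ((bimodFunctor F A).obj V) ((bimodFunctor F A).map f)

variable [F.IsEquivalence]

/-- Cancelling the projection leaves naturality of the tensorator of `F`. -/
theorem tensorIso_natural_left {V' : Bimod A A} (f : V ⟶ V') (W : Bimod A A) :
    (bimodFunctor F A).map f ▷ (bimodFunctor F A).obj W ≫ (tensorIso F V' W).hom =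
      (tensorIso F V W).hom ≫ (bimodFunctor F A).map (f ▷ W) := by
  apply Bimod.hom_ext
  rw [← cancel_epi (proj F V W)]
  change proj F V W ≫ _ ≫ tensorHom F V' W = proj F V W ≫ tensorHom F V W ≫ F.map (f ▷ W).hom
  rw [reassoc_of% (proj_whiskerRight F f W), proj_tensorHom, reassoc_of% (proj_tensorHom F V W),
    ← F.map_comp,
    bimodProj_whiskerRight, LaxMonoidal.μ_natural_left_assoc, F.map_comp]

theorem tensorIso_natural_right (V : Bimod A A) {W' : Bimod A A} (f : W ⟶ W') :
    (bimodFunctor F A).obj V ◁ (bimodFunctor F A).map f ≫ (tensorIso F V W').hom =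
      (tensorIso F V W).hom ≫ (bimodFunctor F A).map (V ◁ f) := by
  apply Bimod.hom_ext
  rw [← cancel_epi (proj F V W)]
  change proj F V W ≫ _ ≫ tensorHom F V W' = proj F V W ≫ tensorHom F V W ≫ F.map (V ◁ f).hom
  rw [reassoc_of% (proj_whiskerLeft F V f), proj_tensorHom, reassoc_of% (proj_tensorHom F V W),
    ← F.map_comp,
    bimodProj_whiskerLeft, LaxMonoidal.μ_natural_right_assoc, F.map_comp]

variable (V W)

/-- The projection `N ⊗ F(X) ⟶ N ⊗_{F(A)} F(X)`. -/
noncomputable def projRight (N : Bimod (F.mapMon.obj A) (F.mapMon.obj A)) (X : Bimod A A) :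
    N.X ⊗ F.obj X.X ⟶ (N ⊗ (bimodFunctor F A).obj X : Bimod _ _).X :=
  bimodProj N ((bimodFunctor F A).obj X)

/-- The projection `F(V) ⊗ N ⟶ F(V) ⊗_{F(A)} N`. -/
noncomputable def projLeft (V : Bimod A A) (N : Bimod (F.mapMon.obj A) (F.mapMon.obj A)) :
    F.obj V.X ⊗ N.X ⟶ ((bimodFunctor F A).obj V ⊗ N : Bimod _ _).X :=
  bimodProj ((bimodFunctor F A).obj V) N

/-- In the associativity law one factor is a tensor product over `F(A)`, which is only isomorphic to
an image under the functor. `projRight` and `projLeft` project onto tensor products with such a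
factor, and whiskering with `tensorIso` leads back to `proj`. -/
theorem projRight_tensorIso :
    projRight F ((bimodFunctor F A).obj V ⊗ (bimodFunctor F A).obj W) X ≫
        ((tensorIso F V W).hom ▷ (bimodFunctor F A).obj X).hom =
      tensorHom F V W ▷ F.obj X.X ≫ proj F (V ⊗ W) X :=
  bimodProj_whiskerRight (tensorIso F V W).hom ((bimodFunctor F A).obj X)

theorem projLeft_tensorIso :
    projLeft F V ((bimodFunctor F A).obj W ⊗ (bimodFunctor F A).obj X) ≫
        ((bimodFunctor F A).obj V ◁ (tensorIso F W X).hom).hom =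
      F.obj V.X ◁ tensorHom F W X ≫ proj F V (W ⊗ X) :=
  bimodProj_whiskerLeft ((bimodFunctor F A).obj V) (tensorIso F W X).hom

theorem proj_projRight_associator :
    proj F V W ▷ F.obj X.X ≫
        projRight F ((bimodFunctor F A).obj V ⊗ (bimodFunctor F A).obj W) X ≫
        (α_ ((bimodFunctor F A).obj V) ((bimodFunctor F A).obj W)
          ((bimodFunctor F A).obj X)).hom.hom =
      (α_ (F.obj V.X) (F.obj W.X) (F.obj X.X)).hom ≫ F.obj V.X ◁ proj F W X ≫
        projLeft F V ((bimodFunctor F A).obj W ⊗ (bimodFunctor F A).obj X) :=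
  bimodProj_associator ((bimodFunctor F A).obj V) ((bimodFunctor F A).obj W)
    ((bimodFunctor F A).obj X)

theorem tensorIso_associativity :
    (tensorIso F V W).hom ▷ (bimodFunctor F A).obj X ≫ (tensorIso F (V ⊗ W) X).hom ≫
        (bimodFunctor F A).map (α_ V W X).hom =
      (α_ ((bimodFunctor F A).obj V) ((bimodFunctor F A).obj W) ((bimodFunctor F A).obj X)).hom ≫
        (bimodFunctor F A).obj V ◁ (tensorIso F W X).hom ≫ (tensorIso F V (W ⊗ X)).hom := by
  apply Bimod.hom_ext
  apply bimodProj_hom_ext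
  -- After cancelling both projections the equation is one between morphisms out of `(F.obj V.X ⊗
  -- F.obj W.X) ⊗ F.obj X.X`. There the descended maps become tensorators, and the law becomes
  -- associativity of `F` followed by the image of `bimodProj_associator`.
  refine (cancel_epi (proj F V W ▷ F.obj X.X)).1 ?_
  change _ ≫ projRight F ((bimodFunctor F A).obj V ⊗ (bimodFunctor F A).obj W) X ≫ _ ≫
      tensorHom F (V ⊗ W) X ≫ F.map (α_ V W X).hom.hom =
    _ ≫ projRight F ((bimodFunctor F A).obj V ⊗ (bimodFunctor F A).obj W) X ≫ _ ≫ _ ≫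
      tensorHom F V (W ⊗ X)
  rw [reassoc_of% (projRight_tensorIso F V W X), reassoc_of% (proj_projRight_associator F V W X),
    reassoc_of% (projLeft_tensorIso F V W X), proj_tensorHom,
    reassoc_of% (proj_tensorHom F (V ⊗ W) X),
    ← comp_whiskerRight_assoc, proj_tensorHom, ← MonoidalCategory.whiskerLeft_comp_assoc,
    proj_tensorHom, comp_whiskerRight_assoc, MonoidalCategory.whiskerLeft_comp_assoc,
    LaxMonoidal.μ_natural_left_assoc, LaxMonoidal.μ_natural_right_assoc, ← F.map_comp,
    ← F.map_comp, bimodProj_associator, F.map_comp, F.map_comp,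
    LaxMonoidal.associativity_assoc]

/-- The projection `F(A) ⊗ F(V) ⟶ F(A) ⊗_{F(A)} F(V)`. -/
noncomputable def unitProjLeft : F.obj (𝟙_ (Bimod A A)).X ⊗ F.obj V.X ⟶
    (𝟙_ (Bimod (F.mapMon.obj A) (F.mapMon.obj A)) ⊗ (bimodFunctor F A).obj V : Bimod _ _).X :=
  bimodProj (𝟙_ (Bimod (F.mapMon.obj A) (F.mapMon.obj A))) ((bimodFunctor F A).obj V)

/-- The projection `F(V) ⊗ F(A) ⟶ F(V) ⊗_{F(A)} F(A)`. -/
noncomputable def unitProjRight : F.obj V.X ⊗ F.obj (𝟙_ (Bimod A A)).X ⟶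
    ((bimodFunctor F A).obj V ⊗ 𝟙_ (Bimod (F.mapMon.obj A) (F.mapMon.obj A)) : Bimod _ _).X :=
  bimodProj ((bimodFunctor F A).obj V) (𝟙_ (Bimod (F.mapMon.obj A) (F.mapMon.obj A)))

/-- `unitIso` is the identity on underlying objects, so whiskering with it does not change the
projection. -/
theorem unitProjLeft_unitIso :
    unitProjLeft F V ≫ ((unitIso F A).hom ▷ (bimodFunctor F A).obj V).hom =
      proj F (𝟙_ (Bimod A A)) V := by
  refine (bimodProj_whiskerRight (unitIso F A).hom ((bimodFunctor F A).obj V)).trans ?_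
  change 𝟙 (F.obj (𝟙_ (Bimod A A)).X) ▷ F.obj V.X ≫ proj F (𝟙_ (Bimod A A)) V = _
  rw [id_whiskerRight]
  rw [Category.id_comp]

theorem unitProjRight_unitIso :
    unitProjRight F V ≫ ((bimodFunctor F A).obj V ◁ (unitIso F A).hom).hom =
      proj F V (𝟙_ (Bimod A A)) := by
  refine (bimodProj_whiskerLeft ((bimodFunctor F A).obj V) (unitIso F A).hom).trans ?_
  change F.obj V.X ◁ 𝟙 (F.obj (𝟙_ (Bimod A A)).X) ≫ proj F V (𝟙_ (Bimod A A)) = _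
  rw [MonoidalCategory.whiskerLeft_id]
  rw [Category.id_comp]

/-- The unitor of bimodules is the descended action, so on representatives both sides are the action
on `F(V)`, which is the tensorator followed by the image of the action on `V`. Unitality of `F`
itself is not needed here. -/
theorem tensorIso_left_unitality : (λ_ ((bimodFunctor F A).obj V)).hom =
    (unitIso F A).hom ▷ (bimodFunctor F A).obj V ≫ (tensorIso F (𝟙_ (Bimod A A)) V).hom ≫
      (bimodFunctor F A).map (λ_ V).hom := by
  apply Bimod.hom_ext
  apply bimodProj_hom_ext
  refine (bimodProj_leftUnitor ((bimodFunctor F A).obj V)).trans ?_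
  have h : unitProjLeft F V ≫ ((unitIso F A).hom ▷ (bimodFunctor F A).obj V).hom ≫
      tensorHom F (𝟙_ (Bimod A A)) V ≫ F.map (λ_ V).hom.hom = actLeft F V := by
    rw [reassoc_of% (unitProjLeft_unitIso F V), reassoc_of% (proj_tensorHom F (𝟙_ (Bimod A A)) V),
      ← F.map_comp,
      bimodProj_leftUnitor]
    rfl
  exact h.symm

theorem tensorIso_right_unitality : (ρ_ ((bimodFunctor F A).obj V)).hom =
    (bimodFunctor F A).obj V ◁ (unitIso F A).hom ≫ (tensorIso F V (𝟙_ (Bimod A A))).hom ≫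
      (bimodFunctor F A).map (ρ_ V).hom := by
  apply Bimod.hom_ext
  apply bimodProj_hom_ext
  refine (bimodProj_rightUnitor ((bimodFunctor F A).obj V)).trans ?_
  have h : unitProjRight F V ≫ ((bimodFunctor F A).obj V ◁ (unitIso F A).hom).hom ≫
      tensorHom F V (𝟙_ (Bimod A A)) ≫ F.map (ρ_ V).hom.hom = actRight F V := by
    rw [reassoc_of% (unitProjRight_unitIso F V), reassoc_of% (proj_tensorHom F V (𝟙_ (Bimod A A))),
      ← F.map_comp,
      bimodProj_rightUnitor]
    rfl
  exact h.symm

variable (A) in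
/-- The monoidal structure of `bimodFunctor F A`. -/
noncomputable def coreMonoidal : (bimodFunctor F A).CoreMonoidal where
  εIso := unitIso F A
  μIso V W := tensorIso F V W
  μIso_hom_natural_left f W := tensorIso_natural_left F f W
  μIso_hom_natural_right V f := tensorIso_natural_right F V f
  associativity V W X := tensorIso_associativity F V W X
  left_unitality V := tensorIso_left_unitality F V
  right_unitality V := tensorIso_right_unitality F V

noncomputable instance : (bimodFunctor F A).Monoidal := (coreMonoidal F A).toMonoidal

end BimodFunctor

/-! ### Monoidal equivalences preserve internal homs. -/

namespace RightMonoidalClosed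

open Functor

variable {C D : Type*} [Category C] [MonoidalCategory C] [RightMonoidalClosed C] [Category D]
  [MonoidalCategory D] [RightMonoidalClosed D] (G : C ⥤ D) [G.Monoidal] [G.IsEquivalence]

/-- The uniqueness half of the statement that `G.obj (hom V W)`, with the image of the evaluation,
is an internal hom in the target category. All later identities for maps into this object are
checked by this test. -/
theorem hom_ext_map_ev {V W : C} {Z : D} {f g : Z ⟶ G.obj (hom V W)}
    (h : f ▷ G.obj V ≫ LaxMonoidal.μ G (hom V W) V ≫ G.map (ev V W) =
      g ▷ G.obj V ≫ LaxMonoidal.μ G (hom V W) V ≫ G.map (ev V W)) : f = g := by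
  -- Up to isomorphism `Z` is an image under `G`, and by fullness both maps then come from the
  -- source category, where a map into `hom V W` is determined by its evaluation.
  let e := G.objObjPreimageIso Z
  rw [← cancel_epi e.hom]
  obtain ⟨f', hf⟩ := G.map_surjective (e.hom ≫ f)
  obtain ⟨g', hg⟩ := G.map_surjective (e.hom ≫ g)
  rw [← hf, ← hg]
  congr 1
  apply hom_ext_ev
  apply G.map_injective
  rw [← cancel_epi (LaxMonoidal.μ G _ V), G.map_comp, G.map_comp,
    ← LaxMonoidal.μ_natural_left_assoc, ← LaxMonoidal.μ_natural_left_assoc, hf, hg,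
    comp_whiskerRight_assoc, comp_whiskerRight_assoc, h]

/-- The comparison morphism `G(hom(V, W)) ⟶ hom(G(V), G(W))`. -/
def homComparison (V W : C) : G.obj (hom V W) ⟶ hom (G.obj V) (G.obj W) :=
  curry (LaxMonoidal.μ G (hom V W) V ≫ G.map (ev V W))

theorem homComparison_ev (V W : C) :
    homComparison G V W ▷ G.obj V ≫ ev (G.obj V) (G.obj W) =
      LaxMonoidal.μ G (hom V W) V ≫ G.map (ev V W) :=
  whiskerRight_curry_ev _

/-- The inverse of the comparison morphism, for an equivalence `G`. -/
noncomputable def homComparisonInv (V W : C) : hom (G.obj V) (G.obj W) ⟶ G.obj (hom V W) :=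
  -- The existence half: with `P` the chosen preimage of `hom (G.obj V) (G.obj W)`, the evaluation
  -- gives a map `G.obj (P ⊗ V) ⟶ G.obj W` through `δ`; it is pulled back along the full functor
  -- `G`, curried in `C` and sent to `D` again.
  (G.objObjPreimageIso (hom (G.obj V) (G.obj W))).inv ≫
    G.map (curry (G.preimage (OplaxMonoidal.δ G _ V ≫
      (G.objObjPreimageIso (hom (G.obj V) (G.obj W))).hom ▷ G.obj V ≫ ev (G.obj V) (G.obj W))))

/-- Compatibility with the evaluations. Uncurrying undoes the currying in the definition, `δ`
cancels against `μ`, and the preimage isomorphism against its inverse. -/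
theorem homComparisonInv_ev (V W : C) :
    homComparisonInv G V W ▷ G.obj V ≫ LaxMonoidal.μ G (hom V W) V ≫ G.map (ev V W) =
      ev (G.obj V) (G.obj W) := by
  rw [homComparisonInv, comp_whiskerRight_assoc, LaxMonoidal.μ_natural_left_assoc, ← G.map_comp,
    whiskerRight_curry_ev, G.map_preimage, Monoidal.μ_δ_assoc, ← comp_whiskerRight_assoc]
  simp

/-- The isomorphism `hom(G(V), G(W)) ≅ G(hom(V, W))`, for a monoidal equivalence `G`. -/
@[simps]
noncomputable def homIso (V W : C) : hom (G.obj V) (G.obj W) ≅ G.obj (hom V W) where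
  hom := homComparisonInv G V W
  inv := homComparison G V W
  -- Each composite is compared with the identity through its evaluation: here in the internal hom
  -- of `D`, and for the other composite in the image of the internal hom of `C`.
  hom_inv_id := by
    apply hom_ext_ev
    rw [comp_whiskerRight_assoc, homComparison_ev, homComparisonInv_ev, id_whiskerRight,
      Category.id_comp]
  inv_hom_id := by
    apply hom_ext_map_ev
    rw [comp_whiskerRight_assoc, homComparisonInv_ev, homComparison_ev, id_whiskerRight,
      Category.id_comp]

/-- Both sides evaluate to the evaluation of `D` followed by `G.map g`. -/
theorem homIso_natural_right (V : C) {W W' : C} (g : W ⟶ W') :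
    ((ihom (C := D)).obj (Opposite.op (G.obj V))).map (G.map g) ≫ (homIso G V W').hom =
      (homIso G V W).hom ≫ G.map (((ihom (C := C)).obj (Opposite.op V)).map g) := by
  apply hom_ext_map_ev
  rw [comp_whiskerRight_assoc, comp_whiskerRight_assoc, homIso_hom, homIso_hom,
    homComparisonInv_ev, ihom_obj_map_ev, LaxMonoidal.μ_natural_left_assoc, ← G.map_comp,
    ihom_obj_map_ev, G.map_comp, ← homComparisonInv_ev G V W]
  simp only [Category.assoc]

/-- Both sides evaluate to `G.map f` applied to the argument, followed by the evaluation of `D`. -/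
theorem homIso_natural_left {V V' : C} (f : V' ⟶ V) (W : C) :
    ((ihom (C := D)).map (G.map f).op).app (G.obj W) ≫ (homIso G V' W).hom =
      (homIso G V W).hom ≫ G.map (((ihom (C := C)).map f.op).app W) := by
  apply hom_ext_map_ev
  rw [comp_whiskerRight_assoc, comp_whiskerRight_assoc, homIso_hom, homIso_hom,
    homComparisonInv_ev, ihom_map_app_ev, LaxMonoidal.μ_natural_left_assoc, ← G.map_comp,
    ihom_map_app_ev, G.map_comp, ← LaxMonoidal.μ_natural_right_assoc, ← whisker_exchange_assoc,
    homComparisonInv_ev]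

/-- A monoidal equivalence between closed monoidal categories is compatible with internal homs. -/
noncomputable def closedMonoidalEquivalence : ClosedMonoidalEquivalence G where
  isEquivalence := inferInstance
  -- This is the given monoidal structure on `G`, so the tensor and unit maps extracted from the
  -- result unfold to the `μ` and `ε` of `G`.
  monoidal := inferInstance
  γ := NatIso.ofComponents
    (fun V => NatIso.ofComponents (fun W => homIso G V.unop W)
      (fun g => homIso_natural_right G V.unop g))
    (fun f => by
      ext W
      exact homIso_natural_left G f.unop W)
  γ_ev V W := homComparisonInv_ev G V W

end RightMonoidalClosed

/-! ### The coherence map for internal homs of bimodules as a restriction of an ambient one. -/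

namespace BimodFunctor

open Functor RightMonoidalClosed

section

variable {C : Type*} [Category C] [MonoidalCategory C] [HasCoequalizers C]
  [∀ X : C, PreservesColimitsOfSize.{0, 0} (tensorLeft X)]
  [∀ X : C, PreservesColimitsOfSize.{0, 0} (tensorRight X)] [RightMonoidalClosed C]
  [HasEqualizers C] {A : Mon C} (V W : Bimod A A)

/-- The inclusion of the internal hom of bimodules into the internal hom. -/
noncomputable def inclHom :
    (RightMonoidalClosed.hom V W).X ⟶ RightMonoidalClosed.hom V.X W.X :=
  BimodHom.incl V W

/-- The evaluation of bimodules is the uncurried identity, hence the descent of the ambient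
evaluation restricted to right linear maps. -/
theorem bimodProj_ev :
    bimodProj (RightMonoidalClosed.hom V W) V ≫ (ev V W).hom =
      inclHom V W ▷ V.X ≫ ev V.X W.X := by
  refine (BimodHom.bimodProj_uncurryHom (𝟙 (RightMonoidalClosed.hom V W))).trans ?_
  change 𝟙 (BimodHom.homA V W) ▷ V.X ≫ BimodHom.evA V W = _
  rw [id_whiskerRight, Category.id_comp]
  rfl

end

variable {C D : Type*} [Category C] [MonoidalCategory C] [Category D] [MonoidalCategory D]
  [HasCoequalizers C] [∀ X : C, PreservesColimitsOfSize.{0, 0} (tensorLeft X)]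
  [∀ X : C, PreservesColimitsOfSize.{0, 0} (tensorRight X)]
  [HasCoequalizers D] [∀ X : D, PreservesColimitsOfSize.{0, 0} (tensorLeft X)]
  [∀ X : D, PreservesColimitsOfSize.{0, 0} (tensorRight X)]
  [RightMonoidalClosed C] [HasEqualizers C] [RightMonoidalClosed D] [HasEqualizers D]
  (F : C ⥤ D) [F.Monoidal] [F.IsEquivalence] {A : Mon C} (V W : Bimod A A)

/-- The isomorphism `hom_{F(A)}(F(V), F(W)) ⟶ F(hom_A(V, W))` on underlying objects. -/
noncomputable def homMap :
    (RightMonoidalClosed.hom ((bimodFunctor F A).obj V) ((bimodFunctor F A).obj W)).X ⟶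
      F.obj (RightMonoidalClosed.hom V W).X :=
  (homComparisonInv (bimodFunctor F A) V W).hom

/-- The inclusion `hom_{F(A)}(F(V), F(W)) ⟶ hom(F(V), F(W))`. -/
noncomputable def imageInclHom :
    (RightMonoidalClosed.hom ((bimodFunctor F A).obj V) ((bimodFunctor F A).obj W)).X ⟶
      RightMonoidalClosed.hom (F.obj V.X) (F.obj W.X) :=
  inclHom ((bimodFunctor F A).obj V) ((bimodFunctor F A).obj W)

/-- The compatibility of the bimodule coherence map with the evaluations over `A` and `F(A)`, pulled
back to the ambient tensor product. In this form it mentions only the ambient evaluations and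
tensorator. -/
theorem homMap_ev :
    homMap F V W ▷ F.obj V.X ≫ LaxMonoidal.μ F (RightMonoidalClosed.hom V W).X V.X ≫
        F.map (inclHom V W ▷ V.X ≫ ev V.X W.X) =
      imageInclHom F V W ▷ F.obj V.X ≫ ev (F.obj V.X) (F.obj W.X) := by
  have h := congrArg (fun f => bimodProj (RightMonoidalClosed.hom ((bimodFunctor F A).obj V)
    ((bimodFunctor F A).obj W)) ((bimodFunctor F A).obj V) ≫ f.hom)
    (homComparisonInv_ev (bimodFunctor F A) V W)
  have h1 : projRight F (RightMonoidalClosed.hom ((bimodFunctor F A).obj V)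
      ((bimodFunctor F A).obj W)) V ≫
      (homComparisonInv (bimodFunctor F A) V W ▷ (bimodFunctor F A).obj V).hom =
      homMap F V W ▷ F.obj V.X ≫ proj F (RightMonoidalClosed.hom V W) V :=
    bimodProj_whiskerRight (homComparisonInv (bimodFunctor F A) V W) ((bimodFunctor F A).obj V)
  -- Rewrites the left side of `h` on representatives: the projection passes through the whiskering
  -- and turns `tensorHom` into the tensorator of `F`.
  have h2 := (reassoc_of% h1) (tensorHom F (RightMonoidalClosed.hom V W) V ≫ F.map (ev V W).hom)
  rw [reassoc_of% (proj_tensorHom F (RightMonoidalClosed.hom V W) V), ← F.map_comp,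
    bimodProj_ev] at h2
  exact h2.symm.trans (h.trans (bimodProj_ev ((bimodFunctor F A).obj V)
    ((bimodFunctor F A).obj W)))

/-- The isomorphism `hom_{F(A)}(F(V), F(W)) ⟶ F(hom_A(V, W))` is the restriction of any map
`hom(F(V), F(W)) ⟶ F(hom(V, W))` that is compatible with the evaluations. -/
theorem homMap_incl
    (γ : RightMonoidalClosed.hom (F.obj V.X) (F.obj W.X) ⟶ F.obj (RightMonoidalClosed.hom V.X W.X))
    (hγ : γ ▷ F.obj V.X ≫ LaxMonoidal.μ F _ V.X ≫ F.map (ev V.X W.X) =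
      ev (F.obj V.X) (F.obj W.X)) :
    homMap F V W ≫ F.map (inclHom V W) = imageInclHom F V W ≫ γ := by
  -- Both sides are maps into the image of the ambient internal hom, so equality of their
  -- evaluations suffices; these agree by `hγ` and `homMap_ev`. In particular, that the ambient map
  -- carries right linear maps to right linear maps needs no separate check.
  apply hom_ext_map_ev
  rw [comp_whiskerRight_assoc, comp_whiskerRight_assoc, hγ, LaxMonoidal.μ_natural_left_assoc,
    ← F.map_comp, ← homMap_ev]

end BimodFunctor

/-! ### The explicit coherence map for internal homs under a cochain twist. -/

namespace CochainTwist

open QHMod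

variable {k : Type u} {H : Type v} [CommRing k] [Ring H] [Algebra k H]
  {Q : QuasiHopfAlgebra k H} (T : CochainTwist Q)

/-- A left factor $1 \otimes Y$ is absorbed into the middle element because the antipode reverses
products. For $Y = F^{-1}$ and $a = \alpha$ the new middle element is $\alpha_F$. -/
theorem foldLeft_oneTmul (S : H ≃ₐ[k] Hᵐᵒᵖ) (a : H) (Y : H ⊗[k] H) (X : H ⊗[k] (H ⊗[k] H)) :
    foldLeft (antiLin S) a (oneTmul H (H ⊗[k] H) Y * X) =
      foldLeft (antiLin S) (sandwichLeft (antiLin S) a Y) X := by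
  induction X with
  | zero => simp
  | tmul x Z => simp [sandwichLeft_mul]
  | add X Z hX hZ => rw [mul_add, map_add, map_add, hX, hZ]

/-- The evaluation element of the twisted quasi-Hopf algebra. -/
theorem foldLeft_assoc_twist :
    foldLeft (antiLin Q.antipode) Q.α ((Q.assoc : H ⊗[k] (H ⊗[k] H)) *
      comulFst Q.comul H ((T.F⁻¹ : (H ⊗[k] H)ˣ) : H ⊗[k] H) *
        tmulOne H H ((T.F⁻¹ : (H ⊗[k] H)ˣ) : H ⊗[k] H)) = T.twist.evElem := by
  -- By `assoc_elem` the argument equals $(\mathrm{id} \otimes \Delta)(F^{-1})\,(1 \otimes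
  -- F^{-1})\,\phi_F$. The first factor collapses to $(\mathrm{id} \otimes \epsilon)(F^{-1}) = 1$ by
  -- the antipode axiom, and the second turns $\alpha$ into $\alpha_F$.
  rw [T.assoc_elem, mul_assoc, Q.foldLeft_comul, T.counitSnd_inv, foldLeft_oneTmul,
    ← Algebra.TensorProduct.one_def, one_mul]
  rfl

section Functor

variable (V W : QHMod Q)

/-- The action of `F⁻¹` on `hom(V, W)` as an equivariant map. -/
noncomputable def internalHomTwist :
    internalHom (T.obj V) (T.obj W) ⟶ T.obj (internalHom V W) :=
  ofLin (V := internalHom (T.obj V) (T.obj W)) (W := T.obj (internalHom V W))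
    (homAct Q.antipode V.act W.act ((T.F⁻¹ : (H ⊗[k] H)ˣ) : H ⊗[k] H)) (fun h => by
      -- The antipode is not twisted, so the two adjoint actions differ only in the coproduct. As
      -- `homAct` is an algebra homomorphism, equivariance reduces to $F^{-1} \Delta_F(h) =
      -- \Delta(h) F^{-1}$.
      change homAct Q.antipode V.act W.act ((T.F⁻¹ : (H ⊗[k] H)ˣ) : H ⊗[k] H) ∘ₗ
          homAct Q.antipode V.act W.act (T.comul h) =
        homAct Q.antipode V.act W.act (Q.comul h) ∘ₗ
          homAct Q.antipode V.act W.act ((T.F⁻¹ : (H ⊗[k] H)ˣ) : H ⊗[k] H)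
      rw [← Module.End.mul_eq_comp, ← Module.End.mul_eq_comp, ← map_mul, ← map_mul, comul,
        conjHom_apply, ← mul_assoc, ← mul_assoc, Units.inv_mul, one_mul])

/-- The two occurrences of $F^{-1}$, one from the tensorator and one from the map on internal homs,
multiply the associator on the right by $(\Delta \otimes \mathrm{id})(F^{-1})$ and $F^{-1} \otimes
1$. The result is the element computed in `foldLeft_assoc_twist`. -/
theorem evLin_twist :
    (evLin V.act W.act Q.evElem ∘ₗ tensorAct ((homAct Q.antipode V.act W.act).comp Q.comul) V.act
      ((T.F⁻¹ : (H ⊗[k] H)ˣ) : H ⊗[k] H)) ∘ₗ LinearMap.rTensor V.carrier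
        (homAct Q.antipode V.act W.act ((T.F⁻¹ : (H ⊗[k] H)ˣ) : H ⊗[k] H)) =
      evLin V.act W.act T.twist.evElem := by
  rw [QuasiHopfAlgebra.evElem, evLin_comp_tensorAct, ← T.foldLeft_assoc_twist]
  apply TensorProduct.ext'
  intro L v
  -- The third tensor factor is taken to be `1`, because this copy of $F^{-1}$ acts on the linear
  -- map alone and not on `v`.
  have h := LinearMap.congr_fun (biAct_foldLeft_assoc Q.antipode Q.α V.act W.act
    ((Q.assoc : H ⊗[k] (H ⊗[k] H)) * comulFst Q.comul H ((T.F⁻¹ : (H ⊗[k] H)ˣ) : H ⊗[k] H))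
    ((T.F⁻¹ : (H ⊗[k] H)ˣ) : H ⊗[k] H) 1 L) v
  rw [assoc_tmul_one, map_one] at h
  rw [LinearMap.comp_apply, LinearMap.rTensor_tmul, evLin_tmul, evLin_tmul]
  exact h

/-- The linear identity `evLin_twist`, read in the closed categories. This is the hypothesis that
`homMap_incl` requires of the ambient map. -/
theorem internalHomTwist_ev :
    (show RightMonoidalClosed.hom (T.functor.obj V) (T.functor.obj W) ⟶
        T.functor.obj (RightMonoidalClosed.hom V W) from T.internalHomTwist V W) ▷
          T.functor.obj V ≫
        Functor.LaxMonoidal.μ T.functor (RightMonoidalClosed.hom V W) V ≫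
          T.functor.map (RightMonoidalClosed.ev V W) =
      RightMonoidalClosed.ev (T.functor.obj V) (T.functor.obj W) := by
  apply hom_ext
  apply TensorProduct.ext'
  intro L v
  refine Eq.trans ?_ ((LinearMap.congr_fun (T.evLin_twist V W) (L ⊗ₜ v)).trans ?_)
  · have h : lin (RightMonoidalClosed.ev V W) = evLin V.act W.act Q.evElem :=
      TensorProduct.ext' (fun L v => (lin_ev_tmul V W L v).trans (evLin_tmul _ _ _ _ _).symm)
    rw [← h]
    rfl
  · exact (evLin_tmul _ _ _ _ _).trans (lin_ev_tmul (T.functor.obj V) (T.functor.obj W) L v).symm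

instance : T.functor.Faithful where
  map_injective {V W} _ _ h :=
    hom_ext (congrArg (lin (V := T.obj V) (W := T.obj W)) h)

instance : T.functor.Full where
  map_surjective {V W} f :=
    ⟨ofLin (lin (V := T.obj V) (W := T.obj W) f) (lin_comm (V := T.obj V) (W := T.obj W) f), rfl⟩

instance : T.functor.EssSurj where
  -- As $H_F$ and $H$ are the same algebra, every $H_F$-module is literally the image of the
  -- $H$-module with the same action.
  mem_essImage N := ⟨{ carrier := N.carrier, act := N.act }, ⟨Iso.refl _⟩⟩

instance : T.functor.IsEquivalence where

end Functor

end CochainTwist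

/-- Tensor products over $A$ and $\mathrm{hom}_A$ are abstract coequalizers and equalizers. The
coherence maps are therefore described after projection and after inclusion, which determines them
because `bimodProj` is an epimorphism and `BimodHom.incl` an equalizer inclusion. -/
theorem mainTheorem2 {k : Type u} {H : Type v} [CommRing k] [Ring H] [Algebra k H]
    (Q : QuasiHopfAlgebra k H) (T : CochainTwist Q) (A : Mon (QHMod Q)) :
    ∃ E : ClosedMonoidalEquivalence (bimodFunctor T.functor A),
      (∀ (V W : Bimod A A) (v : V.X.carrier) (w : W.X.carrier),
        QHMod.lin (E.tensorMap V W).hom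
            (QHMod.projA ((bimodFunctor T.functor A).obj V) ((bimodFunctor T.functor A).obj W)
              (v ⊗ₜ[k] w)) =
          QHMod.projA V W
            (tensorAct V.X.act W.X.act ((T.F⁻¹ : (H ⊗[k] H)ˣ) : H ⊗[k] H) (v ⊗ₜ[k] w))) ∧
      (∀ a : A.X.carrier, QHMod.lin E.unitMap.hom a = a) ∧
      (∀ (V W : Bimod A A)
          (L : (RightMonoidalClosed.hom ((bimodFunctor T.functor A).obj V)
            ((bimodFunctor T.functor A).obj W)).X.carrier),
        QHMod.inclA V W (QHMod.lin (E.homMap V W).hom L) =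
          homAct Q.antipode V.X.act W.X.act ((T.F⁻¹ : (H ⊗[k] H)ˣ) : H ⊗[k] H)
            (QHMod.inclA ((bimodFunctor T.functor A).obj V)
              ((bimodFunctor T.functor A).obj W) L)) := by
  refine ⟨RightMonoidalClosed.closedMonoidalEquivalence _, fun V W v w => ?_, fun a => ?_,
    fun V W L => ?_⟩
  -- The tensor map of the equivalence unfolds to `tensorHom`, and the tensorator of `T.functor` to
  -- the action of $F^{-1}$.
  · exact LinearMap.congr_fun (congrArg QHMod.lin (BimodFunctor.proj_tensorHom T.functor V W))
      (v ⊗ₜ w)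
  · rfl
  -- The coherence map was constructed abstractly; its formula follows from uniqueness, with
  -- `internalHomTwist` as the ambient map.
  · exact LinearMap.congr_fun (congrArg QHMod.lin (BimodFunctor.homMap_incl T.functor V W
      (T.internalHomTwist V.X W.X) (T.internalHomTwist_ev V.X W.X))) L
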